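/- **Theorem.** For all integers $k\ge 1$ and $d\ge 1$, the octahedron $K_{2,2,2}$ is not a $9$-fat minor of the NSS graph $G_{k,d}$. Here the *NSS graph* $G_{k,d}$ of height $k$ and division $d$ (the Nguyen–Scott–Seymour graph), together with five distinguished vertices $S_0,S_1,T_1,T_0,R$, is defined by recursion on $k$. The graph $G_{1,d}$ is obtained from the $5$-cycle $R\,S_0\,S_1\,T_1\,T_0\,R$ by subdividing every edge into a path of length $d$. For $k\ge 2$, take two disjoint copies $\Delta_0,\Delta_1$ of $G_{k-1,d}$; identify $T_1(\Delta_0)$ with $S_0(\Delta_1)$ and $T_0(\Delta_0)$ with $S_1(\Delta_1)$; delete one of the two resulting parallel paths of length $d$ between the two identified vertices (the path from $T_1$ to $T_0$ of $\Delta_0$ and the path from $S_0$ to $S_1$ of $\Delta_1$); and add a new vertex $R$ adjacent to $R(\Delta_0)$ and $R(\Delta_1)$. In $G_{k,d}$ set $S_i:=S_i(\Delta_0)$ and $T_i:=T_i(\Delta_1)$ for $i\in\{0,1\}$, and let $R$ be the new vertex. A *model* of a graph $J$ in a graph $G$ consists of pairwise disjoint non-empty connected sets $U_x\subseteq V(G)$,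 one for each $x\in V(J)$, and internally disjoint paths $E_e$ in $G$, one for each edge $e=xy\in E(J)$, such that $E_e$ meets $U_x$ precisely in its first vertex and $U_y$ precisely in its last vertex and is disjoint from $U_z$ for every $z\ne x,y$. It is *$K$-fat* if any two distinct members $Y,Z$ of the family of all $U_x$ and all $E_e$ have distance at least $K$ in $G$, unless one of them is some $E_e$ and the other is some $U_x$ with $x$ an end of $e$. The graph $J$ is a *$K$-fat minor* of $G$ if $G$ contains a $K$-fat model of $J$. -/

import Mathlib

/-! ### Fat minors -/

namespace FatMinor

variable {V W : Type*}

/-- Two vertex sets `Y`, `Z` of `G` have distance at least `K` in `G`. -/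
def FarApart (G : SimpleGraph V) (K : ℕ) (Y Z : Set V) : Prop :=
  ∀ y ∈ Y, ∀ z ∈ Z, (K : ℕ∞) ≤ G.edist y z

/-- `p` is an `A`--`B` path: a path that meets `A` precisely in its first vertex and
`B` precisely in its last vertex. -/
def IsSetPath {G : SimpleGraph V} (A B : Set V) {a b : V} (p : G.Walk a b) : Prop :=
  p.IsPath ∧ (∀ v ∈ p.support, v ∈ A ↔ v = a) ∧ (∀ v ∈ p.support, v ∈ B ↔ v = b)

/-- A model of `J` in `G`: disjoint connected (in particular nonempty) branch sets `U_x`, one for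
each vertex of `J`, and internally disjoint branch paths `E_e`, one for each edge `e = xy` of `J`,
where `E_e` is a `U_x`--`U_y` path avoiding all other branch sets. -/
structure Model (J : SimpleGraph W) (G : SimpleGraph V) where
  branchSet : W → Set V
  connected : ∀ x, (G.induce (branchSet x)).Connected
  disjoint : ∀ x y, x ≠ y → Disjoint (branchSet x) (branchSet y)
  first : J.edgeSet → V
  last : J.edgeSet → V
  branchPath : ∀ e, G.Walk (first e) (last e)
  joins : ∀ e : J.edgeSet, ∃ x y, (e : Sym2 W) = s(x, y) ∧
    IsSetPath (branchSet x) (branchSet y) (branchPath e)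
  avoids : ∀ (e : J.edgeSet) (z : W), z ∉ (e : Sym2 W) →
    ∀ v ∈ (branchPath e).support, v ∉ branchSet z
  internally_disjoint : ∀ e f : J.edgeSet, e ≠ f →
    ∀ v ∈ (branchPath e).support, v ∈ (branchPath f).support →
      (v = first e ∨ v = last e) ∧ (v = first f ∨ v = last f)

/-- The vertex set of the branch path of the edge `e`. -/
def Model.pathSet {J : SimpleGraph W} {G : SimpleGraph V} (M : Model J G) (e : J.edgeSet) :
    Set V :=
  {v | v ∈ (M.branchPath e).support}

/-- A model is `K`-fat if any two distinct members of the family of all branch sets and branch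
paths are at distance at least `K`, except for a branch path `E_e` and a branch set `U_x` such
that `x` is an end of `e`. -/
def Model.IsFat {J : SimpleGraph W} {G : SimpleGraph V} (M : Model J G) (K : ℕ) : Prop :=
  (∀ x y, x ≠ y → FarApart G K (M.branchSet x) (M.branchSet y)) ∧
  (∀ e f, e ≠ f → FarApart G K (M.pathSet e) (M.pathSet f)) ∧
  (∀ (e : J.edgeSet) (z : W), z ∉ (e : Sym2 W) → FarApart G K (M.pathSet e) (M.branchSet z))

/-- `J` is a `K`-fat minor of `G`. -/
def IsFatMinor (K : ℕ) (J : SimpleGraph W) (G : SimpleGraph V) : Prop :=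
  ∃ M : Model J G, M.IsFat K

end FatMinor

/-! ### NSS graphs

The NSS graph of height `k` and division `d` is written down in coordinates.  It has `2 ^ (k - 1)`
trigons of height `1`, numbered `0, 1, …` from left to right, and more generally `2 ^ (k - h)`
trigons of height `h`.  Its vertices are:

* `tree h i`, the root of the `i`-th trigon of height `h`;
* `bottom p`, the vertices of the bottom path, which has length `(2 ^ k + 1) * d`;
  its vertices `bottom (j * d)` are the unsubdivided ones;
* `leg i r t` with `0 < t < d`, the `t`-th subdivision vertex on the left (`r = false`) or right
  (`r = true`) dotted path from the root `tree 1 i` of the `i`-th trigon of height `1` down to the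
  bottom path.

In the `i`-th trigon of height `1` the four vertices `S₀, S₁, T₁, T₀` are `bottom (j * d)` for
`j = 2 * i, 2 * i + 1, 2 * i + 2, 2 * i + 3`, and the two dotted paths from its root lead to `S₀`
and `T₀`.  So `T₁, T₀` of a trigon of height `1` are `S₀, S₁` of the next one.  More generally,
the `i`-th trigon of height `h` has `S₀, S₁, T₁, T₀` equal to `bottom (j * d)` for
`j = i * 2 ^ h, i * 2 ^ h + 1, (i + 1) * 2 ^ h, (i + 1) * 2 ^ h + 1`.

For `k = 1` this is the cycle `R, S₀, S₁, T₁, T₀` with each edge subdivided into a path of length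
`d`.  That the passage from `k` to `k + 1` is the recursive construction (two copies of the graph of height `k`, glued along the
`d`-path between `T₁, T₀` of the first and `S₀, S₁` of the second, and a new root joined to the two
old roots) is verified in `mem_vertexSet_succ_iff`, `mem_inter_shift_iff` and `edge_succ_iff`
below. -/

namespace NSS

inductive Label : Type
  | tree (h i : ℕ)
  | bottom (p : ℕ)
  | leg (i : ℕ) (r : Bool) (t : ℕ)

open Label

/-- The `t`-th vertex (`0 ≤ t ≤ d`) of the left or right dotted path of length `d` that leads from
`tree 1 i` to the bottom path. -/
def legPoint (d i : ℕ) (r : Bool) (t : ℕ) : Label :=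
  if t = 0 then tree 1 i
  else if t < d then leg i r t
  else bottom ((if r then 2 * i + 3 else 2 * i) * d)

/-- The edges, each listed in one direction. -/
inductive Link (d : ℕ) : Label → Label → Prop
  | tree (h i : ℕ) : Link d (tree h i) (tree (h + 1) (i / 2))
  | bottom (p : ℕ) : Link d (bottom p) (bottom (p + 1))
  | leg (i : ℕ) (r : Bool) (t : ℕ) (ht : t < d) :
      Link d (legPoint d i r t) (legPoint d i r (t + 1))

/-- The vertices of the NSS graph of height `k` and division `d`. -/
def vertexSet (k d : ℕ) : Set Label :=
  {v | match v with
    | tree h i => 1 ≤ h ∧ h ≤ k ∧ i < 2 ^ (k - h)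
    | bottom p => p ≤ (2 ^ k + 1) * d
    | leg i _ t => i < 2 ^ (k - 1) ∧ 0 < t ∧ t < d}

/-- The NSS graph `G_{k,d}` of height `k ≥ 1` and division `d ≥ 1`. -/
def graph (k d : ℕ) : SimpleGraph (vertexSet k d) :=
  SimpleGraph.fromRel fun u v => Link d u v

/-- The labels `u`, `v` are the ends of an edge of `G_{k,d}`. -/
def Edge (k d : ℕ) (u v : Label) : Prop :=
  ∃ (hu : u ∈ vertexSet k d) (hv : v ∈ vertexSet k d), (graph k d).Adj ⟨u, hu⟩ ⟨v, hv⟩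

/-- The embedding of the second copy of `G_{k,d}` into `G_{k+1,d}`; the first copy is embedded by
the identity on labels. -/
def shift (k d : ℕ) : Label → Label
  | tree h i => tree h (i + 2 ^ (k - h))
  | bottom p => bottom (p + 2 ^ k * d)
  | leg i r t => leg (i + 2 ^ (k - 1)) r t

theorem shift_injective (k d : ℕ) : Function.Injective (shift k d) := by
  intro u v h
  cases u <;> cases v <;> simp_all [shift]
  have h1 := h.1
  subst h1
  simpa using h.2

/-- `G_{k+1,d}` consists of the two copies of `G_{k,d}` and the new root. -/
theorem mem_vertexSet_succ_iff {k d : ℕ} (hk : 1 ≤ k) (v : Label) :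
    v ∈ vertexSet (k + 1) d ↔
      v ∈ vertexSet k d ∨ v ∈ shift k d '' vertexSet k d ∨ v = tree (k + 1) 0 := by
  obtain ⟨m, rfl⟩ : ∃ m, k = m + 1 := ⟨k - 1, by omega⟩
  constructor
  · intro hv
    cases v with
    | tree h i =>
      obtain ⟨h1, h2, h3⟩ : 1 ≤ h ∧ h ≤ m + 1 + 1 ∧ i < 2 ^ (m + 1 + 1 - h) := hv
      rcases Nat.lt_or_ge (m + 1) h with h4 | h4
      · obtain rfl : h = m + 1 + 1 := by omega
        simp at h3
        simp [h3]
      · rw [Nat.succ_sub h4, pow_succ] at h3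
        by_cases h5 : i < 2 ^ (m + 1 - h)
        · exact Or.inl ⟨h1, h4, h5⟩
        · refine Or.inr (Or.inl ⟨tree h (i - 2 ^ (m + 1 - h)), ⟨h1, h4, by omega⟩, ?_⟩)
          simp only [shift]
          congr 1
          omega
    | bottom p =>
      have h1 : p ≤ (2 ^ (m + 1 + 1) + 1) * d := hv
      by_cases h2 : p ≤ (2 ^ (m + 1) + 1) * d
      · exact Or.inl h2
      · have h3 : 2 ^ (m + 1) * d ≤ p := by nlinarith
        refine Or.inr (Or.inl ⟨bottom (p - 2 ^ (m + 1) * d), ?_, ?_⟩)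
        · change p - 2 ^ (m + 1) * d ≤ (2 ^ (m + 1) + 1) * d
          rw [Nat.sub_le_iff_le_add]
          calc p ≤ _ := h1
            _ = _ := by ring
        · simp only [shift]
          congr 1
          omega
    | leg i r t =>
      obtain ⟨h1, h2⟩ : i < 2 ^ (m + 1) ∧ 0 < t ∧ t < d := hv
      rw [pow_succ] at h1
      by_cases h3 : i < 2 ^ m
      · exact Or.inl ⟨h3, h2⟩
      · refine Or.inr (Or.inl ⟨leg (i - 2 ^ m) r t, ⟨?_, h2⟩, ?_⟩)
        · simp only [Nat.add_sub_cancel]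
          omega
        · simp only [shift, Nat.add_sub_cancel]
          congr 1
          omega
  · rintro (hv | ⟨u, hu, rfl⟩ | rfl)
    · cases v with
      | tree h i =>
        obtain ⟨h1, h2, h3⟩ : 1 ≤ h ∧ h ≤ m + 1 ∧ i < 2 ^ (m + 1 - h) := hv
        refine ⟨h1, by omega, h3.trans_le (Nat.pow_le_pow_right (by norm_num) (by omega))⟩
      | bottom p =>
        have h1 : p ≤ (2 ^ (m + 1) + 1) * d := hv
        refine h1.trans (Nat.mul_le_mul_right d ?_)
        have := Nat.pow_le_pow_right (n := 2) (by norm_num) (Nat.le_succ (m + 1))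
        omega
      | leg i r t =>
        exact ⟨hv.1.trans_le (Nat.pow_le_pow_right (by norm_num) (by omega)), hv.2⟩
    · cases u with
      | tree h i =>
        obtain ⟨h1, h2, h3⟩ : 1 ≤ h ∧ h ≤ m + 1 ∧ i < 2 ^ (m + 1 - h) := hu
        refine ⟨h1, by omega, ?_⟩
        rw [Nat.succ_sub h2, pow_succ]
        omega
      | bottom p =>
        have h1 : p ≤ (2 ^ (m + 1) + 1) * d := hu
        change p + 2 ^ (m + 1) * d ≤ (2 ^ (m + 1 + 1) + 1) * d
        calc p + 2 ^ (m + 1) * d ≤ (2 ^ (m + 1) + 1) * d + 2 ^ (m + 1) * d := by omega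
          _ = _ := by ring
      | leg i r t =>
        obtain ⟨h1, h2⟩ : i < 2 ^ m ∧ 0 < t ∧ t < d := hu
        refine ⟨?_, h2⟩
        simp only [Nat.add_sub_cancel]
        rw [pow_succ]
        omega
    · exact ⟨by omega, le_rfl, by simp⟩

/-- The two copies share exactly the `d`-path from `T₁` to `T₀` of the first copy, which is the
`d`-path from `S₀` to `S₁` of the second copy. -/
theorem mem_inter_shift_iff {k d : ℕ} {u v : Label} (hu : u ∈ vertexSet k d)
    (hv : v ∈ vertexSet k d) :
    u = shift k d v ↔ ∃ t ≤ d, u = bottom (2 ^ k * d + t) ∧ v = bottom t := by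
  constructor
  · rintro rfl
    cases v with
    | tree h i => exact absurd hu.2.2 (by omega)
    | leg i r t => exact absurd hu.1 (by omega)
    | bottom p =>
      have h1 : p + 2 ^ k * d ≤ (2 ^ k + 1) * d := hu
      refine ⟨p, by linarith, ?_, rfl⟩
      simp only [shift]
      rw [add_comm]
  · rintro ⟨t, -, rfl, rfl⟩
    simp only [shift]
    rw [add_comm]

theorem shift_legPoint {k : ℕ} (hk : 1 ≤ k) (d i : ℕ) (r : Bool) (t : ℕ) :
    shift k d (legPoint d i r t) = legPoint d (i + 2 ^ (k - 1)) r t := by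
  obtain ⟨m, rfl⟩ : ∃ m, k = m + 1 := ⟨k - 1, by omega⟩
  unfold legPoint
  split_ifs <;> simp only [shift, Nat.add_sub_cancel] <;> congr 1 <;> ring

theorem Link.shift {k d : ℕ} {u v : Label} (hv : v ∈ vertexSet k d) (h : Link d u v)
    (hk : 1 ≤ k) : Link d (shift k d u) (shift k d v) := by
  cases h with
  | tree h i =>
    have h1 : h + 1 ≤ k := hv.2.1
    obtain ⟨m, rfl⟩ : ∃ m, k = m + 1 + h := ⟨k - h - 1, by omega⟩
    have e : (i + 2 ^ (m + 1)) / 2 = i / 2 + 2 ^ m := by rw [pow_succ]; omega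
    have e1 : m + 1 + h - h = m + 1 := by omega
    have e2 : m + 1 + h - (h + 1) = m := by omega
    simp only [NSS.shift, e1, e2, ← e]
    exact Link.tree _ _
  | bottom p =>
    simp only [NSS.shift, Nat.add_right_comm p 1]
    exact Link.bottom _
  | leg i r t ht =>
    rw [shift_legPoint hk, shift_legPoint hk]
    exact Link.leg _ _ _ ht

theorem Link.ne {d : ℕ} {u v : Label} (h : Link d u v) : u ≠ v := by
  cases h with
  | tree h i => simp
  | bottom p => simp
  | leg i r t ht =>
    unfold legPoint
    split_ifs <;> simp_all

theorem edge_iff {k d : ℕ} {u v : Label} :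
    Edge k d u v ↔ u ∈ vertexSet k d ∧ v ∈ vertexSet k d ∧ (Link d u v ∨ Link d v u) := by
  constructor
  · rintro ⟨hu, hv, -, h⟩
    exact ⟨hu, hv, h⟩
  · rintro ⟨hu, hv, h⟩
    refine ⟨hu, hv, fun e => ?_, h⟩
    have e' : u = v := congrArg Subtype.val e
    exact h.elim (fun h => h.ne e') (fun h => h.ne e'.symm)

theorem legPoint_mem_iff {k d i : ℕ} {r : Bool} {t : ℕ} (hk : 1 ≤ k) (ht : t < d) :
    legPoint d i r t ∈ vertexSet k d ↔ i < 2 ^ (k - 1) := by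
  unfold legPoint
  by_cases h : t = 0
  · simp [h, vertexSet, hk]
  · simp [h, ht, vertexSet]
    omega

theorem legPoint_mem {k d i : ℕ} {r : Bool} {t : ℕ} (hk : 1 ≤ k) (hi : i < 2 ^ (k - 1)) :
    legPoint d i r t ∈ vertexSet k d := by
  obtain ⟨m, rfl⟩ : ∃ m, k = m + 1 := ⟨k - 1, by omega⟩
  simp only [Nat.add_sub_cancel] at hi
  unfold legPoint
  split_ifs with h1 h2 h3
  · exact ⟨le_rfl, hk, hi⟩
  · exact ⟨hi, by omega, h2⟩
  · refine Nat.mul_le_mul_right d ?_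
    rw [pow_succ]
    omega
  · refine Nat.mul_le_mul_right d ?_
    rw [pow_succ]
    omega

theorem link_succ {k d : ℕ} (hk : 1 ≤ k) {u v : Label} (hu : u ∈ vertexSet (k + 1) d)
    (hv : v ∈ vertexSet (k + 1) d) (h : Link d u v) :
    (u ∈ vertexSet k d ∧ v ∈ vertexSet k d) ∨
      (∃ u' v', u' ∈ vertexSet k d ∧ v' ∈ vertexSet k d ∧ Link d u' v' ∧
        u = shift k d u' ∧ v = shift k d v') ∨
      (v = tree (k + 1) 0 ∧ (u = tree k 0 ∨ u = tree k 1)) := by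
  cases h with
  | tree h i =>
    obtain ⟨h1, h2, h3⟩ : 1 ≤ h ∧ h ≤ k + 1 ∧ i < 2 ^ (k + 1 - h) := hu
    have h4 : h + 1 ≤ k + 1 := hv.2.1
    by_cases h5 : h = k
    · subst h5
      have : i < 2 := by simpa using h3
      refine Or.inr (Or.inr ⟨?_, ?_⟩)
      · congr 1
        omega
      · interval_cases i <;> simp
    · obtain ⟨m, rfl⟩ : ∃ m, k = m + 1 + h := ⟨k - h - 1, by omega⟩
      have e0 : m + 1 + h + 1 - h = m + 2 := by omega
      have e1 : m + 1 + h - h = m + 1 := by omega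
      have e2 : m + 1 + h - (h + 1) = m := by omega
      have p1 : 2 ^ (m + 2) = 4 * 2 ^ m := by ring
      have p2 : 2 ^ (m + 1) = 2 * 2 ^ m := by ring
      rw [e0] at h3
      by_cases h6 : i < 2 ^ (m + 1)
      · refine Or.inl ⟨⟨h1, by omega, by rwa [e1]⟩, ⟨by omega, by omega, ?_⟩⟩
        rw [e2]
        omega
      · refine Or.inr (Or.inl ⟨tree h (i - 2 ^ (m + 1)), tree (h + 1) ((i - 2 ^ (m + 1)) / 2),
          ⟨h1, by omega, ?_⟩, ⟨by omega, by omega, ?_⟩, Link.tree _ _, ?_, ?_⟩)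
        · rw [e1]
          omega
        · rw [e2]
          omega
        · simp only [shift, e1]
          congr 1
          omega
        · simp only [shift, e2]
          congr 1
          omega
  | bottom p =>
    have h1 : p + 1 ≤ (2 ^ (k + 1) + 1) * d := hv
    have e : (2 ^ (k + 1) + 1) * d = 2 ^ k * d + (2 ^ k + 1) * d := by ring
    by_cases h2 : p + 1 ≤ (2 ^ k + 1) * d
    · exact Or.inl ⟨show p ≤ _ by omega, h2⟩
    · have h3 : 2 ^ k * d ≤ p := by nlinarith
      refine Or.inr (Or.inl ⟨bottom (p - 2 ^ k * d), bottom (p - 2 ^ k * d + 1),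
        show p - 2 ^ k * d ≤ (2 ^ k + 1) * d by omega,
        show p - 2 ^ k * d + 1 ≤ (2 ^ k + 1) * d by omega, Link.bottom _, ?_, ?_⟩) <;>
      · simp only [shift]
        congr 1
        omega
  | leg i r t ht =>
    have hi : i < 2 ^ (k + 1 - 1) := (legPoint_mem_iff (by omega) ht).1 hu
    obtain ⟨m, rfl⟩ : ∃ m, k = m + 1 := ⟨k - 1, by omega⟩
    simp only [Nat.add_sub_cancel, pow_succ] at hi
    by_cases h2 : i < 2 ^ m
    · exact Or.inl ⟨legPoint_mem hk h2, legPoint_mem hk h2⟩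
    · have h3 : i - 2 ^ m < 2 ^ (m + 1 - 1) := by
        simp only [Nat.add_sub_cancel]
        omega
      have h4 : i - 2 ^ m + 2 ^ (m + 1 - 1) = i := by
        simp only [Nat.add_sub_cancel]
        omega
      refine Or.inr (Or.inl ⟨_, _, legPoint_mem hk h3, legPoint_mem hk h3, Link.leg _ r t ht,
        ?_, ?_⟩) <;> rw [shift_legPoint hk, h4]

/-- The edges of `G_{k+1,d}` are those of the two copies and the two edges at the new root. -/
theorem edge_succ_iff {k d : ℕ} (hk : 1 ≤ k) (u v : Label) :
    Edge (k + 1) d u v ↔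
      Edge k d u v ∨ (∃ u' v', Edge k d u' v' ∧ u = shift k d u' ∧ v = shift k d v') ∨
      (u = tree (k + 1) 0 ∧ (v = tree k 0 ∨ v = tree k 1)) ∨
      (v = tree (k + 1) 0 ∧ (u = tree k 0 ∨ u = tree k 1)) := by
  have root : ∀ w, w = tree k 0 ∨ w = tree k 1 →
      w ∈ vertexSet (k + 1) d ∧ Link d w (tree (k + 1) 0) := by
    rintro w (rfl | rfl)
    · exact ⟨⟨hk, by omega, by simp⟩, Link.tree k 0⟩
    · exact ⟨⟨hk, by omega, by simp⟩, Link.tree k 1⟩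
  have top : tree (k + 1) 0 ∈ vertexSet (k + 1) d :=
    (mem_vertexSet_succ_iff hk _).2 (Or.inr (Or.inr rfl))
  simp only [edge_iff]
  constructor
  · rintro ⟨hu, hv, h | h⟩
    · rcases link_succ hk hu hv h with h' | ⟨u', v', h1, h2, h3, h4⟩ | h'
      · exact Or.inl ⟨h'.1, h'.2, Or.inl h⟩
      · exact Or.inr (Or.inl ⟨u', v', ⟨h1, h2, Or.inl h3⟩, h4⟩)
      · exact Or.inr (Or.inr (Or.inr h'))
    · rcases link_succ hk hv hu h with h' | ⟨v', u', h1, h2, h3, h4⟩ | h'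
      · exact Or.inl ⟨h'.2, h'.1, Or.inr h⟩
      · exact Or.inr (Or.inl ⟨u', v', ⟨h2, h1, Or.inr h3⟩, h4.2, h4.1⟩)
      · exact Or.inr (Or.inr (Or.inl h'))
  · rintro (⟨hu, hv, h⟩ | ⟨u', v', ⟨hu, hv, h⟩, rfl, rfl⟩ | ⟨rfl, h⟩ | ⟨rfl, h⟩)
    · exact ⟨(mem_vertexSet_succ_iff hk _).2 (Or.inl hu),
        (mem_vertexSet_succ_iff hk _).2 (Or.inl hv), h⟩
    · refine ⟨(mem_vertexSet_succ_iff hk _).2 (Or.inr (Or.inl ⟨_, hu, rfl⟩)),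
        (mem_vertexSet_succ_iff hk _).2 (Or.inr (Or.inl ⟨_, hv, rfl⟩)), ?_⟩
      exact h.imp (fun h => h.shift hv hk) (fun h => h.shift hu hk)
    · exact ⟨top, (root v h).1, Or.inr (root v h).2⟩
    · exact ⟨(root u h).1, top, Or.inl (root u h).2⟩

end NSS

/-! Draw the graph in a half-plane with the bottom path on the boundary line, the binary tree on top
and the dotted paths in between. Consecutive trigons of height one share a `d`-path, called a gap,
and the drawing is plane except that over each gap the last edges of two dotted paths, the foot
edges, cross. A model of the octahedron is read as a drawing of the octahedron, and crossings are
counted modulo two.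

Counting. Extend two disjoint arcs by vertical rays from their ends down to the boundary. The
extended arcs cross with the parity given by the interleaving of their feet, so the arcs themselves
cross with that parity corrected by the ends of one arc that lie above the other
(`crossing_eq_drawn`). This telescopes to disjoint walks (`cross_eq`). For a closed walk `p`, `mu d
p w` says whether `p` encloses `w`.

Structure. Fatness is used only through `Apart`: disjointness, no parent and child, no two siblings.
Recursion over trigons (`noInner`, `not_joined`) shows that closed walks in two apart sets are never
both odd on the two foot edges of a gap (`coef_mul_coef_eq_zero`). Hence the odd edges of one of
them lie outside the other (`mu_eq_zero_of_odd`).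

Octahedron. In a plane drawing of the octahedron exactly one of the eight triangles, the outer one,
encloses the opposite triangle; `axis_identity` is the version with crossings. A triangle of the
model encloses no end of a branch path of the opposite triangle, so enclosure of a centre can be
traded for crossings with a leg inside a branch set. Thus `1` is a sum over the gaps of a form in
the parities at the two foot edges (`sum_axisForm`). The finite check `parityCheck_eq` reduces this
form to complementary pairs: the two foot edges of the gap lie in antipodal branch sets and pair up
the four common neighbours in different ways. Hence for some axis and some pattern the number of
such pairs is odd.

It is also even (`sum_chi`). Follow the main path of the branch set from its first complementary
foot edge on. A suitable triangle through the antipode encloses neither end of this walk, so the two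
cross evenly, and they cross exactly at complementary foot edges. -/

namespace NSS

open Label SimpleGraph

/-! ### The infinite ambient graph -/

/-- The last vertex of a dotted path before the bottom path. -/
def footTop (d i : ℕ) (r : Bool) : Label := legPoint d i r (d - 1)

/-- The position of the foot of a dotted path, in units of `d`. -/
def footPos (i : ℕ) (r : Bool) : ℕ := if r then 2 * i + 3 else 2 * i

/-- The edges of the infinite NSS graph, each listed in one direction. -/
inductive NLink (d : ℕ) : Label → Label → Prop
  | tree (h i : ℕ) : NLink d (tree (h + 1) i) (tree (h + 2) (i / 2))
  | bottom (p : ℕ) : NLink d (bottom p) (bottom (p + 1))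
  | leg (i : ℕ) (r : Bool) (t : ℕ) (ht : t + 1 < d) :
      NLink d (legPoint d i r t) (leg i r (t + 1))
  | foot (i : ℕ) (r : Bool) : NLink d (footTop d i r) (bottom (footPos i r * d))

theorem footTop_ne_bottom {d : ℕ} (hd : 1 ≤ d) (i : ℕ) (r : Bool) (p : ℕ) :
    footTop d i r ≠ bottom p := by
  unfold footTop legPoint
  split_ifs <;> first | (exfalso; omega) | simp

theorem NLink.ne {d : ℕ} (hd : 1 ≤ d) {u v : Label} (h : NLink d u v) : u ≠ v := by
  cases h with
  | tree h i => simp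
  | bottom p => simp
  | leg i r t ht =>
    unfold legPoint
    split_ifs <;> simp
  | foot i r => exact footTop_ne_bottom hd i r _

/-- The infinite NSS graph: the union of all `graph k d`. -/
def full (d : ℕ) : SimpleGraph Label := SimpleGraph.fromRel (NLink d)

theorem full_adj {d : ℕ} (hd : 1 ≤ d) {u v : Label} :
    (full d).Adj u v ↔ NLink d u v ∨ NLink d v u := by
  simp only [full, SimpleGraph.fromRel_adj]
  exact ⟨fun h => h.2, fun h => ⟨h.elim (fun h => h.ne hd) (fun h => (h.ne hd).symm), h⟩⟩

theorem full_adj_cases {d : ℕ} {u v : Label} (h : (full d).Adj u v) :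
    NLink d u v ∨ NLink d v u := by
  simp only [full, SimpleGraph.fromRel_adj] at h
  exact h.2

/-! ### Sums along walks -/

section WalkSum

variable {V : Type*} {G : SimpleGraph V}

/-- The sum of a function of ordered pairs over the steps of a walk. -/
def walkSum (φ : V → V → ZMod 2) {u v : V} (p : G.Walk u v) : ZMod 2 :=
  (p.darts.map fun a => φ a.fst a.snd).sum

@[simp] theorem walkSum_nil (φ : V → V → ZMod 2) (u : V) :
    walkSum φ (Walk.nil : G.Walk u u) = 0 := rfl

@[simp] theorem walkSum_cons (φ : V → V → ZMod 2) {u v w : V} (h : G.Adj u v) (p : G.Walk v w) :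
    walkSum φ (Walk.cons h p) = φ u v + walkSum φ p := by
  simp [walkSum]

@[simp] theorem walkSum_append (φ : V → V → ZMod 2) {u v w : V} (p : G.Walk u v)
    (q : G.Walk v w) : walkSum φ (p.append q) = walkSum φ p + walkSum φ q := by
  simp [walkSum]

theorem walkSum_reverse {φ : V → V → ZMod 2} (hφ : ∀ u v, φ u v = φ v u) {u v : V}
    (p : G.Walk u v) : walkSum φ p.reverse = walkSum φ p := by
  induction p with
  | nil => rfl
  | cons h p ih =>
    rw [Walk.reverse_cons, walkSum_append, ih, walkSum_cons, walkSum_cons, walkSum_nil,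
      hφ, add_zero, add_comm]

theorem walkSum_congr {φ ψ : V → V → ZMod 2} {u v : V} (p : G.Walk u v)
    (h : ∀ x ∈ p.support, ∀ y ∈ p.support, G.Adj x y → φ x y = ψ x y) :
    walkSum φ p = walkSum ψ p := by
  unfold walkSum
  congr 1
  refine List.map_congr_left fun a ha => ?_
  exact h _ (p.dart_fst_mem_support_of_mem_darts ha) _ (p.dart_snd_mem_support_of_mem_darts ha)
    a.adj

theorem walkSum_eq_zero {φ : V → V → ZMod 2} {u v : V} (p : G.Walk u v)
    (h : ∀ x ∈ p.support, ∀ y ∈ p.support, G.Adj x y → φ x y = 0) :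
    walkSum φ p = 0 := by
  rw [walkSum_congr p h]
  simp [walkSum]

theorem walkSum_add (φ ψ : V → V → ZMod 2) {u v : V} (p : G.Walk u v) :
    walkSum (fun x y => φ x y + ψ x y) p = walkSum φ p + walkSum ψ p := by
  simp [walkSum, List.sum_map_add]

/-- A potential difference telescopes along a walk. -/
theorem walkSum_boundary (f : V → ZMod 2) {u v : V} (p : G.Walk u v) :
    walkSum (fun x y => f x + f y) p = f u + f v := by
  induction p with
  | nil => simp [CharTwo.add_self_eq_zero]
  | @cons u v w h p ih =>
    rw [walkSum_cons, ih]
    linear_combination CharTwo.add_self_eq_zero (f v)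

end WalkSum

/-! ### A drawing of the infinite graph in a half-plane, modulo two -/

/-- The labels that occur in some `graph k d`. -/
def Valid (d : ℕ) : Label → Prop
  | tree h _ => 1 ≤ h
  | bottom _ => True
  | leg _ _ t => 0 < t ∧ t < d

theorem valid_footTop {d : ℕ} (hd : 1 ≤ d) (i : ℕ) (r : Bool) : Valid d (footTop d i r) := by
  unfold footTop legPoint
  split_ifs <;> first | (exfalso; omega) | (simp [Valid]; done) | exact ⟨by omega, by omega⟩

theorem NLink.valid {d : ℕ} (hd : 1 ≤ d) {u v : Label} (h : NLink d u v) :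
    Valid d u ∧ Valid d v := by
  cases h with
  | tree h i => simp [Valid]
  | bottom p => simp [Valid]
  | leg i r t ht =>
    refine ⟨?_, by simp [Valid]; omega⟩
    unfold legPoint
    split_ifs <;> first | (exfalso; omega) | (simp [Valid]; done) | exact ⟨by omega, by omega⟩
  | foot i r => exact ⟨valid_footTop hd i r, trivial⟩

theorem valid_of_adj {d : ℕ} (hd : 1 ≤ d) {u v : Label} (h : (full d).Adj u v) :
    Valid d u ∧ Valid d v := by
  rcases full_adj_cases h with h | h
  · exact h.valid hd
  · exact (h.valid hd).symm

/-- The position of a tree vertex among the tree vertices, from left to right. -/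
def treePos (h i : ℕ) : ℕ := (2 * i + 1) * 2 ^ (h - 1)

/-- The horizontal coordinate of a vertex, in the lexicographic order. -/
def key (d : ℕ) : Label → ℕ ×ₗ ℕ
  -- The second coordinate is an offset to the right of less than one unit. The root and the left
  -- dotted path of a trigon of height one stand just right of `(2 * i + 1) * d`, the place of its
  -- `S₁`; the right dotted path stands just left of its `T₁`, and a higher tree vertex stands
  -- between such a path and that `T₁`.
  | tree h i => if h = 1 then toLex ((2 * i + 1) * d, d) else toLex (treePos h i * d - 1, d + 1)
  | bottom p => toLex (p, 0)
  | leg i r t => if r then toLex ((2 * i + 2) * d - 1, t) else toLex ((2 * i + 1) * d, d - t)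

theorem treePos_pos (h i : ℕ) : 0 < treePos h i := by
  unfold treePos; positivity

theorem key_tree_lt {d : ℕ} (hd : 1 ≤ d) {h i h' i' : ℕ}
    (H : treePos h i < treePos h' i') : key d (tree h i) < key d (tree h' i') := by
  have h0 : (treePos h i + 1) * d ≤ treePos h' i' * d := Nat.mul_le_mul_right d H
  rw [add_mul, one_mul] at h0
  have e : ∀ h i, h = 1 → 2 * i + 1 = treePos h i := by
    rintro h i rfl; simp [treePos]
  have h1 : 0 < treePos h i * d := Nat.mul_pos (treePos_pos _ _) hd
  simp only [key]
  split_ifs with a b b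
  · rw [e h i a, e h' i' b, Prod.Lex.toLex_lt_toLex]; left; simp only; omega
  · rw [e h i a, Prod.Lex.toLex_lt_toLex]
    simp only
    omega
  · rw [e h' i' b, Prod.Lex.toLex_lt_toLex]; left; simp only; omega
  · rw [Prod.Lex.toLex_lt_toLex]; left; simp only; omega

theorem key_tree_lt_iff {d : ℕ} (hd : 1 ≤ d) {h i h' i' : ℕ}
    (hne : treePos h i ≠ treePos h' i') :
    key d (tree h i) < key d (tree h' i') ↔ treePos h i < treePos h' i' := by
  refine ⟨fun H => ?_, key_tree_lt hd⟩
  by_contra hc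
  exact absurd (key_tree_lt hd (by omega)) (not_lt.2 H.le)

theorem treePos_injective {h i h' i' : ℕ} (hh : 1 ≤ h) (hh' : 1 ≤ h')
    (H : treePos h i = treePos h' i') : h = h' ∧ i = i' := by
  have key : ∀ a b i j : ℕ, (2 * i + 1) * 2 ^ a = (2 * j + 1) * 2 ^ b → a ≤ b → a = b ∧ i = j := by
    intro a b i j H hab
    obtain ⟨c, rfl⟩ := Nat.exists_eq_add_of_le hab
    rw [pow_add, ← mul_assoc, mul_right_comm] at H
    have H := Nat.eq_of_mul_eq_mul_right (by positivity) H
    rcases Nat.eq_zero_or_pos c with rfl | hc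
    · simp at H; simp; omega
    · obtain ⟨c, rfl⟩ : ∃ e, c = e + 1 := ⟨c - 1, by omega⟩
      rw [pow_succ] at H
      have : 2 ∣ 2 * i + 1 := ⟨(2 * j + 1) * 2 ^ c, by rw [H]; ring⟩
      omega
  unfold treePos at H
  rcases le_total (h - 1) (h' - 1) with h1 | h1
  · have := key _ _ _ _ H h1; omega
  · have := key _ _ _ _ H.symm h1; omega

theorem key_injective {d : ℕ} (hd : 1 ≤ d) {u v : Label} (hu : Valid d u) (hv : Valid d v)
    (H : key d u = key d v) : u = v := by
  -- A left dotted path stands at `(2 * i + 1) * d`, a right one at `(2 * j + 2) * d - 1`; equality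
  -- would make `d` divide `1`. For `d = 1` there are no leg vertices.
  have aux : ∀ i j : ℕ, 2 ≤ d → (2 * i + 1) * d = (2 * j + 2) * d - 1 → False := by
    intro i j h2 H
    have h3 : (2 * i + 1) * d + 1 = (2 * j + 2) * d := by
      have : 0 < (2 * j + 2) * d := by positivity
      omega
    have h4 : d ∣ 1 := (Nat.dvd_add_right (Dvd.intro_left _ rfl)).1 ⟨2 * j + 2, by rw [h3]; ring⟩
    have := Nat.le_of_dvd one_pos h4
    omega
  have c1 : ∀ i j : ℕ, i * d = j * d → i = j := fun i j H => Nat.eq_of_mul_eq_mul_right hd H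
  cases u with
  | tree h i =>
    cases v with
    | tree h' i' =>
      rcases lt_trichotomy (treePos h i) (treePos h' i') with h1 | h1 | h1
      · exact absurd H (key_tree_lt hd h1).ne
      · obtain ⟨rfl, rfl⟩ := treePos_injective hu hv h1; rfl
      · exact absurd H.symm (key_tree_lt hd h1).ne
    | bottom p =>
      simp only [key] at H
      split_ifs at H <;> simp at H <;> omega
    | leg i' r t =>
      obtain ⟨h1, h2⟩ := hv
      simp only [key] at H
      split_ifs at H <;> simp at H <;> omega
  | bottom p =>
    cases v with
    | tree h' i' =>
      simp only [key] at H
      split_ifs at H <;> simp at H <;> omega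
    | bottom p => simpa [key] using H
    | leg i' r t =>
      obtain ⟨h1, h2⟩ := hv
      simp only [key] at H
      split_ifs at H <;> simp at H <;> omega
  | leg i r t =>
    obtain ⟨h1, h2⟩ := hu
    cases v with
    | tree h' i' =>
      simp only [key] at H
      split_ifs at H <;> simp at H <;> omega
    | bottom p =>
      simp only [key] at H
      split_ifs at H <;> simp at H <;> omega
    | leg i' r' t' =>
      obtain ⟨h3, h4⟩ := hv
      cases r <;> cases r' <;> simp only [key] at H <;> simp at H
      · obtain ⟨H1, H2⟩ := H
        have := H1.resolve_right (by omega)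
        subst this
        congr 1
        omega
      · exact (aux _ _ (by omega) H.1).elim
      · exact (aux _ _ (by omega) H.1.symm).elim
      · obtain ⟨H1, rfl⟩ := H
        have h5 : 0 < (2 * i + 2) * d := by positivity
        have h6 : 0 < (2 * i' + 2) * d := by positivity
        have := c1 (2 * i + 2) (2 * i' + 2) (by omega)
        congr 1
        omega

/-- `1` if `u` is to the left of `v`. -/
def leftOf (d : ℕ) (u v : Label) : ZMod 2 := if key d u < key d v then 1 else 0

theorem leftOf_add_leftOf {d : ℕ} (hd : 1 ≤ d) {u v : Label} (hu : Valid d u) (hv : Valid d v)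
    (h : u ≠ v) : leftOf d u v + leftOf d v u = 1 := by
  unfold leftOf
  rcases lt_trichotomy (key d u) (key d v) with h1 | h1 | h1
  · simp [h1, h1.le]
  · exact absurd (key_injective hd hu hv h1) h
  · simp [h1, h1.le]

/-- `1` if the vertex `w` is above the edge `uv` in the drawing. -/
def above (d : ℕ) (u v : Label) : Label → ZMod 2
  | bottom _ => 0
  -- Below a dotted path run only bottom edges. Below a tree vertex run bottom edges and dotted
  -- paths but no tree edge: the tree vertices in the span of a tree edge are descendants of its
  -- lower end and lie beneath it.
  | leg i r t =>
    match u, v with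
    | bottom _, bottom _ => leftOf d u (leg i r t) + leftOf d v (leg i r t)
    | _, _ => 0
  | tree h i =>
    match u, v with
    | tree _ _, tree _ _ => 0
    | _, _ => leftOf d u (tree h i) + leftOf d v (tree h i)

theorem above_comm (d : ℕ) (u v w : Label) : above d u v w = above d v u w := by
  cases w <;> cases u <;> cases v <;> simp [above, add_comm]

/-- `1` if `uv` is the last edge of the dotted path `i`, `r`. -/
noncomputable def footEdge (d i : ℕ) (r : Bool) (u v : Label) : ZMod 2 :=
  open Classical in
  if (u = footTop d i r ∧ v = bottom (footPos i r * d)) ∨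
    (v = footTop d i r ∧ u = bottom (footPos i r * d)) then 1 else 0

theorem footEdge_comm (d i : ℕ) (r : Bool) (u v : Label) :
    footEdge d i r u v = footEdge d i r v u := by
  unfold footEdge
  congr 1
  exact propext or_comm

theorem leftOf_eq {d : ℕ} {u v : Label} {a b a' b' : ℕ} (hu : key d u = toLex (a, b))
    (hv : key d v = toLex (a', b')) :
    leftOf d u v = if a < a' ∨ a = a' ∧ b < b' then 1 else 0 := by
  unfold leftOf
  rw [hu, hv]
  simp only [Prod.Lex.toLex_lt_toLex]

theorem key_footTop {d : ℕ} (hd : 1 ≤ d) (i : ℕ) (r : Bool) :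
    key d (footTop d i r) =
      if r then toLex ((2 * i + 2) * d - 1, if d = 1 then 1 else d - 1)
      else toLex ((2 * i + 1) * d, 1) := by
  unfold footTop legPoint
  by_cases h : d = 1
  · subst h; cases r <;> simp [key]
  · have h0 : d - 1 ≠ 0 := by omega
    have h1 : d - 1 < d := by omega
    cases r <;> simp [key, h0, h1, h]
    omega

theorem key_legPoint {d : ℕ} (i : ℕ) (r : Bool) (t : ℕ) (ht : t < d) :
    key d (legPoint d i r t) =
      if r = false ∨ t = 0 then toLex ((2 * i + 1) * d, d - t)
      else toLex ((2 * i + 2) * d - 1, t) := by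
  unfold legPoint
  by_cases h : t = 0
  · subst h; simp [key]
  · cases r <;> simp [key, h, ht]

/-- A bottom edge has length one, so no other position separates its ends. Since `leftOf` is strict,
only its right end has to be excluded. -/
theorem bottom_bottom_side (d p q : ℕ) (h2 : q ≠ p + 1) :
    leftOf d (bottom p) (bottom q) = leftOf d (bottom (p + 1)) (bottom q) := by
  simp only [leftOf, key, Prod.Lex.toLex_lt_toLex]
  congr 1
  simp
  omega

/-- Reversing a comparison adds `1`, and two comparisons are reversed. -/
theorem leftOf_cancel {d : ℕ} (hd : 1 ≤ d) {u v x : Label} (hu : Valid d u) (hv : Valid d v)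
    (hx : Valid d x) (h : u ≠ x) (h' : v ≠ x) :
    leftOf d x u + leftOf d x v = leftOf d u x + leftOf d v x := by
  have h1 := leftOf_add_leftOf hd hu hx h
  have h2 := leftOf_add_leftOf hd hv hx h'
  generalize leftOf d u x = a at *
  generalize leftOf d v x = b at *
  generalize leftOf d x u = a' at *
  generalize leftOf d x v = b' at *
  revert h1 h2; revert a b a' b'; decide

/-- Edges of the tree do not interleave. -/
theorem tree_tree_side {d : ℕ} (hd : 1 ≤ d) {h i h' i' : ℕ} (hh : h ≤ h')
    (h1 : (h, i) ≠ (h', i')) (h2 : (h, i / 2) ≠ (h', i' / 2)) (h3 : (h + 1, i / 2) ≠ (h', i')) :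
    leftOf d (tree (h + 1) i) (tree (h' + 1) i') = leftOf d (tree (h + 2) (i / 2)) (tree (h' + 1) i') ∧
    leftOf d (tree (h + 1) i) (tree (h' + 2) (i' / 2)) =
      leftOf d (tree (h + 2) (i / 2)) (tree (h' + 2) (i' / 2)) := by
  have key1 : ∀ m j : ℕ, h ≤ m → (h, i) ≠ (m, j) → (h + 1, i / 2) ≠ (m, j) →
      leftOf d (tree (h + 1) i) (tree (m + 1) j) =
      leftOf d (tree (h + 2) (i / 2)) (tree (m + 1) j) := by
    intro m j hm e1 e2
    obtain ⟨c, rfl⟩ := Nat.exists_eq_add_of_le hm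
    unfold leftOf
    congr 1
    have n1 : treePos (h + 1) i ≠ treePos (h + c + 1) j := fun e => by
      have := treePos_injective (by omega) (by omega) e
      apply e1; ext <;> simp <;> omega
    have n2 : treePos (h + 2) (i / 2) ≠ treePos (h + c + 1) j := fun e => by
      have := treePos_injective (by omega) (by omega) e
      apply e2; ext <;> simp <;> omega
    rw [key_tree_lt_iff hd n1, key_tree_lt_iff hd n2]
    -- Divided by `2 ^ h`, the ends of the lower edge are the consecutive integers `2 * i + 1` and
    -- `2 * (2 * (i / 2) + 1)`; an integer different from both lies on the same side of both.
    have E1 : treePos (h + 1) i = (2 * i + 1) * 2 ^ h := by simp [treePos]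
    have E2 : treePos (h + 2) (i / 2) = (2 * (2 * (i / 2) + 1)) * 2 ^ h := by
      simp [treePos, pow_succ]; ring
    have E3 : treePos (h + c + 1) j = ((2 * j + 1) * 2 ^ c) * 2 ^ h := by
      simp [treePos, pow_add]; ring
    have hp : 0 < 2 ^ h := by positivity
    have n1' : 2 * i + 1 ≠ (2 * j + 1) * 2 ^ c := fun e => n1 (by rw [E1, E3, e])
    have n2' : 2 * (2 * (i / 2) + 1) ≠ (2 * j + 1) * 2 ^ c := fun e => n2 (by rw [E2, E3, e])
    rw [E1, E2, E3, Nat.mul_lt_mul_right hp, Nat.mul_lt_mul_right hp]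
    simp only [eq_iff_iff]
    omega
  refine ⟨key1 _ _ hh h1 h3, key1 (h' + 1) (i' / 2) (by omega) (by simp; omega) ?_⟩
  intro e; apply h2; simp at e ⊢; omega

theorem walkSum_mul {V : Type*} {G : SimpleGraph V} (φ : V → V → ZMod 2) (c : ZMod 2) {u v : V}
    (p : G.Walk u v) : walkSum (fun x y => φ x y * c) p = walkSum φ p * c := by
  simp [walkSum, List.sum_map_mul_right]

theorem walkSum_finset_sum {V ι : Type*} {G : SimpleGraph V} (s : Finset ι)
    (φ : ι → V → V → ZMod 2) {u v : V}
    (p : G.Walk u v) : walkSum (fun x y => ∑ i ∈ s, φ i x y) p = ∑ i ∈ s, walkSum (φ i) p := by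
  induction p with
  | nil => simp
  | cons h p ih => simp [ih, Finset.sum_add_distrib]

/-! ### Crossings of two edges of the drawing -/

/-- The two edges cross: they are the two foot edges in a gap of index below `B`. -/
noncomputable def crossing (d B : ℕ) (u v x y : Label) : ZMod 2 :=
  ∑ i ∈ Finset.range B, (footEdge d i true u v * footEdge d (i + 1) false x y +
    footEdge d (i + 1) false u v * footEdge d i true x y)

/-- The drawing formula for the number of crossings of two edges. -/
noncomputable def drawn (d : ℕ) (u v x y : Label) : ZMod 2 :=
  above d u v x + above d u v y + (above d x y u + above d x y v) +
    (leftOf d u x + leftOf d u y + leftOf d v x + leftOf d v y)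

theorem footEdge_eq_zero_of_not {d i : ℕ} {r : Bool} {u v : Label}
    (h : ¬ ((u = footTop d i r ∧ v = bottom (footPos i r * d)) ∨
    (v = footTop d i r ∧ u = bottom (footPos i r * d)))) : footEdge d i r u v = 0 := by
  unfold footEdge; rw [if_neg h]

theorem footEdge_bottom_bottom {d : ℕ} (hd : 1 ≤ d) (i : ℕ) (r : Bool) (p q : ℕ) :
    footEdge d i r (bottom p) (bottom q) = 0 := by
  apply footEdge_eq_zero_of_not
  rintro (⟨h, -⟩ | ⟨h, -⟩) <;> exact footTop_ne_bottom hd _ _ _ h.symm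

theorem footEdge_of_not_bottom {d i : ℕ} {r : Bool} {u v : Label}
    (hu : ∀ p, u ≠ bottom p) (hv : ∀ p, v ≠ bottom p) : footEdge d i r u v = 0 := by
  apply footEdge_eq_zero_of_not
  rintro (⟨-, h⟩ | ⟨-, h⟩)
  · exact hv _ h
  · exact hu _ h

/-- The edges of the infinite graph, with dotted paths treated uniformly. -/
theorem dotted_cases {d : ℕ} (hd : 1 ≤ d) {u v : Label} (h : NLink d u v) :
    (∃ h i, u = tree (h + 1) i ∧ v = tree (h + 2) (i / 2)) ∨
    (∃ p, u = bottom p ∧ v = bottom (p + 1)) ∨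
    (∃ i r t, t < d ∧ u = legPoint d i r t ∧ v = legPoint d i r (t + 1)) := by
  cases h with
  | tree h i => exact Or.inl ⟨h, i, rfl, rfl⟩
  | bottom p => exact Or.inr (Or.inl ⟨p, rfl, rfl⟩)
  | leg i r t ht =>
    refine Or.inr (Or.inr ⟨i, r, t, by omega, rfl, ?_⟩)
    simp [legPoint, ht]
  | foot i r =>
    refine Or.inr (Or.inr ⟨i, r, d - 1, by omega, rfl, ?_⟩)
    rw [Nat.sub_add_cancel hd]
    simp [legPoint, footPos, show d ≠ 0 by omega]

theorem legPoint_injective {d i i' : ℕ} {r r' : Bool} {t t' : ℕ} (ht : t < d) (ht' : t' < d)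
    (h : legPoint d i r t = legPoint d i' r' t') :
    i = i' ∧ t = t' ∧ (t = 0 ∨ r = r') := by
  unfold legPoint at h
  by_cases h1 : t = 0 <;> by_cases h2 : t' = 0 <;> simp [h1, h2, ht, ht'] at h ⊢
  · exact h
  · tauto

theorem valid_legPoint {d : ℕ} (i : ℕ) (r : Bool) (t : ℕ) :
    Valid d (legPoint d i r t) := by
  unfold legPoint
  split_ifs <;> first | (simp [Valid]; done) | exact ⟨by omega, by omega⟩

theorem key_legPoint_top {d : ℕ} (hd : 1 ≤ d) (i : ℕ) (r : Bool) :
    key d (legPoint d i r d) = toLex (footPos i r * d, 0) := by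
  simp [legPoint, footPos, key, show d ≠ 0 by omega]

theorem crossing_eq_zero {d B : ℕ} {u v x y : Label}
    (h : ∀ i r i' r', footEdge d i r u v = 0 ∨ footEdge d i' r' x y = 0) :
    crossing d B u v x y = 0 := by
  refine Finset.sum_eq_zero fun i _ => ?_
  rcases h i true (i + 1) false with h1 | h1 <;> rcases h (i + 1) false i true with h2 | h2 <;>
    simp [h1, h2]

theorem footEdge_legPoint {d i j : ℕ} {r s : Bool} {t : ℕ} (hd : 1 ≤ d) (ht : t < d) :
    footEdge d j s (legPoint d i r t) (legPoint d i r (t + 1)) =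
      if t + 1 = d ∧ j = i ∧ s = r then 1 else 0 := by
  unfold footEdge footTop
  congr 1
  have nb : ∀ p, legPoint d i r t ≠ bottom p := by
    intro p; unfold legPoint; split_ifs <;> simp
  have nb2 : ∀ p, legPoint d j s (d - 1) ≠ bottom p := by
    intro p; unfold legPoint; split_ifs <;> first | (exfalso; omega) | simp
  rw [eq_iff_iff]
  constructor
  · rintro (⟨h1, h2⟩ | ⟨h1, h2⟩)
    · obtain ⟨h3, h4, h5⟩ := legPoint_injective ht (by omega) h1
      have h6 : t + 1 = d := by omega
      refine ⟨h6, h3.symm, ?_⟩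
      rw [h6] at h2
      have : legPoint d i r d = bottom (footPos i r * d) := by
        simp [legPoint, footPos, show d ≠ 0 by omega]
      rw [this] at h2
      simp only [bottom.injEq] at h2
      have := Nat.eq_of_mul_eq_mul_right hd h2
      subst h3
      unfold footPos at this
      cases r <;> cases s <;> simp at this ⊢
    · exact absurd h2 (nb _)
  · rintro ⟨h1, rfl, rfl⟩
    left
    obtain rfl : t = d - 1 := by omega
    refine ⟨rfl, ?_⟩
    rw [h1]
    simp [legPoint, footPos, show d ≠ 0 by omega]

theorem above_dotted_left {d i : ℕ} {r : Bool} {t : ℕ} {w : Label} (ht : t < d) (hw : ∀ h i, w ≠ tree h i) :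
    above d (legPoint d i r t) (legPoint d i r (t + 1)) w = 0 := by
  have nb : ∀ p, legPoint d i r t ≠ bottom p := by
    intro p; unfold legPoint; split_ifs <;> simp
  generalize legPoint d i r t = a at *
  cases w with
  | tree h i => exact absurd rfl (hw h i)
  | bottom p => rfl
  | leg _ _ _ => cases a <;> simp_all [above]

theorem above_dotted_tree {d i : ℕ} {r : Bool} {t : ℕ} {h j : ℕ} :
    above d (legPoint d i r t) (legPoint d i r (t + 1)) (tree h j) =
      leftOf d (legPoint d i r t) (tree h j) + leftOf d (legPoint d i r (t + 1)) (tree h j) := by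
  have nb : ∀ h j, legPoint d i r (t + 1) ≠ tree h j := by
    intro p; unfold legPoint; split_ifs <;> first | (exfalso; omega) | simp
  generalize legPoint d i r (t + 1) = a at *
  cases a <;> simp_all [above]

theorem ite_add_ite_eq_zero {P Q : Prop} [Decidable P] [Decidable Q] (h : P ↔ Q) :
    (if P then 1 else 0 : ZMod 2) + (if Q then 1 else 0) = 0 := by
  by_cases P <;> simp_all [CharTwo.add_self_eq_zero]

-- The order relations behind `drawn_dotted` for two disjoint dotted edges that are not a crossing
-- pair. They are split according to whether an edge starts at a root (`t = 0`), since a root is the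
-- only vertex of a dotted path that can lie above a dotted edge.
set_option maxHeartbeats 4000000 in
theorem dotted_order {d : ℕ} (hd : 1 ≤ d) {i i' : ℕ} {r r' : Bool} {t t' : ℕ} (ht : t < d)
    (ht' : t' < d)
    (hx : legPoint d i r t ≠ legPoint d i' r' t')
    (hc : ¬ (t + 1 = d ∧ t' + 1 = d ∧ r = true ∧ r' = false ∧ i' = i + 1))
    (hc' : ¬ (t + 1 = d ∧ t' + 1 = d ∧ r = false ∧ r' = true ∧ i = i' + 1))
    (hv : legPoint d i r (t + 1) ≠ legPoint d i' r' (t' + 1))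
    (hvx : legPoint d i r (t + 1) ≠ legPoint d i' r' t')
    (huy : legPoint d i r t ≠ legPoint d i' r' (t' + 1)) :
    (t = 0 → t' = 0 →
      leftOf d (legPoint d i r t) (legPoint d i' r' t') +
      leftOf d (legPoint d i r (t + 1)) (legPoint d i' r' (t' + 1)) = 0) ∧
    (t ≠ 0 → 
      leftOf d (legPoint d i r t) (legPoint d i' r' (t' + 1)) +
      leftOf d (legPoint d i r (t + 1)) (legPoint d i' r' (t' + 1)) = 0) ∧
    (t' ≠ 0 → 
      leftOf d (legPoint d i r (t + 1)) (legPoint d i' r' t') +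
      leftOf d (legPoint d i r (t + 1)) (legPoint d i' r' (t' + 1)) = 0) ∧
    (t ≠ 0 → t' ≠ 0 →
      leftOf d (legPoint d i r t) (legPoint d i' r' t') +
      leftOf d (legPoint d i r (t + 1)) (legPoint d i' r' t') = 0) := by
  have hx' : ¬ (i = i' ∧ t = t' ∧ (t = 0 ∨ r = r')) := by
    rintro ⟨rfl, rfl, rfl | rfl⟩ <;> exact hx (by simp [legPoint])
  have hv' : ¬ (i = i' ∧ t = t' ∧ r = r') := by
    rintro ⟨rfl, rfl, rfl⟩; exact hv rfl
  have hvx' : ¬ (i = i' ∧ t + 1 = t' ∧ r = r') := by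
    rintro ⟨rfl, rfl, rfl⟩; exact hvx rfl
  have huy' : ¬ (i = i' ∧ t = t' + 1 ∧ r = r') := by
    rintro ⟨rfl, rfl, rfl⟩; exact huy rfl
  have mono : ∀ a b : ℕ, a < b → a * d + d ≤ b * d := fun a b h => by
    have := Nat.mul_le_mul_right d h
    rwa [Nat.succ_mul] at this
  have mono2 : ∀ a b : ℕ, a + 1 < b → a * d + d + d ≤ b * d := fun a b h => by
    have := mono _ _ h
    rw [Nat.succ_mul] at this
    exact this
  have k1 := key_legPoint (d := d) i r t ht
  have k2 := key_legPoint (d := d) i' r' t' ht'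
  have K1 : key d (legPoint d i r (t + 1)) = if t + 1 = d then toLex (footPos i r * d, 0) else
      if r = false then toLex ((2 * i + 1) * d, d - (t + 1)) else
        toLex ((2 * i + 2) * d - 1, t + 1) := by
    split_ifs with h1 h2
    · rw [h1, key_legPoint_top hd]
    · rw [key_legPoint _ _ _ (by omega)]; simp [h2]
    · rw [key_legPoint _ _ _ (by omega)]; simp [h2]
  have K2 : key d (legPoint d i' r' (t' + 1)) = if t' + 1 = d then toLex (footPos i' r' * d, 0) else
      if r' = false then toLex ((2 * i' + 1) * d, d - (t' + 1)) else
        toLex ((2 * i' + 2) * d - 1, t' + 1) := by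
    split_ifs with h1 h2
    · rw [h1, key_legPoint_top hd]
    · rw [key_legPoint _ _ _ (by omega)]; simp [h2]
    · rw [key_legPoint _ _ _ (by omega)]; simp [h2]
  have e1 : (2 * i + 1) * d = 2 * (i * d) + d := by ring
  have e2 : (2 * i + 2) * d = 2 * (i * d) + 2 * d := by ring
  have e3 : (2 * i + 3) * d = 2 * (i * d) + 3 * d := by ring
  have e4 : (2 * i) * d = 2 * (i * d) := by ring
  have e1' : (2 * i' + 1) * d = 2 * (i' * d) + d := by ring
  have e2' : (2 * i' + 2) * d = 2 * (i' * d) + 2 * d := by ring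
  have e3' : (2 * i' + 3) * d = 2 * (i' * d) + 3 * d := by ring
  have e4' : (2 * i') * d = 2 * (i' * d) := by ring
  -- Only `i * d` and `i' * d` are nonlinear; comparing `i` and `i'` up to distance one provides all
  -- that `omega` needs about them.
  have hord : (i = i' ∧ i * d = i' * d) ∨ (i + 1 = i' ∧ i * d + d = i' * d) ∨
      (i + 1 < i' ∧ i * d + d + d ≤ i' * d) ∨ (i' + 1 = i ∧ i' * d + d = i * d) ∨
      (i' + 1 < i ∧ i' * d + d + d ≤ i * d) := by
    rcases lt_trichotomy (i + 1) i' with h | h | h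
    · exact Or.inr (Or.inr (Or.inl ⟨h, mono2 _ _ h⟩))
    · refine Or.inr (Or.inl ⟨h, ?_⟩); rw [← h]; ring
    · rcases lt_trichotomy (i' + 1) i with h' | h' | h'
      · exact Or.inr (Or.inr (Or.inr (Or.inr ⟨h', mono2 _ _ h'⟩)))
      · refine Or.inr (Or.inr (Or.inr (Or.inl ⟨h', ?_⟩))); rw [← h']; ring
      · obtain rfl : i = i' := by omega
        exact Or.inl ⟨rfl, rfl⟩
  clear mono mono2 hx hv hvx huy
  unfold footPos at K1 K2
  rw [e1, e2] at k1
  rw [e1', e2'] at k2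
  generalize legPoint d i r (t + 1) = v at *
  generalize legPoint d i' r' (t' + 1) = y at *
  generalize legPoint d i r t = u at *
  generalize legPoint d i' r' t' = x at *
  cases r <;> cases r' <;>
    simp only [Bool.false_eq_true, if_false, if_true, reduceCtorEq, false_or, true_or, or_false, and_true, true_and,
      and_false, false_and, not_false_eq_true, e1, e2, e3, e4, e1', e2', e3', e4'] at * <;>
    clear e1 e2 e3 e4 e1' e2' e3' e4' <;>
    generalize i * d = A at * <;> generalize i' * d = A' at * <;>
    by_cases f1 : t + 1 = d <;> by_cases f2 : t' + 1 = d <;>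
    by_cases g1 : t = 0 <;> by_cases g2 : t' = 0 <;>
    (try simp only [g1, g2, if_true, if_false] at k1 k2) <;>
    (first | rw [if_pos f1] at K1 | rw [if_neg f1] at K1) <;>
    (first | rw [if_pos f2] at K2 | rw [if_neg f2] at K2) <;>
    rw [leftOf_eq k1 k2, leftOf_eq K1 K2, leftOf_eq k1 K2, leftOf_eq K1 k2] <;>
    refine ⟨fun _ _ => ite_add_ite_eq_zero ?_, fun _ => ite_add_ite_eq_zero ?_,
      fun _ => ite_add_ite_eq_zero ?_, fun _ _ => ite_add_ite_eq_zero ?_⟩ <;>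
    omega

theorem crossing_comm_left (d B : ℕ) (u v x y : Label) :
    crossing d B u v x y = crossing d B v u x y := by
  unfold crossing; simp only [footEdge_comm d _ _ u v]

theorem crossing_comm_right (d B : ℕ) (u v x y : Label) :
    crossing d B u v x y = crossing d B u v y x := by
  unfold crossing; simp only [footEdge_comm d _ _ x y]

theorem drawn_comm_left (d : ℕ) (u v x y : Label) : drawn d u v x y = drawn d v u x y := by
  unfold drawn; rw [above_comm d u v x, above_comm d u v y]; ring

theorem drawn_comm_right (d : ℕ) (u v x y : Label) : drawn d u v x y = drawn d u v y x := by
  unfold drawn; rw [above_comm d x y u, above_comm d x y v]; ring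

theorem drawn_swap {d : ℕ} (hd : 1 ≤ d) {u v x y : Label} (hu : Valid d u) (hv : Valid d v)
    (hx : Valid d x) (hy : Valid d y) (h1 : u ≠ x) (h2 : u ≠ y) (h3 : v ≠ x) (h4 : v ≠ y) :
    drawn d u v x y = drawn d x y u v := by
  have e1 := leftOf_cancel hd hu hv hx h1 h3
  have e2 := leftOf_cancel hd hu hv hy h2 h4
  unfold drawn
  linear_combination - e1 - e2

theorem zmod_self_add (a : ZMod 2) : a + a = 0 := CharTwo.add_self_eq_zero a

theorem crossing_dotted {d B : ℕ} (hd : 1 ≤ d) {i i' : ℕ} {r r' : Bool} {t t' : ℕ} (ht : t < d)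
    (ht' : t' < d) (hB : i < B) :
    crossing d B (legPoint d i r t) (legPoint d i r (t + 1))
      (legPoint d i' r' t') (legPoint d i' r' (t' + 1)) =
      if (t + 1 = d ∧ t' + 1 = d) ∧ (r = true ∧ r' = false ∧ i' = i + 1 ∨
        r = false ∧ r' = true ∧ i = i' + 1) then 1 else 0 := by
  unfold crossing
  simp only [footEdge_legPoint hd ht, footEdge_legPoint hd ht']
  by_cases h1 : t + 1 = d <;> by_cases h2 : t' + 1 = d <;> simp only [h1, h2, false_and, true_and,
    if_false, mul_zero, zero_mul, add_zero, Finset.sum_const_zero, and_false]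
  cases r <;> cases r' <;> simp
  · split_ifs <;> first | rfl | (exfalso; omega)
  · rw [Finset.sum_eq_single i]
    · simp [eq_comm]
    · intro j _ hj
      simp [hj]
    · simp [hB]

theorem above_dotted {d : ℕ} {i i' : ℕ} {r r' : Bool} {t t' : ℕ} (ht : t < d) :
    above d (legPoint d i r t) (legPoint d i r (t + 1)) (legPoint d i' r' t') =
      if t' = 0 then leftOf d (legPoint d i r t) (legPoint d i' r' t') +
        leftOf d (legPoint d i r (t + 1)) (legPoint d i' r' t') else 0 := by
  split_ifs with h
  · rw [show legPoint d i' r' t' = tree 1 i' by simp [legPoint, h], above_dotted_tree]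
  · apply above_dotted_left ht
    intro a b
    unfold legPoint
    split_ifs <;> simp

/-- The right foot edge runs from just left of the gap to its right end, the left foot edge from
just right of the gap to its left end, so their ends interleave. -/
theorem drawn_crossing {d : ℕ} (hd : 1 ≤ d) (i : ℕ) :
    drawn d (legPoint d i true (d - 1)) (legPoint d i true d)
      (legPoint d (i + 1) false (d - 1)) (legPoint d (i + 1) false d) = 1 := by
  have k1 := key_footTop hd i true
  have k2 := key_footTop hd (i + 1) false
  have k3 := key_legPoint_top hd i true
  have k4 := key_legPoint_top hd (i + 1) false
  unfold footTop at k1 k2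
  have a1 := above_dotted (d := d) (i := i) (i' := i + 1) (r := true) (r' := false) (t := d - 1)
    (t' := d - 1) (by omega)
  have a2 := above_dotted (d := d) (i := i) (i' := i + 1) (r := true) (r' := false) (t := d - 1)
    (t' := d) (by omega)
  have a3 := above_dotted (d := d) (i := i + 1) (i' := i) (r := false) (r' := true) (t := d - 1)
    (t' := d - 1) (by omega)
  have a4 := above_dotted (d := d) (i := i + 1) (i' := i) (r := false) (r' := true) (t := d - 1)
    (t' := d) (by omega)
  rw [Nat.sub_add_cancel hd] at a1 a2 a3 a4
  rw [if_neg (by omega)] at a2 a4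
  simp only [footPos, if_true, Bool.false_eq_true, if_false] at k1 k2 k3 k4
  have e1 : (2 * i + 2) * d = 2 * (i * d) + 2 * d := by ring
  have e2 : (2 * i + 3) * d = 2 * (i * d) + 3 * d := by ring
  have e3 : (2 * (i + 1) + 1) * d = 2 * (i * d) + 3 * d := by ring
  have e4 : 2 * (i + 1) * d = 2 * (i * d) + 2 * d := by ring
  rw [e1] at k1
  rw [e3] at k2
  rw [e2] at k3
  rw [e4] at k4
  have s1 := leftOf_eq k1 k2
  have s2 := leftOf_eq k3 k4
  have s3 := leftOf_eq k3 k2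
  have s4 := leftOf_eq k1 k4
  have s5 := leftOf_eq k2 k1
  have s6 := leftOf_eq k4 k1
  rw [if_pos (by omega)] at s1 s3 s4
  rw [if_neg (by omega)] at s2 s5 s6
  unfold drawn
  rw [a1, a2, a3, a4, s1, s2, s3, s4, s5, s6]
  by_cases h : d - 1 = 0 <;> simp only [h, if_true, if_false] <;> decide

theorem drawn_dotted {d : ℕ} (hd : 1 ≤ d) {i i' : ℕ} {r r' : Bool} {t t' : ℕ} (ht : t < d)
    (ht' : t' < d)
    (hx : legPoint d i r t ≠ legPoint d i' r' t')
    (hv : legPoint d i r (t + 1) ≠ legPoint d i' r' (t' + 1))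
    (hvx : legPoint d i r (t + 1) ≠ legPoint d i' r' t')
    (huy : legPoint d i r t ≠ legPoint d i' r' (t' + 1)) :
    drawn d (legPoint d i r t) (legPoint d i r (t + 1))
      (legPoint d i' r' t') (legPoint d i' r' (t' + 1)) =
      if (t + 1 = d ∧ t' + 1 = d) ∧ (r = true ∧ r' = false ∧ i' = i + 1 ∨
        r = false ∧ r' = true ∧ i = i' + 1) then 1 else 0 := by
  have vu := valid_legPoint (d := d) i r t
  have vv := valid_legPoint (d := d) i r (t + 1)
  have vx := valid_legPoint (d := d) i' r' t'
  have vy := valid_legPoint (d := d) i' r' (t' + 1)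
  split_ifs with hc
  · obtain ⟨⟨rfl, h2⟩, ⟨rfl, rfl, rfl⟩ | ⟨rfl, rfl, rfl⟩⟩ := hc
    · obtain rfl : t = t' := by omega
      simpa using drawn_crossing hd i
    · obtain rfl : t = t' := by omega
      rw [drawn_swap hd vu vv vx vy hx huy hvx hv]
      simpa using drawn_crossing hd i'
  · obtain ⟨o1, o2, o3, o4⟩ := dotted_order hd ht ht' hx (by tauto) (by tauto) hv hvx huy
    have e1 := leftOf_cancel hd vx vy vu hx.symm huy.symm
    unfold drawn
    rw [above_dotted ht, above_dotted ht, above_dotted ht', above_dotted ht', if_neg (by omega : ¬ t' + 1 = 0),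
      if_neg (by omega : ¬ t + 1 = 0)]
    generalize legPoint d i r (t + 1) = v at *
    generalize legPoint d i' r' (t' + 1) = y at *
    generalize legPoint d i r t = u at *
    generalize legPoint d i' r' t' = x at *
    by_cases h1 : t = 0 <;> by_cases h2 : t' = 0 <;> simp only [h1, h2, if_true, if_false]
    · linear_combination o1 h1 h2 - e1 + zmod_self_add (leftOf d u x + leftOf d v x + leftOf d u y)
    · linear_combination o3 (by omega) - e1 + zmod_self_add (leftOf d u x + leftOf d u y)
    · linear_combination o2 (by omega) + zmod_self_add (leftOf d u x + leftOf d v x)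
    · linear_combination o2 h1 + o4 h1 h2

/-- The topological reason is the extension of both edges by vertical rays. In coordinates it is a
check over the types tree, bottom and dotted of the two edges; the value is `1` only for the two
foot edges of a gap. -/
theorem crossing_eq_drawn_of_link {d B : ℕ} (hd : 1 ≤ d) {u v x y : Label} (huv : NLink d u v)
    (hxy : NLink d x y) (h1 : u ≠ x) (h2 : u ≠ y) (h3 : v ≠ x) (h4 : v ≠ y)
    (hB : ∀ i r, B ≤ i → footEdge d i r u v = 0) :
    crossing d B u v x y = drawn d u v x y := by
  have vu := (huv.valid hd).1
  have vv := (huv.valid hd).2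
  have vx := (hxy.valid hd).1
  have vy := (hxy.valid hd).2
  have TT : ∀ h i h' i', h ≤ h' → tree (h + 1) i ≠ tree (h' + 1) i' →
      tree (h + 2) (i / 2) ≠ tree (h' + 2) (i' / 2) → tree (h + 2) (i / 2) ≠ tree (h' + 1) i' →
      drawn d (tree (h + 1) i) (tree (h + 2) (i / 2)) (tree (h' + 1) i')
        (tree (h' + 2) (i' / 2)) = 0 := by
    intro h i h' i' hh e1 e2 e3
    obtain ⟨s1, s2⟩ := tree_tree_side hd (i := i) (i' := i') hh (by simpa using e1)
      (by simpa using e2) (by simpa using e3)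
    simp only [drawn, above, s1, s2]
    linear_combination zmod_self_add (leftOf d (tree (h + 2) (i / 2)) (tree (h' + 1) i')) +
      zmod_self_add (leftOf d (tree (h + 2) (i / 2)) (tree (h' + 2) (i' / 2)))
  have TB : ∀ h i p, drawn d (tree (h + 1) i) (tree (h + 2) (i / 2)) (bottom p)
      (bottom (p + 1)) = 0 := by
    intro h i p
    have e1 := leftOf_add_leftOf hd (u := tree (h + 1) i) (v := bottom p)
      (by simp [Valid]) trivial (by simp)
    have e2 := leftOf_add_leftOf hd (u := tree (h + 1) i) (v := bottom (p + 1))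
      (by simp [Valid]) trivial (by simp)
    have e3 := leftOf_add_leftOf hd (u := tree (h + 2) (i / 2)) (v := bottom p)
      (by simp [Valid]) trivial (by simp)
    have e4 := leftOf_add_leftOf hd (u := tree (h + 2) (i / 2)) (v := bottom (p + 1))
      (by simp [Valid]) trivial (by simp)
    simp only [drawn, above]
    linear_combination e1 + e2 + e3 + e4 + zmod_self_add (1 + 1)
  have TD : ∀ h i j r t, t < d → tree (h + 1) i ≠ legPoint d j r t →
      tree (h + 2) (i / 2) ≠ legPoint d j r t → drawn d (tree (h + 1) i) (tree (h + 2) (i / 2))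
      (legPoint d j r t) (legPoint d j r (t + 1)) = 0 := by
    intro h i j r t ht n1 n2
    have nt : ∀ h i, legPoint d j r (t + 1) ≠ tree h i := by
      intro h i; unfold legPoint; split_ifs <;> first | (exfalso; omega) | simp
    have e1 := leftOf_cancel hd (valid_legPoint j r t) (valid_legPoint j r (t + 1))
      (show Valid d (tree (h + 1) i) by simp [Valid]) n1.symm (nt _ _)
    have e2 := leftOf_cancel hd (valid_legPoint j r t) (valid_legPoint j r (t + 1))
      (show Valid d (tree (h + 2) (i / 2)) by simp [Valid]) n2.symm (nt _ _)
    have z : ∀ w, above d (tree (h + 1) i) (tree (h + 2) (i / 2)) w = 0 := by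
      intro w; cases w <;> rfl
    unfold drawn
    rw [z, z, above_dotted_tree, above_dotted_tree]
    linear_combination - e1 - e2 + zmod_self_add (leftOf d (tree (h + 1) i) (legPoint d j r t) +
      leftOf d (tree (h + 1) i) (legPoint d j r (t + 1)) +
      leftOf d (tree (h + 2) (i / 2)) (legPoint d j r t) +
      leftOf d (tree (h + 2) (i / 2)) (legPoint d j r (t + 1)))
  have BD : ∀ p j r t, t < d →
      bottom (p + 1) ≠ legPoint d j r (t + 1) → drawn d (bottom p) (bottom (p + 1))
      (legPoint d j r t) (legPoint d j r (t + 1)) = 0 := by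
    intro p j r t ht n2
    have z : ∀ q w, above d w (legPoint d j r (t + 1)) (bottom q) = 0 := fun _ _ => rfl
    have z1 : above d (bottom p) (bottom (p + 1)) (legPoint d j r t) =
        leftOf d (bottom p) (legPoint d j r t) + leftOf d (bottom (p + 1)) (legPoint d j r t) := by
      have nb : ∀ p, legPoint d j r t ≠ bottom p := by
        intro p; unfold legPoint; split_ifs <;> simp
      generalize legPoint d j r t = a at *
      cases a <;> simp_all [above]
    have z2 : above d (bottom p) (bottom (p + 1)) (legPoint d j r (t + 1)) =
        leftOf d (bottom p) (legPoint d j r (t + 1)) +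
        leftOf d (bottom (p + 1)) (legPoint d j r (t + 1)) := by
      generalize legPoint d j r (t + 1) = a at *
      cases a with
      | bottom q =>
        rw [bottom_bottom_side d p q (by simpa using n2.symm)]
        exact (zmod_self_add _).symm
      | tree h i => simp [above]
      | leg i r t => simp [above]
    unfold drawn
    rw [z, z, z1, z2]
    linear_combination zmod_self_add (leftOf d (bottom p) (legPoint d j r t) +
      leftOf d (bottom (p + 1)) (legPoint d j r t) + leftOf d (bottom p) (legPoint d j r (t + 1)) +
        leftOf d (bottom (p + 1)) (legPoint d j r (t + 1)))
  have swap := drawn_swap hd vu vv vx vy h1 h2 h3 h4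
  rcases dotted_cases hd huv with ⟨h, i, rfl, rfl⟩ | ⟨p, rfl, rfl⟩ | ⟨i, r, t, ht, rfl, rfl⟩ <;>
  rcases dotted_cases hd hxy with ⟨h', i', rfl, rfl⟩ | ⟨p', rfl, rfl⟩ | ⟨i', r', t', ht', rfl, rfl⟩
  · rw [crossing_eq_zero fun i r i' r' => Or.inl (footEdge_of_not_bottom (by simp) (by simp))]
    rcases le_total h h' with hh | hh
    · exact (TT _ _ _ _ hh h1 h4 h3).symm
    · rw [swap]
      exact (TT _ _ _ _ hh h1.symm h4.symm h2.symm).symm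
  · rw [crossing_eq_zero fun i r i' r' => Or.inl (footEdge_of_not_bottom (by simp) (by simp)), TB]
  · rw [crossing_eq_zero fun i r i' r' => Or.inl (footEdge_of_not_bottom (by simp) (by simp)),
      TD _ _ _ _ _ ht' h1 h3]
  · rw [crossing_eq_zero fun i r i' r' => Or.inr (footEdge_of_not_bottom (by simp) (by simp)), swap,
      TB]
  · rw [crossing_eq_zero fun i r i' r' => Or.inl (footEdge_bottom_bottom hd _ _ _ _)]
    simp only [drawn, above, bottom_bottom_side d p p' (by simpa using h3.symm),
      bottom_bottom_side d p (p' + 1) (by simpa using h4.symm)]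
    linear_combination - zmod_self_add (leftOf d (bottom (p + 1)) (bottom p')) -
      zmod_self_add (leftOf d (bottom (p + 1)) (bottom (p' + 1)))
  · rw [crossing_eq_zero fun i r i' r' => Or.inl (footEdge_bottom_bottom hd _ _ _ _),
      BD _ _ _ _ ht' h4]
  · rw [crossing_eq_zero fun i r i' r' => Or.inr (footEdge_of_not_bottom (by simp) (by simp)), swap,
      TD _ _ _ _ _ ht h1.symm h2.symm]
  · rw [crossing_eq_zero fun i r i' r' => Or.inr (footEdge_bottom_bottom hd _ _ _ _), swap,
      BD _ _ _ _ ht h4.symm]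
  · rw [drawn_dotted hd ht ht' h1 h4 h3 h2]
    by_cases hi : i < B
    · rw [crossing_dotted hd ht ht' hi]
    · have := hB i r (not_lt.1 hi)
      rw [footEdge_legPoint hd ht] at this
      have ht1 : t + 1 ≠ d := by
        rintro h; simp [h] at this
      rw [crossing_eq_zero, if_neg (by tauto)]
      intro j s j' s'
      left
      rw [footEdge_legPoint hd ht, if_neg (by tauto)]

/-- The mod 2 crossing formula for two disjoint edges. -/
theorem crossing_eq_drawn {d B : ℕ} (hd : 1 ≤ d) {u v x y : Label} (huv : (full d).Adj u v)
    (hxy : (full d).Adj x y) (h1 : u ≠ x) (h2 : u ≠ y) (h3 : v ≠ x) (h4 : v ≠ y)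
    (hB : ∀ i r, B ≤ i → footEdge d i r u v = 0) :
    crossing d B u v x y = drawn d u v x y := by
  have hB' : ∀ i r, B ≤ i → footEdge d i r v u = 0 := fun i r h => by
    rw [footEdge_comm]; exact hB i r h
  rcases full_adj_cases huv with a | a <;> rcases full_adj_cases hxy with b | b
  · exact crossing_eq_drawn_of_link hd a b h1 h2 h3 h4 hB
  · rw [crossing_comm_right, drawn_comm_right]
    exact crossing_eq_drawn_of_link hd a b h2 h1 h4 h3 hB
  · rw [crossing_comm_left, drawn_comm_left]
    exact crossing_eq_drawn_of_link hd a b h3 h4 h1 h2 hB'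
  · rw [crossing_comm_left, drawn_comm_left, crossing_comm_right, drawn_comm_right]
    exact crossing_eq_drawn_of_link hd a b h4 h3 h2 h1 hB'

/-! ### Crossing and enclosure parities of walks -/

/-- The parity of the number of times a walk uses a foot edge. -/
noncomputable def coef (d i : ℕ) (r : Bool) {u v : Label} (p : (full d).Walk u v) : ZMod 2 :=
  walkSum (footEdge d i r) p

/-- The parity of the number of edges of a walk under a vertex. -/
noncomputable def mu (d : ℕ) {u v : Label} (p : (full d).Walk u v) (w : Label) : ZMod 2 :=
  walkSum (fun a b => above d a b w) p

/-- The parity of the number of crossings of two walks. -/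
noncomputable def cross (d B : ℕ) {u v x y : Label} (p : (full d).Walk u v)
    (q : (full d).Walk x y) : ZMod 2 :=
  ∑ i ∈ Finset.range B, (coef d i true p * coef d (i + 1) false q +
    coef d (i + 1) false p * coef d i true q)

@[simp] theorem mu_bottom (d : ℕ) {u v : Label} (p : (full d).Walk u v) (b : ℕ) :
    mu d p (bottom b) = 0 := by
  simp [mu, above, walkSum]

theorem mu_append (d : ℕ) {u v w : Label} (p : (full d).Walk u v) (q : (full d).Walk v w)
    (z : Label) : mu d (p.append q) z = mu d p z + mu d q z := walkSum_append _ _ _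

theorem mu_reverse (d : ℕ) {u v : Label} (p : (full d).Walk u v) (z : Label) :
    mu d p.reverse z = mu d p z := walkSum_reverse (fun _ _ => above_comm _ _ _ _) _

theorem coef_append (d i : ℕ) (r : Bool) {u v w : Label} (p : (full d).Walk u v)
    (q : (full d).Walk v w) : coef d i r (p.append q) = coef d i r p + coef d i r q :=
  walkSum_append _ _ _

theorem coef_reverse (d i : ℕ) (r : Bool) {u v : Label} (p : (full d).Walk u v) :
    coef d i r p.reverse = coef d i r p := walkSum_reverse (footEdge_comm _ _ _) _

theorem footEdge_eq_zero_of_footTop {d i : ℕ} {r : Bool} {u v : Label}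
    (hu : u ≠ footTop d i r) (hv : v ≠ footTop d i r) : footEdge d i r u v = 0 := by
  apply footEdge_eq_zero_of_not
  rintro (⟨h, -⟩ | ⟨h, -⟩)
  · exact hu h
  · exact hv h

theorem walkSum_crossing (d B : ℕ) {u v x y : Label} (p : (full d).Walk u v)
    (q : (full d).Walk x y) :
    walkSum (fun a b => walkSum (fun c e => crossing d B a b c e) q) p = cross d B p q := by
  have h1 : ∀ a b, walkSum (fun c e => crossing d B a b c e) q =
      ∑ i ∈ Finset.range B, (footEdge d i true a b * coef d (i + 1) false q +
    footEdge d (i + 1) false a b * coef d i true q) := by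
    intro a b
    unfold crossing
    rw [walkSum_finset_sum]
    refine Finset.sum_congr rfl fun i _ => ?_
    rw [walkSum_add]
    simp only [mul_comm (footEdge d i true a b), mul_comm (footEdge d (i + 1) false a b)]
    rw [walkSum_mul, walkSum_mul]
    rfl
  simp only [h1]
  rw [walkSum_finset_sum]
  unfold cross
  refine Finset.sum_congr rfl fun i _ => ?_
  rw [walkSum_add, walkSum_mul, walkSum_mul]
  rfl

/-- The mod 2 crossing formula for disjoint walks. -/
theorem cross_eq {d B : ℕ} (hd : 1 ≤ d) {u v x y : Label} (p : (full d).Walk u v)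
    (q : (full d).Walk x y) (hpq : ∀ a ∈ p.support, a ∉ q.support)
    (hB : ∀ i r, B ≤ i → footTop d i r ∉ p.support) :
    cross d B p q = mu d p x + mu d p y + (mu d q u + mu d q v) +
      (leftOf d u x + leftOf d u y + leftOf d v x + leftOf d v y) := by
  have h1 : cross d B p q = walkSum (fun a b => (above d a b x + above d a b y) +
      ((mu d q a + leftOf d a x + leftOf d a y) + (mu d q b + leftOf d b x + leftOf d b y))) p := by
    rw [← walkSum_crossing]
    refine walkSum_congr _ fun a ha b hb hab => ?_
    -- The drawing formula is grouped into a potential difference in `c` and `e`, which telescopes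
    -- along `q`, and a part that sums to `mu` of `q`. The outer sum along `p` is treated in the
    -- same way.
    rw [walkSum_congr (ψ := fun c e => (((above d a b c + leftOf d a c + leftOf d b c) +
      (above d a b e + leftOf d a e + leftOf d b e)) + (above d c e a + above d c e b)))]
    · rw [walkSum_add, walkSum_boundary, walkSum_add]
      unfold mu
      ring
    · intro c hc e he hce
      rw [crossing_eq_drawn hd hab hce]
      · unfold drawn; ring
      · rintro rfl; exact hpq _ ha hc
      · rintro rfl; exact hpq _ ha he
      · rintro rfl; exact hpq _ hb hc
      · rintro rfl; exact hpq _ hb he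
      · intro i r hi
        apply footEdge_eq_zero_of_footTop <;> rintro rfl
        · exact hB _ _ hi ha
        · exact hB _ _ hi hb
  rw [h1, walkSum_add, walkSum_add, walkSum_boundary]
  unfold mu
  ring

/-! ### Reachability inside a set -/

/-- There is a walk from `u` to `v` inside `X`. -/
def Reach (d : ℕ) (X : Set Label) (u v : Label) : Prop :=
  u ∈ X ∧ Relation.ReflTransGen (fun a b => (full d).Adj a b ∧ b ∈ X) u v

namespace Reach

variable {d : ℕ} {X Y W : Set Label} {u v w : Label}

theorem left_mem (h : Reach d X u v) : u ∈ X := h.1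

theorem right_mem (h : Reach d X u v) : v ∈ X := by
  obtain ⟨h1, h2⟩ := h
  induction h2 with
  | refl => exact h1
  | tail _ h _ => exact h.2

theorem refl (h : u ∈ X) : Reach d X u u := ⟨h, .refl⟩

theorem trans (h : Reach d X u v) (h' : Reach d X v w) : Reach d X u w := ⟨h.1, h.2.trans h'.2⟩

theorem tail (h : Reach d X u v) (h' : (full d).Adj v w) (hw : w ∈ X) : Reach d X u w :=
  ⟨h.1, h.2.tail ⟨h', hw⟩⟩

theorem of_adj (h : (full d).Adj u v) (hu : u ∈ X) (hv : v ∈ X) : Reach d X u v :=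
  (refl hu).tail h hv

theorem symm (h : Reach d X u v) : Reach d X v u := by
  obtain ⟨h1, h2⟩ := h
  induction h2 with
  | refl => exact refl h1
  | @tail b c h h' ih => exact (of_adj h'.1.symm h'.2 (right_mem ⟨h1, h⟩)).trans ih

theorem mono (h : Reach d X u v) (hXY : X ⊆ Y) : Reach d Y u v := by
  obtain ⟨h1, h2⟩ := h
  induction h2 with
  | refl => exact refl (hXY h1)
  | tail _ h' ih => exact ih.tail h'.1 (hXY h'.2)

theorem closed {K : Set Label} (h : Reach d X u v)
    (hK : ∀ a ∈ K, a ∈ X → ∀ b ∈ X, (full d).Adj a b → b ∈ K) (hu : u ∈ K) : v ∈ K := by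
  obtain ⟨h1, h2⟩ := h
  induction h2 with
  | refl => exact hu
  | @tail b c h h' ih => exact hK _ ih (right_mem ⟨h1, h⟩) _ h'.2 h'.1

theorem exit (h : Reach d X u v) (hu : u ∈ W) :
    Reach d (X ∩ W) u v ∨
      ∃ a b, Reach d (X ∩ W) u a ∧ (full d).Adj a b ∧ b ∈ X ∧ b ∉ W := by
  obtain ⟨h1, h2⟩ := h
  induction h2 with
  | refl => exact Or.inl (refl ⟨h1, hu⟩)
  | @tail b c h h' ih =>
    rcases ih with ih | ih
    · by_cases hc : c ∈ W
      · exact Or.inl (ih.tail h'.1 ⟨h'.2, hc⟩)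
      · exact Or.inr ⟨b, c, ih, h'.1, h'.2, hc⟩
    · exact Or.inr ih

theorem of_walk (p : (full d).Walk u v) (h : ∀ a ∈ p.support, a ∈ X) : Reach d X u v := by
  induction p with
  | nil => exact refl (h _ (by simp))
  | cons hab p ih =>
    refine (of_adj hab (h _ (by simp)) (h _ (by simp))).trans (ih fun a ha => h a ?_)
    simp [ha]

end Reach

/-! ### Trigons -/

/-- The vertex set of the `i`-th trigon of height `n + 1`. -/
def trig (d n i : ℕ) : Set Label
  | tree h j => ∃ l, h = l + 1 ∧ l ≤ n ∧ j / 2 ^ (n - l) = i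
  | bottom p => 2 * (i * 2 ^ n) * d ≤ p ∧ p ≤ (2 * ((i + 1) * 2 ^ n) + 1) * d
  | leg j _ _ => j / 2 ^ n = i

/-- The `m`-th gap: the common part of the `(m-1)`-st and the `m`-th trigon of height one. -/
def gap (d m : ℕ) : Set Label
  | bottom p => 2 * m * d ≤ p ∧ p ≤ (2 * m + 1) * d
  | _ => False

/-- The two ends of a gap. -/
def gapEnd (d m b : ℕ) : Label := bottom ((2 * m + b) * d)

theorem gapEnd_mem_gap {d m b : ℕ} (hb : b ≤ 1) : gapEnd d m b ∈ gap d m :=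
  ⟨Nat.mul_le_mul_right d (by omega), Nat.mul_le_mul_right d (by omega)⟩

theorem gap_subset_trig {d n i c : ℕ} (hc : c ≤ 1) : gap d ((i + c) * 2 ^ n) ⊆ trig d n i := by
  intro x hx
  cases x with
  | tree h j => exact hx.elim
  | leg j r t => exact hx.elim
  | bottom p =>
    obtain ⟨h1, h2⟩ := hx
    have h3 : i * 2 ^ n ≤ (i + c) * 2 ^ n := Nat.mul_le_mul_right _ (by omega)
    have h4 : (i + c) * 2 ^ n ≤ (i + 1) * 2 ^ n := Nat.mul_le_mul_right _ (by omega)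
    exact ⟨(Nat.mul_le_mul_right d (by omega)).trans h1, h2.trans (Nat.mul_le_mul_right d (by omega))⟩

theorem div_pow_eq_iff {j n i : ℕ} : j / 2 ^ n = i ↔ i * 2 ^ n ≤ j ∧ j < (i + 1) * 2 ^ n := by
  rw [Nat.div_eq_iff (by positivity), add_mul, one_mul]
  have : 0 < 2 ^ n := by positivity
  omega

theorem footTop_mem_trig {d n i j : ℕ} {r : Bool} (hd : 1 ≤ d) :
    footTop d j r ∈ trig d n i ↔ j / 2 ^ n = i := by
  unfold footTop legPoint
  split_ifs
  · change (∃ l, 1 = l + 1 ∧ l ≤ n ∧ j / 2 ^ (n - l) = i) ↔ _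
    constructor
    · rintro ⟨l, hl, -, h⟩
      obtain rfl : l = 0 := by omega
      simpa using h
    · intro h
      exact ⟨0, rfl, by omega, by simpa using h⟩
  · rfl
  · omega
  · omega

theorem child_div {j n i : ℕ} : j / 2 ^ (n + 1) = i ↔ j / 2 ^ n = 2 * i ∨ j / 2 ^ n = 2 * i + 1 := by
  rw [pow_succ, ← Nat.div_div_eq_div_mul]
  omega

theorem trig_succ {d n i : ℕ} :
    trig d (n + 1) i = trig d n (2 * i) ∪ trig d n (2 * i + 1) ∪ {tree (n + 2) i} := by
  have hp : 0 < 2 ^ n := by positivity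
  ext x
  cases x with
  | tree h j =>
    simp only [Set.mem_union, Set.mem_singleton_iff]
    change (∃ l, h = l + 1 ∧ l ≤ n + 1 ∧ j / 2 ^ (n + 1 - l) = i) ↔
      ((∃ l, h = l + 1 ∧ l ≤ n ∧ j / 2 ^ (n - l) = 2 * i) ∨
        (∃ l, h = l + 1 ∧ l ≤ n ∧ j / 2 ^ (n - l) = 2 * i + 1)) ∨ _
    constructor
    · rintro ⟨l, rfl, h1, h2⟩
      rcases Nat.eq_or_lt_of_le h1 with rfl | h1
      · right; simpa using h2
      · left
        rw [show n + 1 - l = n - l + 1 by omega, child_div] at h2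
        rcases h2 with h2 | h2
        · exact Or.inl ⟨l, rfl, by omega, h2⟩
        · exact Or.inr ⟨l, rfl, by omega, h2⟩
    · rintro ((⟨l, rfl, h1, h2⟩ | ⟨l, rfl, h1, h2⟩) | h)
      · exact ⟨l, rfl, by omega, by
          rw [show n + 1 - l = n - l + 1 by omega, child_div]; exact Or.inl h2⟩
      · exact ⟨l, rfl, by omega, by
          rw [show n + 1 - l = n - l + 1 by omega, child_div]; exact Or.inr h2⟩
      · simp only [tree.injEq] at h
        exact ⟨n + 1, h.1, le_rfl, by simp [h.2]⟩
  | bottom p =>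
    simp only [Set.mem_union, Set.mem_singleton_iff, reduceCtorEq, or_false]
    change (2 * (i * 2 ^ (n + 1)) * d ≤ p ∧ p ≤ (2 * ((i + 1) * 2 ^ (n + 1)) + 1) * d) ↔
      (2 * (2 * i * 2 ^ n) * d ≤ p ∧ p ≤ (2 * ((2 * i + 1) * 2 ^ n) + 1) * d) ∨
      (2 * ((2 * i + 1) * 2 ^ n) * d ≤ p ∧ p ≤ (2 * ((2 * i + 1 + 1) * 2 ^ n) + 1) * d)
    have e1 : i * 2 ^ (n + 1) = 2 * i * 2 ^ n := by ring
    have e2 : (i + 1) * 2 ^ (n + 1) = (2 * i + 1 + 1) * 2 ^ n := by ring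
    rw [e1, e2]
    have h1 : 2 * (2 * i * 2 ^ n) * d ≤ 2 * ((2 * i + 1) * 2 ^ n) * d := by gcongr; omega
    have h2 : 2 * ((2 * i + 1) * 2 ^ n) * d ≤ (2 * ((2 * i + 1) * 2 ^ n) + 1) * d := by
      gcongr; omega
    have h3 : (2 * ((2 * i + 1) * 2 ^ n) + 1) * d ≤ (2 * ((2 * i + 1 + 1) * 2 ^ n) + 1) * d := by
      gcongr; omega
    omega
  | leg j r t =>
    simp only [Set.mem_union, Set.mem_singleton_iff, reduceCtorEq, or_false]
    exact child_div

theorem child_subset {d n i e : ℕ} (he : e ≤ 1) : trig d n (2 * i + e) ⊆ trig d (n + 1) i := by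
  rw [trig_succ]
  intro x hx
  obtain rfl | rfl : e = 0 ∨ e = 1 := by omega
  · exact Or.inl (Or.inl hx)
  · exact Or.inl (Or.inr hx)

theorem root_notMem_child {d n i j : ℕ} : tree (n + 2) i ∉ trig d n j := by
  rintro ⟨l, h1, h2, -⟩
  omega

theorem mem_sibling {d n i e : ℕ} (he : e ≤ 1) {x : Label} (hx : x ∈ trig d (n + 1) i)
    (hx' : x ∉ trig d n (2 * i + e)) : x = tree (n + 2) i ∨ x ∈ trig d n (2 * i + (1 - e)) := by
  rw [trig_succ] at hx
  obtain rfl | rfl : e = 0 ∨ e = 1 := by omega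
  · rcases hx with (h | h) | h
    · exact absurd h hx'
    · exact Or.inr h
    · exact Or.inl h
  · rcases hx with (h | h) | h
    · exact Or.inr h
    · exact absurd h hx'
    · exact Or.inl h

/-- The two children of a trigon meet in the middle gap. -/
theorem mem_inter_children {d n i e : ℕ} (he : e ≤ 1) {x : Label}
    (hx : x ∈ trig d n (2 * i + e)) (hx' : x ∈ trig d n (2 * i + (1 - e))) :
    x ∈ gap d ((2 * i + 1) * 2 ^ n) := by
  cases x with
  | tree h j =>
    obtain ⟨l, h1, h2, h3⟩ := hx
    obtain ⟨l', h1', h2', h3'⟩ := hx'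
    obtain rfl : l = l' := by omega
    omega
  | leg j r t =>
    have h1 : j / 2 ^ n = 2 * i + e := hx
    have h2 : j / 2 ^ n = 2 * i + (1 - e) := hx'
    omega
  | bottom p =>
    obtain ⟨h1, h2⟩ := hx
    obtain ⟨h3, h4⟩ := hx'
    obtain rfl | rfl : e = 0 ∨ e = 1 := by omega
    · exact ⟨h3, h2⟩
    · exact ⟨h1, h4⟩

/-- The edges that leave a trigon. -/
theorem trig_boundary {d n i : ℕ} (hd : 1 ≤ d) {x y : Label} (h : (full d).Adj x y)
    (hx : x ∈ trig d n i) (hy : y ∉ trig d n i) :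
    (x = tree (n + 1) i ∧ y = tree (n + 2) (i / 2)) ∨
    (x = gapEnd d (i * 2 ^ n) 0 ∧ ∃ p, y = bottom p ∧ p + 1 = 2 * (i * 2 ^ n) * d) ∨
    (x = gapEnd d (i * 2 ^ n) 1 ∧ ∃ j, y = footTop d j true ∧ j + 1 = i * 2 ^ n) ∨
    (x = gapEnd d ((i + 1) * 2 ^ n) 0 ∧ y = footTop d ((i + 1) * 2 ^ n) false) ∨
    (x = gapEnd d ((i + 1) * 2 ^ n) 1 ∧ ∃ p, y = bottom p ∧
      p = (2 * ((i + 1) * 2 ^ n) + 1) * d + 1) := by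
  have hp : 0 < 2 ^ n := by positivity
  have T : ∀ h j, 1 ≤ h → (h ≤ n) →
      (tree (h + 1) (j / 2) ∈ trig d n i ↔ tree h j ∈ trig d n i) := by
    intro h j h1 h2
    obtain ⟨l, rfl⟩ : ∃ l, h = l + 1 := ⟨h - 1, by omega⟩
    change (∃ l', l + 1 + 1 = l' + 1 ∧ l' ≤ n ∧ j / 2 / 2 ^ (n - l') = i) ↔
      (∃ l', l + 1 = l' + 1 ∧ l' ≤ n ∧ j / 2 ^ (n - l') = i)
    have e : j / 2 / 2 ^ (n - (l + 1)) = j / 2 ^ (n - l) := by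
      rw [Nat.div_div_eq_div_mul, ← pow_succ']; congr 2; omega
    constructor
    · rintro ⟨l', h3, h4, h5⟩
      obtain rfl : l' = l + 1 := by omega
      exact ⟨l, rfl, by omega, by rw [← e]; exact h5⟩
    · rintro ⟨l', h3, h4, h5⟩
      obtain rfl : l' = l := by omega
      exact ⟨l' + 1, rfl, by omega, by rw [e]; exact h5⟩
  have TL : ∀ h j, tree h j ∈ trig d n i → h ≤ n + 1 := by
    rintro h j ⟨l, h1, h2, -⟩; omega
  have LP : ∀ j r t, t < d → (legPoint d j r t ∈ trig d n i ↔ j / 2 ^ n = i) := by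
    intro j r t ht
    by_cases h : t = 0
    · subst h
      have := footTop_mem_trig (d := 1) (n := n) (i := i) (j := j) (r := r) le_rfl
      simp only [footTop, legPoint] at this ⊢
      exact this
    · simp only [legPoint, h, ht, if_true, if_false]; rfl
  have F1 : ∀ j r, footTop d j r ∈ trig d n i → bottom (footPos j r * d) ∈ trig d n i := by
    intro j r h1
    rw [footTop_mem_trig hd, div_pow_eq_iff] at h1
    constructor
    · apply Nat.mul_le_mul_right; unfold footPos; split_ifs <;> omega
    · apply Nat.mul_le_mul_right; unfold footPos; split_ifs <;> omega
  rcases full_adj_cases h with h | h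
  · cases h with
    | tree a j =>
      by_cases h1 : a + 1 ≤ n
      · exact absurd ((T _ _ (by omega) h1).2 hx) hy
      · have := TL _ _ hx
        obtain rfl : a = n := by omega
        obtain ⟨l, h2, h3, h4⟩ := hx
        obtain rfl : l = a := by omega
        left
        simp at h4
        simp [h4]
    | bottom p =>
      obtain ⟨h1, h2⟩ := hx
      have h3 : ¬ p + 1 ≤ (2 * ((i + 1) * 2 ^ n) + 1) * d := fun h3 => hy ⟨by omega, h3⟩
      have h4 : p = (2 * ((i + 1) * 2 ^ n) + 1) * d := by omega
      right; right; right; right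
      exact ⟨by rw [h4]; rfl, _, rfl, by omega⟩
    | leg j r t ht =>
      rw [LP _ _ _ (by omega)] at hx
      exact absurd hx hy
    | foot j r => exact absurd (F1 _ _ hx) hy
  · cases h with
    | tree a j =>
      by_cases h1 : a + 1 ≤ n
      · exact absurd ((T _ _ (by omega) h1).1 hx) hy
      · have := TL _ _ hx
        omega
    | bottom p =>
      obtain ⟨h1, h2⟩ := hx
      have h3 : ¬ 2 * (i * 2 ^ n) * d ≤ p := fun h3 => hy ⟨h3, by omega⟩
      have h4 : p + 1 = 2 * (i * 2 ^ n) * d := by omega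
      right; left
      exact ⟨by rw [h4]; rfl, _, rfl, h4⟩
    | leg j r t ht =>
      rw [LP _ _ _ (by omega)] at hy
      exact absurd hx hy
    | foot j r =>
      obtain ⟨h1, h2⟩ := hx
      have h1 := Nat.le_of_mul_le_mul_right h1 hd
      have h2 := Nat.le_of_mul_le_mul_right h2 hd
      rw [footTop_mem_trig hd, div_pow_eq_iff] at hy
      cases r
      · simp only [footPos, Bool.false_eq_true, if_false] at h1 h2 ⊢
        obtain rfl : j = (i + 1) * 2 ^ n := by omega
        right; right; right; left
        exact ⟨rfl, rfl⟩
      · simp only [footPos, if_true] at h1 h2 ⊢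
        have e : j + 1 = i * 2 ^ n := by omega
        right; right; left
        refine ⟨?_, j, rfl, e⟩
        unfold gapEnd
        congr 2
        omega

/-- The edges that leave a child of a trigon but not the trigon. -/
theorem child_boundary {d n i e : ℕ} (he : e ≤ 1) (hd : 1 ≤ d) {x y : Label}
    (h : (full d).Adj x y) (hx : x ∈ trig d n (2 * i + e)) (hy : y ∈ trig d (n + 1) i)
    (hy' : y ∉ trig d n (2 * i + e)) :
    (x = tree (n + 1) (2 * i + e) ∧ y = tree (n + 2) i) ∨
      ∃ b ≤ 1, x = gapEnd d ((2 * i + 1) * 2 ^ n) b := by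
  have hp : 0 < 2 ^ n := by positivity
  have hq : (2 : ℕ) ^ (n + 1) = 2 * 2 ^ n := by ring
  have e1 : i * 2 ^ (n + 1) = 2 * i * 2 ^ n := by ring
  have e2 : (i + 1) * 2 ^ (n + 1) = (2 * i + 1 + 1) * 2 ^ n := by ring
  rcases trig_boundary hd h hx hy' with ⟨rfl, h2⟩ | ⟨h1, p, rfl, h2⟩ | ⟨h1, j, rfl, h2⟩ |
    ⟨h1, rfl⟩ | ⟨h1, p, rfl, h2⟩
  · left
    refine ⟨rfl, ?_⟩
    rw [h2]; congr 1; omega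
  · right
    obtain rfl | rfl : e = 0 ∨ e = 1 := by omega
    · have h3 := hy.1
      rw [e1] at h3
      simp only [add_zero] at h2
      omega
    · exact ⟨0, by omega, h1⟩
  · right
    obtain rfl | rfl : e = 0 ∨ e = 1 := by omega
    · rw [footTop_mem_trig hd, div_pow_eq_iff, e1] at hy
      simp only [add_zero] at h2
      omega
    · exact ⟨1, by omega, h1⟩
  · right
    obtain rfl | rfl : e = 0 ∨ e = 1 := by omega
    · exact ⟨0, by omega, h1⟩
    · rw [footTop_mem_trig hd, div_pow_eq_iff, e2] at hy
      omega
  · right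
    obtain rfl | rfl : e = 0 ∨ e = 1 := by omega
    · exact ⟨1, by omega, h1⟩
    · have h3 := hy.2
      rw [e2] at h3
      omega

/-- A walk leaves a child of a trigon at the root or at an end of the middle gap. -/
theorem Reach.exit_child {d n i e : ℕ} (he : e ≤ 1) (hd : 1 ≤ d) {X : Set Label} {x z : Label}
    (h : Reach d (X ∩ trig d (n + 1) i) x z) (hx : x ∈ trig d n (2 * i + e)) :
    Reach d (X ∩ trig d n (2 * i + e)) x z ∨
    (Reach d (X ∩ trig d n (2 * i + e)) x (tree (n + 1) (2 * i + e)) ∧ tree (n + 2) i ∈ X) ∨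
    ∃ b ≤ 1, Reach d (X ∩ trig d n (2 * i + e)) x (gapEnd d ((2 * i + 1) * 2 ^ n) b) := by
  have sub : X ∩ trig d (n + 1) i ∩ trig d n (2 * i + e) ⊆ X ∩ trig d n (2 * i + e) :=
    fun a ha => ⟨ha.1.1, ha.2⟩
  rcases h.exit hx with h | ⟨a, b, h1, h2, h3, h4⟩
  · exact Or.inl (h.mono sub)
  · right
    have h1 := h1.mono sub
    rcases child_boundary he hd h2 h1.right_mem.2 h3.2 h4 with ⟨rfl, rfl⟩ | ⟨c, hc, rfl⟩
    · exact Or.inl ⟨h1, h3.1⟩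
    · exact Or.inr ⟨c, hc, h1⟩

/-- Disjoint sets without close vertices in the trees. -/
structure Apart (A B : Set Label) : Prop where
  disj : ∀ x ∈ A, x ∉ B
  parent : ∀ h i, tree (h + 1) i ∈ A → tree (h + 2) (i / 2) ∉ B
  parent' : ∀ h i, tree (h + 1) i ∈ B → tree (h + 2) (i / 2) ∉ A
  sibling : ∀ h i e, e ≤ 1 → tree h (2 * i + e) ∈ A → tree h (2 * i + (1 - e)) ∉ B

theorem Apart.symm {A B : Set Label} (h : Apart A B) : Apart B A where
  disj x hx hx' := h.disj x hx' hx
  parent := h.parent'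
  parent' := h.parent
  sibling a i e he hx hx' := h.sibling a i (1 - e) (by omega) hx'
    (by rwa [show 1 - (1 - e) = e by omega])

theorem Apart.mono {A B A' B' : Set Label} (h : Apart A B) (hA : A' ⊆ A) (hB : B' ⊆ B) :
    Apart A' B' where
  disj x hx hx' := h.disj x (hA hx) (hB hx')
  parent a i hx hx' := h.parent a i (hA hx) (hB hx')
  parent' a i hx hx' := h.parent' a i (hB hx) (hA hx')
  sibling a i e he hx hx' := h.sibling a i e he (hA hx) (hB hx')

/-- Children, gaps of a trigon and ends of a gap are all numbered `0` on the left and `1` on the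
right. Child `c` shares its gap on side `c` with its parent, and its gap on side `1 - c` is the
middle gap. -/
theorem gap_child_outer (i n c : ℕ) : (2 * i + c + c) * 2 ^ n = (i + c) * 2 ^ (n + 1) := by ring

theorem gap_child_middle {i n e : ℕ} (he : e ≤ 1) :
    (2 * i + e + (1 - e)) * 2 ^ n = (2 * i + 1) * 2 ^ n := by
  congr 1; omega

theorem gap_disjoint {d m m' : ℕ} (hd : 1 ≤ d) {x : Label} (hx : x ∈ gap d m) (hx' : x ∈ gap d m') :
    m = m' := by
  cases x with
  | tree h j => exact hx.elim
  | leg j r t => exact hx.elim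
  | bottom p =>
    have h1 := Nat.le_of_mul_le_mul_right (hx.1.trans hx'.2) hd
    have h2 := Nat.le_of_mul_le_mul_right (hx'.1.trans hx.2) hd
    omega

theorem outer_mem_child {d n i c : ℕ} (hc : c ≤ 1) {x : Label}
    (hx : x ∈ gap d ((i + c) * 2 ^ (n + 1))) : x ∈ trig d n (2 * i + c) := by
  rw [← gap_child_outer] at hx
  exact gap_subset_trig hc hx

theorem middle_mem_child {d n i e : ℕ} (he : e ≤ 1) {x : Label}
    (hx : x ∈ gap d ((2 * i + 1) * 2 ^ n)) : x ∈ trig d n (2 * i + e) := by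
  rw [← gap_child_middle he] at hx
  exact gap_subset_trig (by omega) hx

theorem outer_notMem_child {d n i e : ℕ} (hd : 1 ≤ d) (he : e ≤ 1) {x : Label}
    (hx : x ∈ gap d ((i + (1 - e)) * 2 ^ (n + 1))) : x ∉ trig d n (2 * i + e) := by
  intro h
  have h1 := outer_mem_child (by omega) hx
  have h2 := gap_disjoint hd hx (mem_inter_children he h h1)
  have hp : 0 < 2 ^ n := by positivity
  have h3 : (i + (1 - e)) * 2 ^ (n + 1) = (2 * (i + (1 - e))) * 2 ^ n := by ring
  rw [h3] at h2
  have := Nat.eq_of_mul_eq_mul_right hp h2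
  omega

/-! ### Sets that cross a trigon -/

/-- `X` joins the two gaps of a trigon inside it. -/
def Crosses (d n i : ℕ) (X : Set Label) : Prop :=
  ∃ s ∈ gap d ((i + 0) * 2 ^ n), ∃ t ∈ gap d ((i + 1) * 2 ^ n), Reach d (X ∩ trig d n i) s t

theorem crosses_of {d n i c : ℕ} {X : Set Label} (hc : c ≤ 1) {s t : Label}
    (hs : s ∈ gap d ((i + c) * 2 ^ n)) (ht : t ∈ gap d ((i + (1 - c)) * 2 ^ n))
    (h : Reach d (X ∩ trig d n i) s t) : Crosses d n i X := by
  obtain rfl | rfl : c = 0 ∨ c = 1 := by omega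
  · exact ⟨s, hs, t, ht, h⟩
  · exact ⟨t, ht, s, hs, h.symm⟩

theorem Crosses.side {d n i c : ℕ} {X : Set Label} (h : Crosses d n i X) (hc : c ≤ 1) :
    ∃ s ∈ gap d ((i + c) * 2 ^ n), ∃ t ∈ gap d ((i + (1 - c)) * 2 ^ n),
      Reach d (X ∩ trig d n i) s t := by
  obtain ⟨s, hs, t, ht, h⟩ := h
  obtain rfl | rfl : c = 0 ∨ c = 1 := by omega
  · exact ⟨s, hs, t, ht, h⟩
  · exact ⟨t, ht, s, hs, h.symm⟩

/-- A walk through a trigon that avoids its root meets the middle gap at one of its ends. -/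
theorem Crosses.child' {d n i e : ℕ} (hd : 1 ≤ d) {X : Set Label} (h : Crosses d (n + 1) i X)
    (hR : tree (n + 2) i ∉ X) (he : e ≤ 1) :
    ∃ s ∈ gap d ((2 * i + e + e) * 2 ^ n), ∃ b ≤ 1,
      Reach d (X ∩ trig d n (2 * i + e)) s (gapEnd d ((2 * i + 1) * 2 ^ n) b) := by
  obtain ⟨s, hs, t, ht, h⟩ := h.side he
  have hs' := outer_mem_child he hs
  rw [← gap_child_outer] at hs
  rcases h.exit_child he hd hs' with h | ⟨-, h⟩ | ⟨b, hb, h⟩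
  · exact absurd h.right_mem.2 (outer_notMem_child hd he ht)
  · exact absurd h hR
  · exact ⟨s, hs, b, hb, h⟩

theorem Crosses.child {d n i e : ℕ} (hd : 1 ≤ d) {X : Set Label} (h : Crosses d (n + 1) i X)
    (hR : tree (n + 2) i ∉ X) (he : e ≤ 1) : Crosses d n (2 * i + e) X := by
  obtain ⟨s, hs, b, hb, h⟩ := h.child' hd hR he
  refine crosses_of he hs ?_ h
  rw [gap_child_middle he]
  exact gapEnd_mem_gap hb

/-- The place where a vertex is seen from the bottom path. -/
def shadow (d : ℕ) : Label → ℕ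
  | tree _ _ => 0
  | bottom p => p
  | leg j r _ => footPos j r * d

/-- Without the root a dotted path just hangs from its foot, so projecting it there gives a map to
the bottom path that moves by at most one per step. -/
theorem shadow_step {d i : ℕ} (hd : 1 ≤ d) {x y : Label} (h : NLink d x y)
    (hx : x ∈ trig d 0 i) (hy : y ∈ trig d 0 i) (hx' : x ≠ tree 1 i) (hy' : y ≠ tree 1 i) :
    shadow d x = shadow d y ∨ shadow d x + 1 = shadow d y := by
  have T : ∀ h j, tree h j ∈ trig d 0 i → tree h j = tree 1 i := by
    rintro h j ⟨l, h1, h2, h3⟩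
    obtain rfl : l = 0 := by omega
    simp at h3
    rw [h1, h3]
  have P : ∀ j r t, t < d → legPoint d j r t ∈ trig d 0 i → legPoint d j r t ≠ tree 1 i →
      shadow d (legPoint d j r t) = footPos j r * d := by
    intro j r t ht h1 h2
    unfold legPoint at *
    split_ifs at *
    · exact absurd (T _ _ h1) h2
    · rfl
  cases h with
  | tree h j => exact absurd (T _ _ hx) hx'
  | bottom p => exact Or.inr rfl
  | leg j r t ht => exact Or.inl (P _ _ _ (by omega) hx hx')
  | foot j r => exact Or.inl (P _ _ _ (by omega) hx hx')

/-- Without the root the dotted paths are dead ends hanging from the outer feet, so the set has to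
follow the bottom path from gap to gap and passes `S₁` (`c = 0`) and `T₁` (`c = 1`). If the place
`q` were free, no vertex would have shadow `q`, and shadows could not get past `q`. -/
theorem inner_mem_of_crosses {d i c : ℕ} (hd : 1 ≤ d) (hc : c ≤ 1) {X : Set Label}
    (h : Crosses d 0 i X) (hR : tree 1 i ∉ X) : gapEnd d ((i + c) * 2 ^ 0) (1 - c) ∈ X := by
  obtain ⟨s, hs, t, ht, h⟩ := h
  by_contra hX
  have m1 : (2 * i + 1) * d = 2 * i * d + d := by ring
  have m2 : (2 * i + 2) * d = 2 * i * d + 2 * d := by ring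
  have m3 : (2 * i + 3) * d = 2 * i * d + 3 * d := by ring
  have hq : gapEnd d ((i + c) * 2 ^ 0) (1 - c) = bottom ((2 * i + 1 + c) * d) := by
    unfold gapEnd; congr 2; simp; omega
  have hq1 : (2 * i + 1) * d ≤ (2 * i + 1 + c) * d := Nat.mul_le_mul_right _ (by omega)
  have hq2 : (2 * i + 1 + c) * d ≤ (2 * i + 2) * d := Nat.mul_le_mul_right _ (by omega)
  rw [hq] at hX
  generalize (2 * i + 1 + c) * d = q at *
  have hX' : ∀ x ∈ X, x ∈ trig d 0 i → shadow d x ≠ q := by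
    rintro x hx hx' rfl
    cases x with
    | tree h j =>
      simp only [NSS.shadow] at hq1
      have : 0 < (2 * i + 1) * d := by positivity
      omega
    | bottom p => exact hX hx
    | leg j r t =>
      have h2 : j / 2 ^ 0 = i := hx'
      obtain rfl : j = i := by simpa using h2
      cases r <;> simp only [NSS.shadow, footPos, Bool.false_eq_true, if_true, if_false] at * <;>
        omega
  have := h.closed (K := {x | shadow d x < q}) ?_ ?_
  · cases t with
    | tree h j => exact ht.elim
    | leg j r t => exact ht.elim
    | bottom p =>
      have h1 := ht.1
      have e2 : 2 * ((i + 1) * 2 ^ 0) * d = 2 * i * d + 2 * d := by ring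
      change p < q at this
      omega
  · rintro a ha ⟨h1, h2⟩ b ⟨h3, h4⟩ hab
    have h5 := hX' _ h1 h2
    have h6 := hX' _ h3 h4
    have n1 : a ≠ tree 1 i := by rintro rfl; exact hR h1
    have n2 : b ≠ tree 1 i := by rintro rfl; exact hR h3
    change shadow d a < q at ha
    change shadow d b < q
    rcases full_adj_cases hab with hab | hab
    · have := shadow_step hd hab h2 h4 n1 n2
      omega
    · have := shadow_step hd hab h4 h2 n2 n1
      omega
  · have h5 := hX' _ h.left_mem.1 h.left_mem.2
    cases s with
    | tree h j => exact hs.elim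
    | leg j r t => exact hs.elim
    | bottom p =>
      have h1 := hs.2
      simp only [add_zero, pow_zero, mul_one] at h1
      change p ≠ q at h5
      change p < q
      omega

/-- If a set joins the two gaps of a trigon without its root, an apart set cannot leave an inner
end of a gap towards the root or the other gap. -/
def NoInner (d n : ℕ) : Prop :=
  ∀ i A B, Apart A B → Crosses d n i B → tree (n + 1) i ∉ B → ∀ c ≤ 1, ∀ y,
    y = tree (n + 1) i ∨ y ∈ gap d ((i + (1 - c)) * 2 ^ n) →
    ¬ Reach d (A ∩ trig d n i) (gapEnd d ((i + c) * 2 ^ n) (1 - c)) y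

/-- Seen from child `e`, end `e` of the middle gap is the inner one, which `NoInner` forbids. -/
theorem NoInner.middle {d n i e b : ℕ} (H : NoInner d n) {A B : Set Label} (h : Apart A B)
    (hB : Crosses d n (2 * i + e) B) (hR : tree (n + 1) (2 * i + e) ∉ B) (he : e ≤ 1) (hb : b ≤ 1)
    {y : Label} (hy : y = tree (n + 1) (2 * i + e) ∨ y ∈ gap d ((2 * i + e + e) * 2 ^ n))
    (hA : Reach d (A ∩ trig d n (2 * i + e)) (gapEnd d ((2 * i + 1) * 2 ^ n) b) y) : b = 1 - e := by
  by_contra hb'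
  obtain rfl : b = e := by omega
  refine H _ A B h hB hR (1 - b) (by omega) y ?_ ?_
  · rwa [show 1 - (1 - b) = b by omega]
  · rwa [gap_child_middle hb, show 1 - (1 - b) = b by omega]

/-- If both sets miss the root, both cross both children. By induction one of them, say `A`,
contains the root of the left child; then `B` contains neither child root, these being siblings. Now
`NoInner` forces `A` through end `1` of the middle gap in the left child and through end `0` in the
right one, and no end is left for `B`. At height one both sets would contain `S₁`. -/
theorem root_mem_of_crosses {d : ℕ} (hd : 1 ≤ d) (n : ℕ) (H : ∀ m < n, NoInner d m) :
    ∀ i A B, Apart A B → Crosses d n i A → Crosses d n i B →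
      tree (n + 1) i ∈ A ∨ tree (n + 1) i ∈ B := by
  induction n with
  | zero =>
    intro i A B h hA hB
    by_contra! hR
    exact h.disj _ (inner_mem_of_crosses hd (c := 0) (by omega) hA hR.1)
      (inner_mem_of_crosses hd (by omega) hB hR.2)
  | succ n ih =>
    intro i A B h hA hB
    by_contra! hR
    have ih := ih fun m hm => H m (by omega)
    have H := H n (by omega)
    have main : ∀ A B, Apart A B → Crosses d (n + 1) i A → Crosses d (n + 1) i B →
        tree (n + 2) i ∉ A → tree (n + 2) i ∉ B → tree (n + 1) (2 * i) ∈ A → False := by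
      clear hA hB hR h A B
      intro A B h hA hB hRA hRB h0
      have n0 : tree (n + 1) (2 * i + 0) ∉ B := h.disj _ h0
      have n1 : tree (n + 1) (2 * i + 1) ∉ B := h.sibling _ _ 0 (by omega) h0
      obtain ⟨s0, hs0, b0, hb0, r0⟩ := hA.child' hd hRA (e := 0) (by omega)
      obtain ⟨s1, hs1, b1, hb1, r1⟩ := hA.child' hd hRA (e := 1) (by omega)
      obtain ⟨s, hs, b, hb, r⟩ := hB.child' hd hRB (e := 0) (by omega)
      have e0 := H.middle h (hB.child hd hRB (by omega)) n0 (by omega) hb0 (Or.inr hs0) r0.symm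
      have e1 := H.middle h (hB.child hd hRB (by omega)) n1 (by omega) hb1 (Or.inr hs1) r1.symm
      subst e0 e1
      obtain rfl | rfl : b = 0 ∨ b = 1 := by omega
      · exact h.disj _ r1.right_mem.1 r.right_mem.1
      · exact h.disj _ r0.right_mem.1 r.right_mem.1
    rcases ih (2 * i + 0) A B h (hA.child hd hR.1 (by omega)) (hB.child hd hR.2 (by omega)) with h0 | h0
    · exact main A B h hA hB hR.1 hR.2 h0
    · exact main B A h.symm hB hA hR.2 hR.1 h0

/-- Proved jointly with `root_mem_of_crosses`, which needs `NoInner` only at smaller heights. The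
set `A` contains the root, as the target of the walk or by that lemma, so `B` misses the root of
child `c`. The walk of `A` has to leave this child at its root or at the middle gap, and induction
forbids both. At height one the inner end is already in `B`. -/
theorem noInner {d : ℕ} (hd : 1 ≤ d) (n : ℕ) : NoInner d n := by
  induction n using Nat.strong_induction_on with
  | _ n ih =>
    intro i A B h hB hR c hc y hy hA
    cases n with
    | zero => exact h.disj _ hA.left_mem.1 (inner_mem_of_crosses hd hc hB hR)
    | succ n =>
      have RA : tree (n + 2) i ∈ A := by
        rcases hy with rfl | hy
        · exact hA.right_mem.1
        · have := root_mem_of_crosses hd (n + 1) ih i A B h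
            (crosses_of hc (gapEnd_mem_gap (by omega)) hy hA) hB
          exact this.resolve_right hR
      have hRc : tree (n + 1) (2 * i + c) ∉ B := by
        intro h1
        have := h.parent' _ _ h1
        rw [show (2 * i + c) / 2 = i by omega] at this
        exact this RA
      have g : gapEnd d ((i + c) * 2 ^ (n + 1)) (1 - c) ∈ gap d ((i + c) * 2 ^ (n + 1)) :=
        gapEnd_mem_gap (by omega)
      have key := ih n (by omega) (2 * i + c) A B h (hB.child hd hR hc) hRc c hc
      rw [gap_child_outer, gap_child_middle hc] at key
      rcases hA.exit_child hc hd (outer_mem_child hc g) with h1 | ⟨h1, -⟩ | ⟨b, hb, h1⟩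
      · rcases hy with rfl | hy
        · exact root_notMem_child h1.right_mem.2
        · exact outer_notMem_child hd hc hy h1.right_mem.2
      · exact key _ (Or.inl rfl) h1
      · exact key _ (Or.inr (gapEnd_mem_gap hb)) h1

/-- Pigeonhole for the three exits of a child: disjoint sets cannot both use two of them. -/
theorem eq_false_of_three {α : Type*} {X Y : Set α} (hXY : ∀ x ∈ X, x ∉ Y) {p q r a a' b b' : α}
    (ha : a = p ∨ a = q ∨ a = r) (ha' : a' = p ∨ a' = q ∨ a' = r) (hb : b = p ∨ b = q ∨ b = r)
    (hb' : b' = p ∨ b' = q ∨ b' = r) (h1 : a ≠ a') (h2 : b ≠ b') (h3 : a ∈ X) (h4 : a' ∈ X)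
    (h5 : b ∈ Y) (h6 : b' ∈ Y) : False := by
  have n1 : b ≠ a := by rintro rfl; exact hXY _ h3 h5
  have n2 : b ≠ a' := by rintro rfl; exact hXY _ h4 h5
  have n3 : b' ≠ a := by rintro rfl; exact hXY _ h3 h6
  have n4 : b' ≠ a' := by rintro rfl; exact hXY _ h4 h6
  clear hXY h3 h4 h5 h6
  grind

theorem eq_false_of_two {α : Type*} {q r a a' b : α} (ha : a = q ∨ a = r) (ha' : a' = q ∨ a' = r)
    (hb : b = q ∨ b = r) (h1 : a ≠ a') (h2 : a ≠ b) (h3 : a' ≠ b) : False := by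
  grind

/-- The vertices at which a walk can leave the child `e` of the trigon `n + 1`, `i`. -/
def IsExit (d n i e : ℕ) (x : Label) : Prop :=
  x = tree (n + 1) (2 * i + e) ∨ x = gapEnd d ((2 * i + 1) * 2 ^ n) 0 ∨
    x = gapEnd d ((2 * i + 1) * 2 ^ n) 1

theorem IsExit.or_gap {d n i e : ℕ} {x : Label} (h : IsExit d n i e x) :
    x = tree (n + 1) (2 * i + e) ∨ x ∈ gap d ((2 * i + 1) * 2 ^ n) := by
  rcases h with h | rfl | rfl
  · exact Or.inl h
  · exact Or.inr (gapEnd_mem_gap (by omega))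
  · exact Or.inr (gapEnd_mem_gap (by omega))

theorem Reach.leave {d n i e : ℕ} (he : e ≤ 1) (hd : 1 ≤ d) {X : Set Label} {x z : Label}
    (h : Reach d (X ∩ trig d (n + 1) i) x z) (hx : x ∈ trig d n (2 * i + e)) :
    Reach d (X ∩ trig d n (2 * i + e)) x z ∨
    ∃ a, IsExit d n i e a ∧ Reach d (X ∩ trig d n (2 * i + e)) x a ∧
      (a = tree (n + 1) (2 * i + e) → tree (n + 2) i ∈ X) := by
  rcases h.exit_child he hd hx with h | ⟨h, h'⟩ | ⟨b, hb, h⟩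
  · exact Or.inl h
  · exact Or.inr ⟨_, Or.inl rfl, h, fun _ => h'⟩
  · refine Or.inr ⟨_, ?_, h, fun h => ?_⟩
    · obtain rfl | rfl : b = 0 ∨ b = 1 := by omega
      · exact Or.inr (Or.inl rfl)
      · exact Or.inr (Or.inr rfl)
    · cases h

/-- Take the first exit seen from each end of the walk. If the two coincide, the walk can be
shortened to one inside the child. -/
theorem Reach.leave_return {d n i e : ℕ} (he : e ≤ 1) (hd : 1 ≤ d) {X : Set Label} {x z : Label}
    (h : Reach d (X ∩ trig d (n + 1) i) x z) (hx : x ∈ trig d n (2 * i + e))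
    (hz : z ∈ trig d n (2 * i + e)) :
    Reach d (X ∩ trig d n (2 * i + e)) x z ∨
    ∃ a a', IsExit d n i e a ∧ IsExit d n i e a' ∧ a ≠ a' ∧
      Reach d (X ∩ trig d n (2 * i + e)) x a ∧ Reach d (X ∩ trig d n (2 * i + e)) z a' ∧
      (a = tree (n + 1) (2 * i + e) → tree (n + 2) i ∈ X) ∧
      (a' = tree (n + 1) (2 * i + e) → tree (n + 2) i ∈ X) := by
  rcases h.leave he hd hx with h1 | ⟨a, h1, h2, h3⟩
  · exact Or.inl h1
  rcases h.symm.leave he hd hz with h1' | ⟨a', h1', h2', h3'⟩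
  · exact Or.inl h1'.symm
  by_cases haa : a = a'
  · subst haa
    exact Or.inl (h2.trans h2'.symm)
  · exact Or.inr ⟨a, a', h1, h1', haa, h2, h2', h3, h3'⟩

/-! ### Passing around a gap -/

/-- Two vertices, one on either side of a gap. -/
structure Flank (d m : ℕ) (x : ℕ → Label) : Prop where
  inside : ∀ n i e, e ≤ 1 → i * 2 ^ n < m → m < (i + 1) * 2 ^ n → x e ∈ trig d n i
  split : ∀ n i e, e ≤ 1 → m = (2 * i + 1) * 2 ^ n → x e ∈ trig d n (2 * i + e)
  outside : ∀ e ≤ 1, x e ∉ gap d m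
  -- Relevant for `d = 1`, where the bottom neighbour of a gap end can itself be an end of the next
  -- gap.
  corner : ∀ e ≤ 1, ∀ m', x e ∈ gap d m' → ∃ b ≤ 1, x e = gapEnd d m' b

theorem strict_cases {n i m : ℕ} (h1 : i * 2 ^ (n + 1) < m) (h2 : m < (i + 1) * 2 ^ (n + 1)) :
    m = (2 * i + 1) * 2 ^ n ∨ ∃ e ≤ 1, (2 * i + e) * 2 ^ n < m ∧ m < (2 * i + e + 1) * 2 ^ n := by
  have e1 : i * 2 ^ (n + 1) = (2 * i) * 2 ^ n := by ring
  have e2 : (i + 1) * 2 ^ (n + 1) = (2 * i + 1 + 1) * 2 ^ n := by ring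
  rw [e1] at h1
  rw [e2] at h2
  rcases lt_trichotomy m ((2 * i + 1) * 2 ^ n) with h | h | h
  · exact Or.inr ⟨0, by omega, h1, h⟩
  · exact Or.inl h
  · exact Or.inr ⟨1, by omega, h, h2⟩

theorem Flank.leave_middle {d n i e : ℕ} {x : ℕ → Label} {X : Set Label} (hd : 1 ≤ d)
    (hx : Flank d ((2 * i + 1) * 2 ^ n) x)
    (hX : ∀ b ≤ 1, gapEnd d ((2 * i + 1) * 2 ^ n) b ∉ X) (he : e ≤ 1) {z : Label}
    (h : Reach d (X ∩ trig d (n + 1) i) (x e) z) :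
    Reach d (X ∩ trig d n (2 * i + e)) (x e) z ∨
    (Reach d (X ∩ trig d n (2 * i + e)) (x e) (tree (n + 1) (2 * i + e)) ∧ tree (n + 2) i ∈ X) := by
  rcases h.exit_child he hd (hx.split _ _ _ he rfl) with h | h | ⟨b, hb, h⟩
  · exact Or.inl h
  · exact Or.inr h
  · exact absurd h.right_mem.1 (hX b hb)

/-- Two disjoint sets cannot both pass around a gap in the way described. -/
theorem flank_blocked {d : ℕ} (hd : 1 ≤ d) (n : ℕ) : ∀ i m, i * 2 ^ n < m → m < (i + 1) * 2 ^ n →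
    ∀ (X Y : Set Label) (x y : ℕ → Label), (∀ a ∈ X, a ∉ Y) → (∀ b ≤ 1, gapEnd d m b ∉ X) →
    (∀ b ≤ 1, gapEnd d m b ∉ Y) → Flank d m x → Flank d m y → ∀ c ≤ 1,
    (∀ s ≤ 1, ∃ z, (z = tree (n + 1) i ∨ z ∈ gap d ((i + (1 - c)) * 2 ^ n)) ∧
      Reach d (X ∩ trig d n i) (x s) z) →
    (∀ s ≤ 1, ∃ z ∈ gap d ((i + c) * 2 ^ n), Reach d (Y ∩ trig d n i) (y s) z) →
    ¬ Reach d (X ∩ trig d n i) (x 0) (x 1) → ¬ Reach d (Y ∩ trig d n i) (y 0) (y 1) → False := by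
  induction n with
  | zero => intro i m h1 h2; omega
  | succ n ih =>
    intro i m h1 h2 X Y x y hXY hX hY hx hy c hc hxz hyz nX nY
    rcases strict_cases h1 h2 with rfl | ⟨e, he, h3, h4⟩
    -- The gap is the middle one. The target of `X` is outside child `c` and that of `Y` is outside
    -- child `1 - c`; without the gap ends both sets can get out of these children only through the
    -- root of the trigon.
    · obtain ⟨z, hz, h⟩ := hxz c hc
      have RX : tree (n + 2) i ∈ X := by
        rcases hx.leave_middle hd hX hc h with h | h
        · rcases hz with rfl | hz
          · exact absurd h.right_mem.2 root_notMem_child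
          · exact absurd h.right_mem.2 (outer_notMem_child hd hc hz)
        · exact h.2
      obtain ⟨z, hz, h⟩ := hyz (1 - c) (by omega)
      have RY : tree (n + 2) i ∈ Y := by
        rcases hy.leave_middle hd hY (by omega) h with h | h
        · refine absurd h.right_mem.2 (outer_notMem_child hd (by omega) ?_)
          rwa [show 1 - (1 - c) = c by omega]
        · exact h.2
      exact hXY _ RX RY
    · have mx : ∀ s ≤ 1, x s ∈ trig d n (2 * i + e) := fun s hs => hx.inside _ _ _ hs h3 h4
      have my : ∀ s ≤ 1, y s ∈ trig d n (2 * i + e) := fun s hs => hy.inside _ _ _ hs h3 h4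
      have sub : ∀ Z : Set Label, Z ∩ trig d n (2 * i + e) ⊆ Z ∩ trig d (n + 1) i :=
        fun Z a ha => ⟨ha.1, child_subset he ha.2⟩
      have nX' : ¬ Reach d (X ∩ trig d n (2 * i + e)) (x 0) (x 1) := fun h => nX (h.mono (sub _))
      have nY' : ¬ Reach d (Y ∩ trig d n (2 * i + e)) (y 0) (y 1) := fun h => nY (h.mono (sub _))
      have ih := ih (2 * i + e) m h3 h4
      by_cases hce : c = e
      · subst hce
        have L : ∀ s ≤ 1, ∃ a, IsExit d n i c a ∧ Reach d (X ∩ trig d n (2 * i + c)) (x s) a := by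
          intro s hs
          obtain ⟨z, hz, h⟩ := hxz s hs
          rcases h.leave hc hd (mx s hs) with h | ⟨a, h, h', -⟩
          · rcases hz with rfl | hz
            · exact absurd h.right_mem.2 root_notMem_child
            · exact absurd h.right_mem.2 (outer_notMem_child hd hc hz)
          · exact ⟨a, h, h'⟩
        obtain ⟨a, ha, ra⟩ := L 0 (by omega)
        obtain ⟨a', ha', ra'⟩ := L 1 (by omega)
        -- `X` uses two of the three exits of the child. So a walk of `Y` cannot leave and come back
        -- through different exits, and it can be kept inside the child.
        have haa : a ≠ a' := by
          rintro rfl; exact nX' (ra.trans ra'.symm)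
        refine ih X Y x y hXY hX hY hx hy c hc (fun s hs => ?_) (fun s hs => ?_) nX' nY'
        · obtain ⟨a, ha, ra⟩ := L s hs
          rw [gap_child_middle hc]
          exact ⟨a, ha.or_gap, ra⟩
        · obtain ⟨z, hz, h⟩ := hyz s hs
          rw [gap_child_outer]
          rcases h.leave_return hc hd (my s hs) (outer_mem_child hc hz) with
            h | ⟨b, b', hb, hb', hbb, rb, rb', -⟩
          · exact ⟨z, hz, h⟩
          · exact (eq_false_of_three hXY ha ha' hb hb' haa hbb ra.right_mem.1 ra'.right_mem.1
              rb.right_mem.1 rb'.right_mem.1).elim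
      · obtain rfl : c = 1 - e := by omega
        rw [show 1 - (1 - e) = e by omega] at hxz
        have L : ∀ s ≤ 1, ∃ a, IsExit d n i e a ∧ Reach d (Y ∩ trig d n (2 * i + e)) (y s) a ∧
            (a = tree (n + 1) (2 * i + e) → tree (n + 2) i ∈ Y) := by
          intro s hs
          obtain ⟨z, hz, h⟩ := hyz s hs
          rcases h.leave he hd (my s hs) with h | h
          · exact absurd h.right_mem.2 (outer_notMem_child hd he hz)
          · exact h
        obtain ⟨a, ha, ra, Ra⟩ := L 0 (by omega)
        obtain ⟨a', ha', ra', Ra'⟩ := L 1 (by omega)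
        have haa : a ≠ a' := by
          rintro rfl; exact nY' (ra.trans ra'.symm)
        -- Here `Y` uses two exits. If `Y` has the root of the trigon, then `X` must end in the gap
        -- and the sets exchange their roles. Otherwise `Y` uses both ends of the middle gap and
        -- only the child root is left to `X`.
        by_cases hR : tree (n + 2) i ∈ Y
        · refine ih Y X y x (fun a h1 h2 => hXY a h2 h1) hY hX hy hx e he (fun s hs => ?_)
            (fun s hs => ?_) nY' nX'
          · obtain ⟨a, ha, ra, -⟩ := L s hs
            rw [gap_child_middle he]
            exact ⟨a, ha.or_gap, ra⟩
          · obtain ⟨z, hz, h⟩ := hxz s hs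
            have hz := hz.resolve_left (by rintro rfl; exact hXY _ h.right_mem.1 hR)
            rw [gap_child_outer]
            rcases h.leave_return he hd (mx s hs) (outer_mem_child he hz) with
              h | ⟨b, b', hb, hb', hbb, rb, rb', -⟩
            · exact ⟨z, hz, h⟩
            · exact (eq_false_of_three hXY hb hb' ha ha' hbb haa rb.right_mem.1 rb'.right_mem.1
                ra.right_mem.1 ra'.right_mem.1).elim
        · have na : a ≠ tree (n + 1) (2 * i + e) := fun h => hR (Ra h)
          have na' : a' ≠ tree (n + 1) (2 * i + e) := fun h => hR (Ra' h)
          refine ih X Y x y hXY hX hY hx hy (1 - e) hc (fun s hs => ?_) (fun s hs => ?_) nX' nY'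
          · obtain ⟨z, hz, h⟩ := hxz s hs
            rw [show 1 - (1 - e) = e by omega, gap_child_outer]
            rcases h.leave he hd (mx s hs) with h | ⟨b, hb, rb, -⟩
            · rcases hz with rfl | hz
              · exact absurd h.right_mem.2 root_notMem_child
              · exact ⟨z, Or.inr hz, h⟩
            · refine ⟨b, Or.inl ?_, rb⟩
              by_contra hb0
              have n1 : a ≠ b := by rintro rfl; exact hXY _ rb.right_mem.1 ra.right_mem.1
              have n2 : a' ≠ b := by rintro rfl; exact hXY _ rb.right_mem.1 ra'.right_mem.1
              exact eq_false_of_two (ha.resolve_left na) (ha'.resolve_left na')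
                (hb.resolve_left hb0) haa n1 n2
          · obtain ⟨a, ha, ra, Ra⟩ := L s hs
            rw [gap_child_middle he]
            exact ⟨a, ha.or_gap.resolve_left fun h => hR (Ra h), ra⟩

theorem not_adj_bottom_tree {d p n i : ℕ} : ¬ (full d).Adj (bottom p) (tree (n + 2) i) := by
  intro h
  generalize hx : tree (n + 2) i = x at h
  generalize hy : bottom p = y at h
  rcases full_adj_cases h with h | h
  · cases h with
    | tree h j => cases hy
    | bottom q => cases hx
    | leg j r t ht => cases hx
    | foot j r => cases hx
  · cases h with
    | tree h j => cases hy
    | bottom q => cases hx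
    | leg j r t ht => cases hy
    | foot j r =>
      unfold footTop legPoint at hx
      split_ifs at hx <;> simp at hx

/-- A walk that leaves a child through a single end of the middle gap continues from there in the
other child. -/
theorem Reach.sibling {d n i e b : ℕ} (he : e ≤ 1) (hd : 1 ≤ d) (hb : b ≤ 1) {Z : Set Label}
    {x z : Label} (hn' : gapEnd d ((2 * i + 1) * 2 ^ n) (1 - b) ∉ Z)
    (hxn : Reach d (Z ∩ trig d n (2 * i + e)) x (gapEnd d ((2 * i + 1) * 2 ^ n) b))
    (hxz : Reach d (Z ∩ trig d (n + 1) i) x z)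
    (hz : ¬ Reach d (Z ∩ trig d n (2 * i + e)) x z)
    (hR : tree (n + 2) i ∈ Z → ¬ Reach d (Z ∩ trig d n (2 * i + e)) x (tree (n + 1) (2 * i + e))) :
    (tree (n + 2) i ∈ Z ∧ Reach d (Z ∩ trig d n (2 * i + (1 - e)))
      (gapEnd d ((2 * i + 1) * 2 ^ n) b) (tree (n + 1) (2 * i + (1 - e)))) ∨
    Reach d (Z ∩ trig d n (2 * i + (1 - e))) (gapEnd d ((2 * i + 1) * 2 ^ n) b) z := by
  by_contra! hcon
  obtain ⟨hc1, hc2⟩ := hcon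
  have hn := hxn.right_mem.1
  have gm : gapEnd d ((2 * i + 1) * 2 ^ n) b ∈ gap d ((2 * i + 1) * 2 ^ n) := gapEnd_mem_gap hb
  have uniq : ∀ b' ≤ 1, gapEnd d ((2 * i + 1) * 2 ^ n) b' ∈ Z → b' = b := by
    intro b' hb' h
    by_contra hne
    obtain rfl : b' = 1 - b := by omega
    exact hn' h
  -- The part reached from `x` in the child and the part reached from the gap end in its sibling are
  -- together closed under steps in `Z`; the assumptions exclude every other way out.
  have := hxz.closed (K := {a | Reach d (Z ∩ trig d n (2 * i + e)) x a ∨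
    Reach d (Z ∩ trig d n (2 * i + (1 - e))) (gapEnd d ((2 * i + 1) * 2 ^ n) b) a}) ?_ ?_
  · rcases this with h | h
    · exact hz h
    · exact hc2 h
  · rintro a (ha | ha) haZ c ⟨hcZ, hcT⟩ hac
    · by_cases hc : c ∈ trig d n (2 * i + e)
      · exact Or.inl (ha.tail hac ⟨hcZ, hc⟩)
      · rcases child_boundary he hd hac ha.right_mem.2 hcT hc with ⟨rfl, rfl⟩ | ⟨b', hb', rfl⟩
        · exact absurd ha (hR hcZ)
        · obtain rfl := uniq b' hb' haZ.1
          rcases mem_sibling he hcT hc with rfl | hc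
          · exact absurd hac not_adj_bottom_tree
          · exact Or.inr (Reach.of_adj hac ⟨hn, middle_mem_child (by omega) gm⟩ ⟨hcZ, hc⟩)
    · by_cases hc : c ∈ trig d n (2 * i + (1 - e))
      · exact Or.inr (ha.tail hac ⟨hcZ, hc⟩)
      · rcases child_boundary (by omega) hd hac ha.right_mem.2 hcT hc with
          ⟨rfl, rfl⟩ | ⟨b', hb', rfl⟩
        · exact absurd ha (hc1 hcZ)
        · obtain rfl := uniq b' hb' haZ.1
          rcases mem_sibling (by omega) hcT hc with rfl | hc
          · exact absurd hac not_adj_bottom_tree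
          · rw [show 1 - (1 - e) = e by omega] at hc
            exact Or.inl (hxn.tail hac ⟨hcZ, hc⟩)
  · exact Or.inl (Reach.refl hxn.left_mem)

/-- `A` without the ends of the gap `m`. -/
def broken (d m : ℕ) (A : Set Label) : Set Label := {a ∈ A | ∀ b ≤ 1, a ≠ gapEnd d m b}

/-- If `A` and `B` pass through different ends of a gap, then it is impossible that `A` closes up
around the gap within a trigon while `B` closes up there or leaves the trigon on both sides. -/
theorem not_joined {d : ℕ} (hd : 1 ≤ d) (n : ℕ) : ∀ i m, i * 2 ^ n < m → m < (i + 1) * 2 ^ n →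
    ∀ (A B : Set Label) (x y : ℕ → Label) (q : ℕ), q ≤ 1 → Apart A B →
    gapEnd d m q ∈ A → gapEnd d m (1 - q) ∈ B → Flank d m x → Flank d m y →
    (∀ s ≤ 1, (full d).Adj (gapEnd d m q) (x s)) →
    (∀ s ≤ 1, (full d).Adj (gapEnd d m (1 - q)) (y s)) →
    Reach d (broken d m A ∩ trig d n i) (x 0) (x 1) →
    (Reach d (broken d m B ∩ trig d n i) (y 0) (y 1) ∨ ∀ s ≤ 1, ∃ z,
      (z = tree (n + 1) i ∨ ∃ c ≤ 1, z ∈ gap d ((i + c) * 2 ^ n)) ∧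
        Reach d (broken d m B ∩ trig d n i) (y s) z) → False := by
  have bsub : ∀ m A, broken d m A ⊆ A := fun m A a ha => ha.1
  have bend : ∀ m A, ∀ b ≤ 1, gapEnd d m b ∉ broken d m A := fun m A b hb h => h.2 b hb rfl
  induction n with
  | zero => intro i m h1 h2; omega
  | succ n ih =>
    intro i m h1 h2 A B x y q hq hAB hA hB hx hy ax ay jX jY
    have hXY : ∀ a ∈ broken d m A, a ∉ broken d m B := fun a ha hb => hAB.disj a ha.1 hb.1
    have root_side : ∀ {z e}, e ≤ 1 → (z = tree (n + 2) i ∨ ∃ c ≤ 1, z ∈ gap d ((i + c) * 2 ^ (n + 1))) →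
        z ∈ trig d n (2 * i + e) → z ∈ gap d ((i + e) * 2 ^ (n + 1)) := by
      rintro z e he (rfl | ⟨c, hc, hz⟩) hz'
      · exact absurd hz' root_notMem_child
      · by_cases hce : c = e
        · rwa [← hce]
        · obtain rfl : c = 1 - e := by omega
          exact absurd hz' (outer_notMem_child hd he hz)
    rcases strict_cases h1 h2 with rfl | ⟨e, he, h3, h4⟩
    -- The gap is the middle one: joining its flanks without its ends means climbing to both child
    -- roots and to the root of the trigon.
    · have go : ∀ (Z : Set Label) (x : ℕ → Label), Flank d ((2 * i + 1) * 2 ^ n) x →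
          Reach d (broken d ((2 * i + 1) * 2 ^ n) Z ∩ trig d (n + 1) i) (x 0) (x 1) → ∀ e ≤ 1,
          Reach d (broken d ((2 * i + 1) * 2 ^ n) Z ∩ trig d n (2 * i + e)) (x e)
            (tree (n + 1) (2 * i + e)) ∧ tree (n + 2) i ∈ Z := by
        intro Z x hx j e he
        have j : Reach d (broken d ((2 * i + 1) * 2 ^ n) Z ∩ trig d (n + 1) i) (x e) (x (1 - e)) := by
          obtain rfl | rfl : e = 0 ∨ e = 1 := by omega
          · exact j
          · exact j.symm
        rcases hx.leave_middle hd (bend _ _) he j with h | h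
        · exact absurd (mem_inter_children he h.right_mem.2 (hx.split _ _ _ (by omega) rfl))
            (hx.outside _ (by omega))
        · exact ⟨h.1, h.2.1⟩
      obtain ⟨rX, RX⟩ := go A x hx jX q hq
      rcases jY with jY | jY
      · exact hAB.disj _ RX (go B y hy jY q hq).2
      · obtain ⟨z, hz, h⟩ := jY q hq
        rcases hy.leave_middle hd (bend _ _) hq h with h | h
        · have hz := root_side hq hz h.right_mem.2
          have g : gapEnd d ((2 * i + 1) * 2 ^ n) (1 - q) ∈ gap d ((2 * i + 1) * 2 ^ n) :=
            gapEnd_mem_gap (by omega)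
          have g' : gapEnd d ((2 * i + 1) * 2 ^ n) q ∈ gap d ((2 * i + 1) * 2 ^ n) :=
            gapEnd_mem_gap hq
          rw [← gap_child_outer] at hz
          have cB : Crosses d n (2 * i + q) B := by
            refine crosses_of hq hz (t := gapEnd d ((2 * i + 1) * 2 ^ n) (1 - q)) ?_ ?_
            · rwa [gap_child_middle hq]
            · refine ((Reach.of_adj (X := B ∩ trig d n (2 * i + q)) (ay q hq) ⟨hB, middle_mem_child hq g⟩
                ⟨h.left_mem.1.1, h.left_mem.2⟩).trans (h.mono ?_)).symm
              exact fun a ha => ⟨ha.1.1, ha.2⟩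
          -- `B` crosses child `q`, while `A` goes from end `q` of the middle gap, the inner one for
          -- this child, to the child root; the lemma then says `q = 1 - q`.
          have := (noInner hd n).middle hAB cB (hAB.disj _ rX.right_mem.1.1) hq hq (Or.inl rfl)
            ((Reach.of_adj (X := A ∩ trig d n (2 * i + q)) (ax q hq) ⟨hA, middle_mem_child hq g'⟩
                ⟨rX.left_mem.1.1, rX.left_mem.2⟩).trans (rX.mono fun a ha => ⟨ha.1.1, ha.2⟩))
          omega
        · exact hAB.disj _ RX h.2.1
    · have mx : ∀ s ≤ 1, x s ∈ trig d n (2 * i + e) := fun s hs => hx.inside _ _ _ hs h3 h4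
      have my : ∀ s ≤ 1, y s ∈ trig d n (2 * i + e) := fun s hs => hy.inside _ _ _ hs h3 h4
      have sub : ∀ Z : Set Label, Z ∩ trig d n (2 * i + e) ⊆ Z ∩ trig d (n + 1) i :=
        fun Z a ha => ⟨ha.1, child_subset he ha.2⟩
      have exits : ∀ {a : Label}, IsExit d n i e a →
          a = tree (n + 1) (2 * i + e) ∨ ∃ c ≤ 1, a ∈ gap d ((2 * i + e + c) * 2 ^ n) := by
        intro a ha
        refine ha.or_gap.imp_right fun h => ⟨1 - e, by omega, ?_⟩
        rwa [gap_child_middle he]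
      have joined : ∀ (Z : Set Label) (x : ℕ → Label), (∀ s ≤ 1, x s ∈ trig d n (2 * i + e)) →
          Reach d (Z ∩ trig d (n + 1) i) (x 0) (x 1) →
          Reach d (Z ∩ trig d n (2 * i + e)) (x 0) (x 1) ∨ ∃ a : ℕ → Label, a 0 ≠ a 1 ∧
            ∀ s ≤ 1, IsExit d n i e (a s) ∧ Reach d (Z ∩ trig d n (2 * i + e)) (x s) (a s) ∧
              (a s = tree (n + 1) (2 * i + e) → tree (n + 2) i ∈ Z) := by
        intro Z x hx h
        rcases h.leave_return he hd (hx 0 (by omega)) (hx 1 (by omega)) with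
          h | ⟨a, a', h1, h2, h3, h4, h5, h6, h7⟩
        · exact Or.inl h
        · refine Or.inr ⟨fun s => if s = 0 then a else a', by simpa using h3, fun s hs => ?_⟩
          obtain rfl | rfl : s = 0 ∨ s = 1 := by omega
          · exact ⟨h1, h4, h6⟩
          · exact ⟨h2, h5, h7⟩
      -- If one of the sets already closes up in the child, induction applies there, with exchanged
      -- roles if that set is `B`.
      by_cases nX : Reach d (broken d m A ∩ trig d n (2 * i + e)) (x 0) (x 1)
      · refine ih _ m h3 h4 A B x y q hq hAB hA hB hx hy ax ay nX ?_
        rcases jY with jY | jY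
        · rcases joined _ y my jY with h | ⟨a, -, h⟩
          · exact Or.inl h
          · exact Or.inr fun s hs => ⟨a s, exits (h s hs).1, (h s hs).2.1⟩
        · refine Or.inr fun s hs => ?_
          obtain ⟨z, hz, h⟩ := jY s hs
          rcases h.leave he hd (my s hs) with h | ⟨a, h, h', -⟩
          · refine ⟨z, Or.inr ⟨e, he, ?_⟩, h⟩
            rw [gap_child_outer]
            exact root_side he hz h.right_mem.2
          · exact ⟨a, exits h, h'⟩
      obtain ⟨a, haa, ha⟩ := (joined _ x mx jX).resolve_left nX
      by_cases nY : Reach d (broken d m B ∩ trig d n (2 * i + e)) (y 0) (y 1)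
      · exact ih _ m h3 h4 B A y x (1 - q) (by omega) hAB.symm hB
          (by rwa [show 1 - (1 - q) = q by omega]) hy hx ay
          (by rwa [show 1 - (1 - q) = q by omega]) nY
          (Or.inr fun s hs => ⟨a s, exits (ha s hs).1, (ha s hs).2.1⟩)
      -- Neither set closes up in the child, so `A` uses two of its three exits; if `B` closed up in
      -- the trigon, it would use two as well.
      rcases jY with jY | jY
      · obtain ⟨b, hbb, hb⟩ := (joined _ y my jY).resolve_left nY
        exact eq_false_of_three hXY (ha 0 (by omega)).1 (ha 1 (by omega)).1 (hb 0 (by omega)).1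
          (hb 1 (by omega)).1 haa hbb (ha 0 (by omega)).2.1.right_mem.1
          (ha 1 (by omega)).2.1.right_mem.1 (hb 0 (by omega)).2.1.right_mem.1
          (hb 1 (by omega)).2.1.right_mem.1
      have blocked := flank_blocked hd n (2 * i + e) m h3 h4
      -- `A` leaves the child through its root and one end of the middle gap, or through both ends.
      -- In the second case `flank_blocked` applies with the roles of the two sets exchanged.
      by_cases hRe : ∃ s ≤ 1, a s = tree (n + 1) (2 * i + e)
      · obtain ⟨s1, hs1, has1⟩ := hRe
        have Re : tree (n + 1) (2 * i + e) ∈ broken d m A := by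
          rw [← has1]; exact (ha s1 hs1).2.1.right_mem.1
        have RX : tree (n + 2) i ∈ broken d m A := (ha s1 hs1).2.2 has1
        have hstar : ∃ b ≤ 1, a (1 - s1) = gapEnd d ((2 * i + 1) * 2 ^ n) b := by
          have h5 : a (1 - s1) ≠ tree (n + 1) (2 * i + e) := by
            intro h6
            obtain rfl | rfl : s1 = 0 ∨ s1 = 1 := by omega
            · exact haa (has1.trans h6.symm)
            · exact haa (h6.trans has1.symm)
          rcases (ha (1 - s1) (by omega)).1.resolve_left h5 with h | h
          · exact ⟨0, by omega, h⟩
          · exact ⟨1, by omega, h⟩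
        obtain ⟨b, hb, hab⟩ := hstar
        have rA := (ha (1 - s1) (by omega)).2.1
        have rR := (ha s1 hs1).2.1
        rw [hab] at rA
        rw [has1] at rR
        have nA : gapEnd d ((2 * i + 1) * 2 ^ n) b ∈ broken d m A := rA.right_mem.1
        -- the other end of the middle gap is the only exit for `B`
        have exB : ∀ {s c}, IsExit d n i e c → Reach d (broken d m B ∩ trig d n (2 * i + e)) (y s) c →
            c = gapEnd d ((2 * i + 1) * 2 ^ n) (1 - b) := by
          intro s c hc h
          have h5 := h.right_mem.1
          rcases hc with rfl | rfl | rfl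
          · exact absurd h5 (hXY _ Re)
          · obtain rfl | rfl : b = 0 ∨ b = 1 := by omega
            · exact absurd h5 (hXY _ nA)
            · rfl
          · obtain rfl | rfl : b = 0 ∨ b = 1 := by omega
            · rfl
            · exact absurd h5 (hXY _ nA)
        by_cases hin : ∀ s ≤ 1, ∃ z ∈ gap d ((i + e) * 2 ^ (n + 1)),
            Reach d (broken d m B ∩ trig d n (2 * i + e)) (y s) z
        · refine blocked (broken d m A) (broken d m B) x y hXY (bend _ _) (bend _ _) hx hy e he
            (fun s hs => ?_) (fun s hs => ?_) nX nY
          · rw [gap_child_middle he]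
            exact ⟨a s, (ha s hs).1.or_gap, (ha s hs).2.1⟩
          · rw [gap_child_outer]; exact hin s hs
        -- Now `B` runs from the outer gap of child `e` past the gap `m` and the end `1 - b` of the
        -- middle gap to the far gap, crossing both children, while `A` goes from end `b` to both
        -- child roots. `NoInner` yields `b = 1 - e` in the child and `b = e` in its sibling.
        · push Not at hin
          obtain ⟨s2, hs2, hin⟩ := hin
          have lv : ∀ s ≤ 1, (∃ z ∈ gap d ((i + e) * 2 ^ (n + 1)),
              Reach d (broken d m B ∩ trig d n (2 * i + e)) (y s) z) ∨
              Reach d (broken d m B ∩ trig d n (2 * i + e)) (y s)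
                (gapEnd d ((2 * i + 1) * 2 ^ n) (1 - b)) := by
            intro s hs
            obtain ⟨z, hz, h⟩ := jY s hs
            rcases h.leave he hd (my s hs) with h | ⟨c, hc, h, -⟩
            · exact Or.inl ⟨z, root_side he hz h.right_mem.2, h⟩
            · rw [← exB hc h]; exact Or.inr h
          have r2 := (lv s2 hs2).resolve_left (by push Not; exact hin)
          have r3 : ∃ z ∈ gap d ((i + e) * 2 ^ (n + 1)),
              Reach d (broken d m B ∩ trig d n (2 * i + e)) (y (1 - s2)) z := by
            refine (lv (1 - s2) (by omega)).resolve_right fun h => nY ?_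
            have := r2.trans h.symm
            obtain rfl | rfl : s2 = 0 ∨ s2 = 1 := by omega
            · exact this
            · exact this.symm
          obtain ⟨z3, hz3, r3⟩ := r3
          obtain ⟨z2, hz2, j2⟩ := jY s2 hs2
          have nz2 : ¬ Reach d (broken d m B ∩ trig d n (2 * i + e)) (y s2) z2 := fun h =>
            hin z2 (root_side he hz2 h.right_mem.2) h
          have hz2 : z2 ∈ gap d ((i + (1 - e)) * 2 ^ (n + 1)) := by
            rcases hz2 with rfl | ⟨c, hc, hz2⟩
            · exact absurd j2.right_mem.1 (hXY _ RX)
            · by_cases hce : c = e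
              · subst hce
                rcases j2.leave_return he hd (my s2 hs2) (outer_mem_child he hz2) with
                  h | ⟨c, c', hc, hc', hcc, h5, h6, h7, h8⟩
                · exact absurd h nz2
                · exact absurd (eq_false_of_three hXY (ha s1 hs1).1 (ha (1 - s1) (by omega)).1
                      hc hc' (by
                        rw [has1, hab]; intro h; cases h) hcc (ha s1 hs1).2.1.right_mem.1
                      (ha (1 - s1) (by omega)).2.1.right_mem.1 h5.right_mem.1 h6.right_mem.1) id
              · rwa [show 1 - e = c by omega]
          have bs : ∀ (Z T : Set Label), broken d m Z ∩ T ⊆ Z ∩ T := fun Z T a ha => ⟨ha.1.1, ha.2⟩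
          have gm : ∀ c ≤ 1, gapEnd d ((2 * i + 1) * 2 ^ n) c ∈ gap d ((2 * i + 1) * 2 ^ n) :=
            fun c hc => gapEnd_mem_gap hc
          have mq : ∀ c ≤ 1, gapEnd d m c ∈ trig d n (2 * i + e) := by
            intro c hc
            have h5 : gapEnd d m c ∈ gap d m := gapEnd_mem_gap hc
            exact ⟨(Nat.mul_le_mul_right d (by omega)).trans h5.1,
              h5.2.trans (Nat.mul_le_mul_right d (by omega))⟩
          -- in the child
          have cB : Crosses d n (2 * i + e) B := by
            refine crosses_of he (s := z3) (t := gapEnd d ((2 * i + 1) * 2 ^ n) (1 - b)) ?_ ?_ ?_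
            · rwa [gap_child_outer]
            · rw [gap_child_middle he]; exact gm _ (by omega)
            · exact (r3.mono (bs _ _)).symm.trans ((Reach.of_adj (X := B ∩ trig d n (2 * i + e)) (ay _ (by omega)).symm
                (bs _ _ r3.left_mem) ⟨hB, mq _ (by omega)⟩).trans ((Reach.of_adj (X := B ∩ trig d n (2 * i + e)) (ay _ hs2)
                ⟨hB, mq _ (by omega)⟩ (bs _ _ r2.left_mem)).trans (r2.mono (bs _ _))))
          have b1 := (noInner hd n).middle hAB cB (hAB.disj _ Re.1) he hb (Or.inl rfl)
            ((rA.mono (bs _ _)).symm.trans ((Reach.of_adj (X := A ∩ trig d n (2 * i + e)) (ax _ (by omega)).symm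
                (bs _ _ rA.left_mem) ⟨hA, mq _ (by omega)⟩).trans ((Reach.of_adj (X := A ∩ trig d n (2 * i + e)) (ax _ hs1)
                ⟨hA, mq _ (by omega)⟩ (bs _ _ rR.left_mem)).trans (rR.mono (bs _ _)))))
          -- in its sibling
          have jX' : Reach d (broken d m A ∩ trig d (n + 1) i) (x (1 - s1)) (x s1) := by
            obtain rfl | rfl : s1 = 0 ∨ s1 = 1 := by omega
            · exact jX.symm
            · exact jX
          have nX' : ¬ Reach d (broken d m A ∩ trig d n (2 * i + e)) (x (1 - s1)) (x s1) := by
            intro h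
            obtain rfl | rfl : s1 = 0 ∨ s1 = 1 := by omega
            · exact nX h.symm
            · exact nX h
          have oB : gapEnd d ((2 * i + 1) * 2 ^ n) (1 - b) ∈ broken d m B := r2.right_mem.1
          have sA : Reach d (broken d m A ∩ trig d n (2 * i + (1 - e)))
              (gapEnd d ((2 * i + 1) * 2 ^ n) b) (tree (n + 1) (2 * i + (1 - e))) := by
            rcases rA.sibling he hd hb (fun h => hXY _ h oB) jX' nX'
              (fun _ h => nX' (h.trans rR.symm)) with h | h
            · exact h.2
            · have h5 := mem_inter_children he (mx s1 hs1) h.right_mem.2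
              obtain ⟨b', hb', h6⟩ := hx.corner s1 hs1 _ h5
              have h7 : gapEnd d ((2 * i + 1) * 2 ^ n) b' ∈ broken d m A := by
                rw [← h6]; exact rR.left_mem.1
              obtain rfl | rfl : b' = b ∨ b' = 1 - b := by omega
              · rw [← h6] at rA
                exact absurd rA nX'
              · exact absurd oB (hXY _ h7)
          have sB : Reach d (broken d m B ∩ trig d n (2 * i + (1 - e)))
              (gapEnd d ((2 * i + 1) * 2 ^ n) (1 - b)) z2 := by
            rcases r2.sibling he hd (by omega)
              (by rw [show 1 - (1 - b) = b by omega]; exact fun h => hXY _ nA h) j2 nz2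
              (fun h => absurd h (hXY _ RX)) with h | h
            · exact absurd h.1 (hXY _ RX)
            · exact h
          have cB' : Crosses d n (2 * i + (1 - e)) B := by
            refine crosses_of (c := 1 - e) (by omega) (s := z2)
              (t := gapEnd d ((2 * i + 1) * 2 ^ n) (1 - b)) ?_ ?_ (sB.mono (bs _ _)).symm
            · rwa [gap_child_outer]
            · rw [gap_child_middle (by omega)]; exact gm _ (by omega)
          have b2 := (noInner hd n).middle hAB cB' (hAB.disj _ sA.right_mem.1.1) (by omega) hb
            (Or.inl rfl) (sA.mono (bs _ _))
          omega
      · push Not at hRe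
        refine blocked (broken d m B) (broken d m A) y x (fun a h1 h2 => hXY a h2 h1) (bend _ _)
          (bend _ _) hy hx (1 - e) (by omega) (fun s hs => ?_) (fun s hs => ?_) nY nX
        · obtain ⟨z, hz, h⟩ := jY s hs
          rw [show 1 - (1 - e) = e by omega, gap_child_outer]
          rcases h.leave he hd (my s hs) with h | ⟨b, hb, rb, -⟩
          · exact ⟨z, Or.inr (root_side he hz h.right_mem.2), h⟩
          · refine ⟨b, Or.inl ?_, rb⟩
            by_contra hb0
            have n1 : ∀ s ≤ 1, a s ≠ b := by
              rintro s hs rfl; exact hXY _ (ha s hs).2.1.right_mem.1 rb.right_mem.1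
            exact eq_false_of_two ((ha 0 (by omega)).1.resolve_left (hRe 0 (by omega)))
              ((ha 1 (by omega)).1.resolve_left (hRe 1 (by omega))) (hb.resolve_left hb0) haa
              (n1 0 (by omega)) (n1 1 (by omega))
        · rw [gap_child_middle he]
          exact ⟨a s, (ha s hs).1.or_gap.resolve_left (hRe s hs), (ha s hs).2.1⟩

/-! ### Closed walks that are odd on foot edges -/

/-- The index of the dotted path ending at the left (`r = false`) or right end of the gap `i + 1`. -/
def footIdx (i : ℕ) (r : Bool) : ℕ := if r then i else i + 1

/-- The two neighbours outside the gap of the left or right end of the gap `i + 1`. -/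
def flankPt (d i : ℕ) (r : Bool) (s : ℕ) : Label :=
  if r then if s = 0 then footTop d i true else bottom ((2 * (i + 1) + 1) * d + 1)
  else if s = 0 then bottom (2 * (i + 1) * d - 1) else footTop d (i + 1) false

theorem legPoint_ne_bottom {d j t : ℕ} {s : Bool} (ht : t < d) (p : ℕ) :
    legPoint d j s t ≠ bottom p := by
  unfold legPoint; split_ifs <;> simp

theorem footTop_notMem_gap {d i m : ℕ} {r : Bool} (hd : 1 ≤ d) : footTop d i r ∉ gap d m := by
  unfold footTop legPoint
  split_ifs <;> first | exact id | omega

theorem flank_flankPt {d : ℕ} (hd : 1 ≤ d) (i : ℕ) (r : Bool) :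
    Flank d (i + 1) (flankPt d i r) := by
  have e1 : (2 * (i + 1) + 1) * d = 2 * (i + 1) * d + d := by ring
  have pos : d ≤ 2 * (i + 1) * d := by nlinarith
  have mono : ∀ a b : ℕ, a + 1 ≤ b → 2 * a * d + 2 * d ≤ 2 * b * d := fun a b h => by
    have := Nat.mul_le_mul_right d h
    nlinarith
  have lo : ∀ a : ℕ, a < i + 1 → 2 * a * d ≤ 2 * (i + 1) * d - 1 := fun a h => by
    have := mono _ _ h; omega
  have hi : ∀ a : ℕ, i + 1 ≤ a → 2 * (i + 1) * d - 1 ≤ (2 * a + 1) * d := fun a h => by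
    have := Nat.mul_le_mul_right d (show 2 * (i + 1) ≤ 2 * a + 1 by omega); omega
  have lo' : ∀ a : ℕ, a ≤ i + 1 → 2 * a * d ≤ (2 * (i + 1) + 1) * d + 1 := fun a h => by
    have := Nat.mul_le_mul_right d (show 2 * a ≤ 2 * (i + 1) + 1 by omega); omega
  have hi' : ∀ a : ℕ, i + 1 < a → (2 * (i + 1) + 1) * d + 1 ≤ (2 * a + 1) * d := fun a h => by
    have := mono _ _ h
    have : (2 * a + 1) * d = 2 * a * d + d := by ring
    omega
  cases r
  · refine ⟨fun n a s hs h1 h2 => ?_, fun n a s hs h1 => ?_, fun s hs => ?_, fun s hs m' h => ?_⟩ <;>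
      obtain rfl | rfl : s = 0 ∨ s = 1 := by omega
    · exact ⟨lo _ h1, hi _ h2.le⟩
    · rw [flankPt, if_neg (by simp), if_neg (by simp), footTop_mem_trig hd, div_pow_eq_iff]
      exact ⟨h1.le, h2⟩
    · have hp : 0 < 2 ^ n := by positivity
      have e2 : (2 * a + 1) * 2 ^ n = 2 * a * 2 ^ n + 2 ^ n := by ring
      exact ⟨lo _ (by simp only [add_zero]; omega), hi _ (by simp only [add_zero]; omega)⟩
    · rw [flankPt, if_neg (by simp), if_neg (by simp), footTop_mem_trig hd, div_pow_eq_iff]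
      have hp : 0 < 2 ^ n := by positivity
      have e2 : (2 * a + 1 + 1) * 2 ^ n = (2 * a + 1) * 2 ^ n + 2 ^ n := by ring
      omega
    · rintro ⟨h1, h2⟩
      omega
    · rw [flankPt, if_neg (by simp), if_neg (by simp)]
      exact footTop_notMem_gap hd
    · obtain ⟨h1, h2⟩ := h
      have h3 : 2 * m' * d < 2 * (i + 1) * d := by omega
      have h4 := Nat.lt_of_mul_lt_mul_right h3
      have h5 := mono m' (i + 1) (by omega)
      have h6 : (2 * m' + 1) * d = 2 * m' * d + d := by ring
      refine ⟨1, le_rfl, ?_⟩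
      change bottom _ = bottom _
      congr 1
      omega
    · rw [flankPt, if_neg (by simp), if_neg (by simp)] at h
      exact absurd h (footTop_notMem_gap hd)
  · refine ⟨fun n a s hs h1 h2 => ?_, fun n a s hs h1 => ?_, fun s hs => ?_, fun s hs m' h => ?_⟩ <;>
      obtain rfl | rfl : s = 0 ∨ s = 1 := by omega
    · rw [flankPt, if_pos rfl, if_pos rfl, footTop_mem_trig hd, div_pow_eq_iff]
      omega
    · exact ⟨lo' _ h1.le, hi' _ h2⟩
    · rw [flankPt, if_pos rfl, if_pos rfl, footTop_mem_trig hd, div_pow_eq_iff]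
      have hp : 0 < 2 ^ n := by positivity
      have e2 : (2 * a + 1) * 2 ^ n = 2 * a * 2 ^ n + 2 ^ n := by ring
      simp only [add_zero]
      omega
    · have hp : 0 < 2 ^ n := by positivity
      have e2 : (2 * a + 1 + 1) * 2 ^ n = (2 * a + 1) * 2 ^ n + 2 ^ n := by ring
      exact ⟨lo' _ (by omega), hi' _ (by omega)⟩
    · rw [flankPt, if_pos rfl, if_pos rfl]
      exact footTop_notMem_gap hd
    · rintro ⟨h1, h2⟩
      omega
    · rw [flankPt, if_pos rfl, if_pos rfl] at h
      exact absurd h (footTop_notMem_gap hd)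
    · obtain ⟨h1, h2⟩ := h
      have h3 : (2 * (i + 1) + 1) * d < (2 * m' + 1) * d := by omega
      have h4 := Nat.lt_of_mul_lt_mul_right h3
      have h5 := mono (i + 1) m' (by omega)
      have h6 : (2 * m' + 1) * d = 2 * m' * d + d := by ring
      refine ⟨0, by omega, ?_⟩
      change bottom _ = bottom _
      congr 1
      simp only [add_zero]
      omega

/-- The end of the gap `i + 1` at which the dotted path of index `footIdx i r` ends. -/
def footEnd (d i : ℕ) (r : Bool) : Label := gapEnd d (i + 1) (if r then 1 else 0)

theorem footEnd_eq (d i : ℕ) (r : Bool) : footEnd d i r = bottom (footPos (footIdx i r) r * d) := by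
  cases r <;> simp [footEnd, gapEnd, footPos, footIdx]
  left; ring

theorem flankPt_foot (d i : ℕ) (r : Bool) :
    flankPt d i r (if r then 0 else 1) = footTop d (footIdx i r) r := by
  cases r <;> simp [flankPt, footIdx]

theorem adj_footEnd {d : ℕ} (hd : 1 ≤ d) {i : ℕ} {r : Bool} {a : Label}
    (h : (full d).Adj a (footEnd d i r)) :
    a ∈ gap d (i + 1) ∨ a = flankPt d i r 0 ∨ a = flankPt d i r 1 := by
  have e1 : (2 * (i + 1) + 1) * d = 2 * (i + 1) * d + d := by ring
  have hf : footEnd d i r = bottom ((2 * (i + 1) + if r then 1 else 0) * d) := rfl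
  generalize hy : footEnd d i r = y at h
  rcases full_adj_cases h with h | h
  · cases h with
    | tree h j => cases hf.symm.trans hy
    | leg j s t ht => cases hf.symm.trans hy
    | bottom p =>
      have hp := hf.symm.trans hy
      simp only [bottom.injEq] at hp
      cases r
      · right; left
        simp only [Bool.false_eq_true, if_false, add_zero] at hp
        simp only [flankPt, Bool.false_eq_true, if_false, if_true]
        congr 1; omega
      · left
        simp only [if_true] at hp
        exact ⟨by omega, by omega⟩
    | foot j s =>
      have hp := hf.symm.trans hy
      simp only [bottom.injEq] at hp
      have hp := Nat.eq_of_mul_eq_mul_right hd hp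
      right
      cases r <;> cases s <;>
        simp only [footPos, Bool.false_eq_true, if_false, add_zero, if_true] at hp
      · right
        obtain rfl : j = i + 1 := by omega
        rfl
      · omega
      · omega
      · left
        obtain rfl : j = i := by omega
        rfl
  · generalize hx : a = x at h
    cases h with
    | tree h j => cases hf.symm.trans hy
    | leg j s t ht =>
      exact absurd (hy.symm.trans hf) (legPoint_ne_bottom (by omega) _)
    | bottom p =>
      have hp := hf.symm.trans hy
      simp only [bottom.injEq] at hp
      cases r
      · left
        simp only [Bool.false_eq_true, if_false, add_zero] at hp
        exact ⟨by omega, by omega⟩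
      · right; right
        simp only [if_true] at hp
        simp only [flankPt, if_true]
        rw [hp]
        rfl
    | foot j s => exact absurd (hy.symm.trans hf) (footTop_ne_bottom hd _ _ _)

theorem adj_footTop {d i : ℕ} {r : Bool} (hd : 1 ≤ d) :
    (full d).Adj (footTop d i r) (bottom (footPos i r * d)) :=
  (full_adj hd).2 (Or.inl (NLink.foot i r))

theorem adj_flankPt {d : ℕ} (hd : 1 ≤ d) (i : ℕ) (r : Bool) {s : ℕ} (hs : s ≤ 1) :
    (full d).Adj (footEnd d i r) (flankPt d i r s) := by
  have pos : 0 < 2 * (i + 1) * d := by positivity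
  cases r <;> (obtain rfl | rfl : s = 0 ∨ s = 1 := by omega)
  · refine (full_adj hd).2 (Or.inr ?_)
    have := NLink.bottom (d := d) (2 * (i + 1) * d - 1)
    rw [Nat.sub_add_cancel pos] at this
    exact this
  · have := (adj_footTop (i := i + 1) (r := false) hd).symm
    exact this
  · have := (adj_footTop (i := i) (r := true) hd).symm
    exact this
  · exact (full_adj hd).2 (Or.inl (NLink.bottom _))

/-- The set `A` avoids one end of a gap and contains a closed walk that uses the foot edge at the
other end an odd number of times; then the two neighbours of that end are joined without it. -/
theorem reach_of_odd {d : ℕ} (hd : 1 ≤ d) {i : ℕ} {r : Bool} {A : Set Label} {u : Label}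
    (p : (full d).Walk u u) (hp : ∀ a ∈ p.support, a ∈ A) (hA : footEnd d i (!r) ∉ A)
    (h : coef d (footIdx i r) r p ≠ 0) :
    Reach d (broken d (i + 1) A) (flankPt d i r 0) (flankPt d i r 1) := by
  classical
  set t := footTop d (footIdx i r) r with ht
  have htA : t ∈ A := by
    by_contra hn
    refine h (walkSum_eq_zero _ fun x hx y hy _ => footEdge_eq_zero_of_footTop ?_ ?_)
    · rintro rfl; exact hn (hp _ hx)
    · rintro rfl; exact hn (hp _ hy)
  have ends : ∀ b ≤ 1, gapEnd d (i + 1) b = footEnd d i r ∨ gapEnd d (i + 1) b = footEnd d i (!r) := by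
    intro b hb
    obtain rfl | rfl : b = 0 ∨ b = 1 := by omega
    all_goals cases r <;> simp [footEnd]
  have hfe : ∃ b ≤ 1, footEnd d i r = gapEnd d (i + 1) b := by
    cases r
    · exact ⟨0, by omega, rfl⟩
    · exact ⟨1, by omega, rfl⟩
  have htb : t ∈ broken d (i + 1) A := ⟨htA, fun b _ => footTop_ne_bottom hd _ _ _⟩
  have brk : ∀ a ∈ A, a ∉ broken d (i + 1) A → a = footEnd d i r := by
    intro a ha hn
    by_contra hne
    refine hn ⟨ha, fun b hb hab => ?_⟩
    rcases ends b hb with h | h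
    · exact hne (hab.trans h)
    · exact hA (by rw [← h, ← hab]; exact ha)
  set K := {a | Reach d (broken d (i + 1) A) t a} with hK
  have Kgap : ∀ a ∈ K, a ∉ gap d (i + 1) := by
    intro a ha
    refine Reach.closed (K := {a | a ∉ gap d (i + 1)}) ha ?_ (footTop_notMem_gap hd)
    intro a ha haA b hb hab hbg
    cases b with
    | tree h j => exact hbg
    | leg j s t => exact hbg
    | bottom q =>
      have e1 : (2 * (i + 1) + 1) * d = 2 * (i + 1) * d + d := by ring
      have n0 : q ≠ 2 * (i + 1) * d := by
        rintro rfl; exact hb.2 0 (by omega) rfl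
      have n1 : q ≠ (2 * (i + 1) + 1) * d := by
        rintro rfl; exact hb.2 1 (by omega) rfl
      obtain ⟨g1, g2⟩ := hbg
      generalize hy : bottom q = y at hab
      rcases full_adj_cases hab with h | h
      · cases h with
        | tree h j => cases hy
        | leg j r t ht => cases hy
        | bottom q' => 
          simp only [bottom.injEq] at hy
          exact ha ⟨by omega, by omega⟩
        | foot j s =>
          simp only [bottom.injEq] at hy
          subst hy
          have g1 := Nat.le_of_mul_le_mul_right g1 hd
          have g2 := Nat.le_of_mul_le_mul_right g2 hd
          have n0 : footPos j s ≠ 2 * (i + 1) := fun h => n0 (by rw [h])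
          have n1 : footPos j s ≠ 2 * (i + 1) + 1 := fun h => n1 (by rw [h])
          omega
      · generalize hx : a = x at h
        cases h with
        | tree h j => cases hy
        | leg j r t ht =>
          exact absurd hy.symm (legPoint_ne_bottom (by omega) _)
        | bottom q' =>
          simp only [bottom.injEq] at hy
          subst hx
          exact ha ⟨by omega, by omega⟩
        | foot j s => exact footTop_ne_bottom hd _ _ _ hy.symm
  -- Otherwise the foot edge is the only edge within `A` that leaves the component `K` of its top,
  -- so its indicator is a potential difference and sums to zero along a closed walk.
  have goal : flankPt d i r (if r then 1 else 0) ∈ K := by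
    by_contra hn
    apply h
    have hfn : footEnd d i r ∉ K := by
      intro hh
      obtain ⟨b, hb, e⟩ := hfe
      exact (Reach.right_mem hh).2 b hb e
    have key : ∀ a b, a ∈ A → b ∈ A → (full d).Adj a b → a ∈ K → b ∉ K →
        footEdge d (footIdx i r) r a b = 1 := by
      intro a b ha hb hab haK hbK
      have hb0 : b = footEnd d i r := by
        refine brk b hb fun hbb => hbK ?_
        exact Reach.tail haK hab hbb
      subst hb0
      have h2 : a = t := by
        rcases adj_footEnd hd hab with h1 | h1
        · exact absurd h1 (Kgap a haK)
        · have : a = flankPt d i r (if r then 1 else 0) ∨ a = flankPt d i r (if r then 0 else 1) := by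
            cases r <;> simp <;> tauto
          rcases this with h | h
          · exact absurd (h ▸ haK) hn
          · rw [h, flankPt_foot]
      unfold footEdge
      rw [if_pos (Or.inl ⟨h2, footEnd_eq _ _ _⟩)]
    have same : ∀ a b, (a ∈ K ↔ b ∈ K) → footEdge d (footIdx i r) r a b = 0 := by
      intro a b hab
      apply footEdge_eq_zero_of_not
      rw [← footEnd_eq]
      rintro (⟨rfl, rfl⟩ | ⟨rfl, rfl⟩)
      · exact hfn (hab.1 (Reach.refl htb))
      · exact hfn (hab.2 (Reach.refl htb))
    unfold coef
    rw [walkSum_congr (ψ := fun a b => (if a ∈ K then 1 else 0) + (if b ∈ K then 1 else 0)),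
      walkSum_boundary, zmod_self_add]
    intro a ha b hb hab
    by_cases h1 : a ∈ K <;> by_cases h2 : b ∈ K
    · rw [same a b (by tauto)]; simp [h1, h2, zmod_self_add]
    · rw [key a b (hp _ ha) (hp _ hb) hab h1 h2]; simp [h1, h2]
    · rw [footEdge_comm, key b a (hp _ hb) (hp _ ha) hab.symm h2 h1]; simp [h1, h2]
    · rw [same a b (by tauto)]; simp [h1, h2]
  have h0 : Reach d (broken d (i + 1) A) (flankPt d i r (if r then 0 else 1))
      (flankPt d i r (if r then 1 else 0)) := by
    rw [flankPt_foot]; exact goal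
  cases r
  · exact h0.symm
  · exact h0

theorem footEnd_mem_of_coef {d : ℕ} {i : ℕ} {r : Bool} {u v : Label}
    (p : (full d).Walk u v) (h : coef d (footIdx i r) r p ≠ 0) :
    footTop d (footIdx i r) r ∈ p.support ∧ footEnd d i r ∈ p.support := by
  by_contra hn
  refine h (walkSum_eq_zero _ fun x hx y hy _ => footEdge_eq_zero_of_not ?_)
  rw [← footEnd_eq]
  rintro (⟨rfl, rfl⟩ | ⟨rfl, rfl⟩)
  · exact hn ⟨hx, hy⟩
  · exact hn ⟨hy, hx⟩

/-- Two closed walks in apart sets cannot both be odd on the two foot edges of a gap. -/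
theorem coef_mul_coef_eq_zero {d : ℕ} (hd : 1 ≤ d) {n : ℕ} {A B : Set Label} (hAB : Apart A B)
    (hA : A ⊆ trig d n 0) (hB : B ⊆ trig d n 0) {u v : Label} (p : (full d).Walk u u)
    (q : (full d).Walk v v) (hp : ∀ a ∈ p.support, a ∈ A) (hq : ∀ a ∈ q.support, a ∈ B)
    (i : ℕ) (r : Bool) : coef d (footIdx i r) r p * coef d (footIdx i (!r)) (!r) q = 0 := by
  by_contra h
  have h1 : coef d (footIdx i r) r p ≠ 0 := left_ne_zero_of_mul h
  have h2 : coef d (footIdx i (!r)) (!r) q ≠ 0 := right_ne_zero_of_mul h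
  obtain ⟨tp, ep⟩ := footEnd_mem_of_coef p h1
  obtain ⟨tq, eq⟩ := footEnd_mem_of_coef q h2
  have rp := reach_of_odd hd p hp (fun h => hAB.disj _ h (hq _ eq)) h1
  have rq := reach_of_odd hd q hq (by
    rw [Bool.not_not]; exact fun h => hAB.disj _ (hp _ ep) h) h2
  -- The two foot tops belong to the trigons `i` and `i + 1` of height one, both inside the large
  -- trigon, so the gap is not an outer one.
  have hn : i + 1 < 2 ^ n := by
    have := hA (hp _ tp)
    have := hB (hq _ tq)
    rw [footTop_mem_trig hd, div_pow_eq_iff] at *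
    cases r <;> simp only [footIdx, Bool.not_true, Bool.not_false, if_true, Bool.false_eq_true,
      if_false] at * <;> omega
  have bA : broken d (i + 1) A ⊆ broken d (i + 1) A ∩ trig d n 0 := fun a ha => ⟨ha, hA ha.1⟩
  have bB : broken d (i + 1) B ⊆ broken d (i + 1) B ∩ trig d n 0 := fun a ha => ⟨ha, hB ha.1⟩
  refine not_joined hd n 0 (i + 1) (by omega) (by omega) A B (flankPt d i r) (flankPt d i !r)
    (if r then 1 else 0) (by split_ifs <;> omega) hAB (hp _ ep) ?_ (flank_flankPt hd _ _)
    (flank_flankPt hd _ _) (fun s hs => adj_flankPt hd i r hs) ?_ (rp.mono bA)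
    (Or.inl (rq.mono bB))
  · have := hq _ eq
    cases r <;> exact this
  · intro s hs
    have := adj_flankPt hd i (!r) hs
    cases r <;> exact this

/-! ### Odd edges of a closed walk lie outside an apart closed walk -/

/-- Indicator of the edge `ab`. -/
noncomputable def edgeInd {V : Type*} (a b u v : V) : ZMod 2 :=
  open Classical in if (u = a ∧ v = b) ∨ (v = a ∧ u = b) then 1 else 0

theorem edgeInd_comm {V : Type*} (a b u v : V) : edgeInd a b u v = edgeInd a b v u := by
  unfold edgeInd
  congr 1
  exact propext or_comm

theorem footEdge_eq_edgeInd (d i : ℕ) (r : Bool) :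
    footEdge d i r = edgeInd (footTop d i r) (bottom (footPos i r * d)) := rfl

theorem edgeInd_swap {V : Type*} (a b u v : V) : edgeInd a b u v = edgeInd b a u v := by
  unfold edgeInd
  congr 1
  apply propext
  tauto

/-- In a closed walk every vertex is in an even number of odd edges. -/
theorem sum_edgeInd {V : Type*} [DecidableEq V] {G : SimpleGraph V} {w : V} (q : G.Walk w w) (y : V) :
    ∑ z ∈ q.support.toFinset, walkSum (edgeInd y z) q = 0 := by
  rw [← walkSum_finset_sum, walkSum_congr (ψ := fun u v => (if u = y then 1 else 0) +
    (if v = y then 1 else 0)), walkSum_boundary, zmod_self_add]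
  intro u hu v hv huv
  have hne := huv.ne
  unfold edgeInd
  by_cases h1 : u = y
  · subst h1
    rw [Finset.sum_eq_single v]
    · simp [hne.symm]
    · intro z _ hz
      rw [if_neg]
      rintro (⟨-, rfl⟩ | ⟨rfl, -⟩)
      · exact hz rfl
      · exact hne rfl
    · intro h
      exact absurd (List.mem_toFinset.2 hv) h
  · by_cases h2 : v = y
    · subst h2
      rw [Finset.sum_eq_single u]
      · simp [hne]
      · intro z _ hz
        rw [if_neg]
        rintro (⟨rfl, -⟩ | ⟨-, rfl⟩)
        · exact h1 rfl
        · exact hz rfl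
      · intro h
        exact absurd (List.mem_toFinset.2 hu) h
    · simp [h1, h2]

theorem mem_of_edgeInd {V : Type*} {G : SimpleGraph V} {u w y z : V} {q : G.Walk u w}
    (h : walkSum (edgeInd y z) q ≠ 0) : G.Adj y z ∧ y ∈ q.support ∧ z ∈ q.support := by
  by_contra hn
  refine h (walkSum_eq_zero _ fun a ha b hb hab => if_neg ?_)
  rintro (⟨rfl, rfl⟩ | ⟨rfl, rfl⟩)
  · exact hn ⟨hab, ha, hb⟩
  · exact hn ⟨hab.symm, hb, ha⟩

/-- The height of a vertex above the bottom path. -/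
def level (d : ℕ) : Label → ℕ
  | tree h _ => d + h
  | bottom _ => 0
  | leg _ _ t => d - t

theorem level_legPoint {d i t : ℕ} {r : Bool} (ht : t < d) : d - t ≤ level d (legPoint d i r t) := by
  unfold legPoint; split_ifs <;> simp only [level] <;> omega

/-- Tree and dotted paths hang down to the bottom path: off that path every vertex has only one way
up. This lets `mu_eq_zero_of_odd` descend along odd edges. -/
theorem up_unique {d : ℕ} (hd : 1 ≤ d) {y : Label} (hy : ∀ p, y ≠ bottom p) : ∃ z0, ∀ z,
    (full d).Adj y z → z = z0 ∨ level d z < level d y := by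
  cases y with
  | bottom p => exact absurd rfl (hy p)
  | tree h i =>
    refine ⟨tree (h + 1) (i / 2), fun z hz => ?_⟩
    rcases full_adj_cases hz with hz | hz
    · generalize hx : tree h i = x at hz
      cases hz with
      | tree h j => cases hx; exact Or.inl rfl
      | bottom q => cases hx
      | leg j r t ht =>
        right
        exact lt_of_lt_of_le (by simp only [level]; omega) (level_legPoint (by omega))
      | foot j r =>
        right
        exact lt_of_lt_of_le (by simp only [level]; omega) (level_legPoint (by omega))
    · generalize hx : tree h i = x at hz
      cases hz with
      | tree h j => right; cases hx; simp [level]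
      | bottom q => cases hx
      | leg j r t ht => cases hx
      | foot j r => cases hx
  | leg i r t =>
    refine ⟨legPoint d i r (t - 1), fun z hz => ?_⟩
    rcases full_adj_cases hz with hz | hz
    · generalize hx : leg i r t = x at hz
      cases hz with
      | tree h j => cases hx
      | bottom q => cases hx
      | leg j r t ht =>
        right
        exact lt_of_lt_of_le (by simp only [level]; omega) (level_legPoint (by omega))
      | foot j r =>
        right
        exact lt_of_lt_of_le (by simp only [level]; omega) (level_legPoint (by omega))
    · generalize hx : leg i r t = x at hz
      cases hz with
      | tree h j => cases hx
      | bottom q => cases hx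
      | leg j r t ht => cases hx; exact Or.inl rfl
      | foot j r => cases hx

/-- Walks living in two apart sets of a finite trigon. -/
structure Sep (d n : ℕ) (A B : Set Label) : Prop where
  apart : Apart A B
  left : A ⊆ trig d n 0
  right : B ⊆ trig d n 0

theorem Sep.symm {d n : ℕ} {A B : Set Label} (h : Sep d n A B) : Sep d n B A :=
  ⟨h.apart.symm, h.right, h.left⟩

theorem footBound_of_subset {d n : ℕ} (hd : 1 ≤ d) {A : Set Label} (h : A ⊆ trig d n 0) (i : ℕ)
    (r : Bool) (hi : 2 ^ n ≤ i) : footTop d i r ∉ A := by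
  intro h'
  have := h h'
  rw [footTop_mem_trig hd, div_pow_eq_iff] at this
  omega

/-- The crossing formula for a closed walk and a walk. -/
theorem cross_closed {d n : ℕ} (hd : 1 ≤ d) {A B : Set Label} (hS : Sep d n A B) {u x y : Label}
    (p : (full d).Walk u u) (q : (full d).Walk x y) (hp : ∀ a ∈ p.support, a ∈ A)
    (hq : ∀ a ∈ q.support, a ∈ B) : cross d (2 ^ n) p q = mu d p x + mu d p y := by
  rw [cross_eq hd p q (fun a h h' => hS.apart.disj _ (hp _ h) (hq _ h'))
    (fun i r hi h => footBound_of_subset hd hS.left i r hi (hp _ h))]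
  linear_combination zmod_self_add (mu d q u) + zmod_self_add (leftOf d u x) +
    zmod_self_add (leftOf d u y)

/-- A closed walk has a constant position relative to the odd edges of an apart closed walk. -/
theorem mu_eq_of_odd {d n : ℕ} (hd : 1 ≤ d) {A B : Set Label} (hS : Sep d n A B) {u v y z : Label}
    (p : (full d).Walk u u) (q : (full d).Walk v v) (hp : ∀ a ∈ p.support, a ∈ A)
    (hq : ∀ a ∈ q.support, a ∈ B) (h : walkSum (edgeInd y z) q ≠ 0) : mu d p y = mu d p z := by
  obtain ⟨hyz, hy, hz⟩ := mem_of_edgeInd h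
  have h1 := cross_closed hd hS p (Walk.cons hyz Walk.nil) hp (by
    intro a ha
    simp at ha
    rcases ha with rfl | rfl
    · exact hq _ hy
    · exact hq _ hz)
  -- If `yz` is a foot edge, then `q` is odd on it, so `p` is even on the foot edge that it crosses.
  -- Hence `p` crosses `yz` evenly and encloses both of its ends or neither.
  have key : ∀ i r, footEdge d (footIdx i r) r y z ≠ 0 → coef d (footIdx i (!r)) (!r) p = 0 := by
    intro i r h2
    have h3 : walkSum (edgeInd y z) q = coef d (footIdx i r) r q := by
      unfold coef
      by_contra hn
      have h4 : ¬ _ := fun h4 => h2 (footEdge_eq_zero_of_not h4)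
      rw [not_not] at h4
      rcases h4 with ⟨rfl, rfl⟩ | ⟨rfl, rfl⟩
      · exact hn rfl
      · apply hn
        rw [footEdge_eq_edgeInd]
        exact walkSum_congr _ fun a _ b _ _ => edgeInd_swap _ _ _ _
    have h5 := coef_mul_coef_eq_zero hd hS.symm.apart hS.right hS.left q p hq hp i r
    exact (mul_eq_zero.1 h5).resolve_left (h3 ▸ h)
  have h2 : cross d (2 ^ n) p (Walk.cons hyz Walk.nil) = 0 := by
    refine Finset.sum_eq_zero fun i _ => ?_
    have k1 := key i true
    have k2 := key i false
    simp only [footIdx, if_true, Bool.not_true, Bool.not_false, Bool.false_eq_true, if_false] at k1 k2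
    have e : ∀ j r, coef d j r (Walk.cons hyz Walk.nil) = footEdge d j r y z := by
      intro j r; unfold coef; simp
    rw [e, e]
    by_cases a : footEdge d i true y z = 0 <;> by_cases b : footEdge d (i + 1) false y z = 0 <;>
      simp_all
  rw [h2] at h1
  exact (CharTwo.add_eq_zero.1 h1.symm)

/-- The vertices of the odd edges of a closed walk are outside every apart closed walk. -/
theorem mu_eq_zero_of_odd {d n : ℕ} (hd : 1 ≤ d) {A B : Set Label} (hS : Sep d n A B) {u v : Label}
    (p : (full d).Walk u u) (q : (full d).Walk v v) (hp : ∀ a ∈ p.support, a ∈ A)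
    (hq : ∀ a ∈ q.support, a ∈ B) {y z : Label} (h : walkSum (edgeInd y z) q ≠ 0) :
    mu d p y = 0 := by
  classical
  generalize hl : level d y = l
  induction l using Nat.strong_induction_on generalizing y z with
  | _ l ih =>
    subst hl
    by_cases hb : ∃ b, y = bottom b
    · obtain ⟨b, rfl⟩ := hb
      exact mu_bottom _ _ _
    push Not at hb
    obtain ⟨z0, hz0⟩ := up_unique hd hb
    -- An odd edge going down carries the value of `mu` to a lower vertex. Such an edge exists: the
    -- number of odd edges at `y` is even and positive, and at most one of them goes up.
    by_cases hlow : ∃ z, walkSum (edgeInd y z) q ≠ 0 ∧ level d z < level d y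
    · obtain ⟨z, h1, h2⟩ := hlow
      rw [mu_eq_of_odd hd hS p q hp hq h1]
      refine ih _ h2 (y := z) (z := y) ?_ rfl
      rwa [walkSum_congr _ fun a _ b _ _ => edgeInd_swap z y a b]
    · push Not at hlow
      have only : ∀ z, z ≠ z0 → walkSum (edgeInd y z) q = 0 := by
        intro z hz
        by_contra hn
        rcases hz0 z (mem_of_edgeInd hn).1 with h1 | h1
        · exact hz h1
        · exact absurd h1 (not_lt.2 (hlow z hn))
      have hs := sum_edgeInd q y
      rw [Finset.sum_eq_single z (fun z' _ hz' => ?_) (fun hz => ?_)] at hs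
      · exact absurd hs h
      · have : z = z0 := by by_contra hn; exact h (only z hn)
        exact only z' (this ▸ hz')
      · exact absurd (List.mem_toFinset.2 (mem_of_edgeInd h).2.2) hz

/-! ### A parity identity for the octahedron -/

/-- The vertices of the octahedron; adjacent vertices differ in the first coordinate. -/
abbrev Vx := Fin 3 × Bool

/-- The antipode. -/
def Vx.bar (v : Vx) : Vx := (v.1, !v.2)

section Formula

variable {R : Type*} [Add R] [Mul R]

/-- At the left foot edge of a gap, `l v w` is the bit of the leg from the centre of `v` to the
branch path `vw`, and `E v w` that of the branch path; `l'` and `E'` belong to the right foot edge.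
This is the parity of the walk between two centres, and `wCoef` is that of a closed triangle. -/
def eCoef (l E : Vx → Vx → R) (v w : Vx) : R := l v w + l w v + E v w

def wCoef (l E : Vx → Vx → R) (v w x : Vx) : R := eCoef l E v w + eCoef l E w x + eCoef l E x v

/-- The crossings at one gap of two walks between centres; `wlTerm` is the same for a triangle and a
leg. -/
def eeTerm (l E l' E' : Vx → Vx → R) (v w x y : Vx) : R :=
  eCoef l' E' v w * eCoef l E x y + eCoef l E v w * eCoef l' E' x y

def wlTerm (l E l' E' : Vx → Vx → R) (v w x y z : Vx) : R :=
  l y z * wCoef l' E' v w x + l' y z * wCoef l E v w x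

/-- The left side of `axis_identity` at one gap, where each value of a triangle at a centre is
replaced by its crossings with a leg from that centre. -/
def axisTerm (l E l' E' : Vx → Vx → R) (a A y Y z Z : Vx) : R :=
  (wlTerm l E l' E' a y z Z A + wlTerm l E l' E' A Y Z y z + eeTerm l E l' E' a y A Z) +
  (wlTerm l E l' E' a z Y y Z + wlTerm l E l' E' A Z y z a + eeTerm l E l' E' a z A y) +
  (wlTerm l E l' E' a Y Z z A + wlTerm l E l' E' A y z Y Z + eeTerm l E l' E' a Y A z) +
  (wlTerm l E l' E' a Z y Y z + wlTerm l E l' E' A z Y Z a + eeTerm l E l' E' a Z A Y) +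
  (eeTerm l E l' E' y z Y Z + eeTerm l E l' E' z Y Z y) +
  (eeTerm l E l' E' a y A Y + eeTerm l E l' E' a z A Z + eeTerm l E l' E' a Y A y +
    eeTerm l E l' E' a Z A z)

def axisForm (l E l' E' : Vx → Vx → R) : R :=
  axisTerm l E l' E' (0, false) (0, true) (1, false) (1, true) (2, false) (2, true)

/-- The two patterns of foot edge bits at antipodal vertices are complementary. -/
def complTerm (inv : R → R) (l l' : Vx → Vx → R) (v w Y z Z : Vx) : R :=
  (l v Y * l' w Y) * ((l v z * inv (l v Z)) * (inv (l' w z) * l' w Z) +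
    (inv (l v z) * l v Z) * (l' w z * inv (l' w Z)))

def complForm (inv : R → R) (l l' : Vx → Vx → R) (i : Fin 3) : R :=
  complTerm inv l l' (i, false) (i, true) (i + 1, true) (i + 2, false) (i + 2, true) +
    complTerm inv l' l (i, false) (i, true) (i + 1, true) (i + 2, false) (i + 2, true)

end Formula

/-! ### The finite check at a single gap -/

section Bits

@[reducible] def boolAdd : Add Bool := ⟨xor⟩
@[reducible] def boolMul : Mul Bool := ⟨and⟩

def toZ (b : Bool) : ZMod 2 := if b then 1 else 0

/-- Foot edge in a branch set: it lies on some of the legs at `v`. -/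
def legState (v : Vx) (b1 b2 b3 : Bool) (x w : Vx) : Bool :=
  x == v && (if w.1 == x.1 + 1 then w.2 && b1 else w.1 == x.1 + 2 && (if w.2 then b3 else b2))

/-- Foot edge in a branch path. -/
def pathState (v w x y : Vx) : Bool := (x == v && y == w) || (x == w && y == v)

def allVx : List Vx := [(0, false), (0, true), (1, false), (1, true), (2, false), (2, true)]

/-- A foot edge lies in no part, in one branch set or in one branch path. Three bits suffice in a
branch set, because the leg to the reference neighbour is trivial. Each branch path is listed once,
oriented by the cyclic order of the axes. -/
def allStates : List ((Vx → Vx → Bool) × (Vx → Vx → Bool)) :=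
  (fun _ _ => false, fun _ _ => false) ::
  (allVx.flatMap fun v => [false, true].flatMap fun b1 => [false, true].flatMap fun b2 =>
    [false, true].map fun b3 => (legState v b1 b2 b3, fun _ _ => false)) ++
  (allVx.flatMap fun v => (allVx.filter fun w => w.1 == v.1 + 1).map fun w =>
    (fun _ _ => false, pathState v w))

/-- The closed walks of opposite triangles are not odd on both foot edges. -/
def compatible (p q : (Vx → Vx → Bool) × (Vx → Vx → Bool)) : Bool :=
  [false, true].all fun b0 => [false, true].all fun b1 => [false, true].all fun b2 =>
    !(@wCoef Bool boolAdd p.1 p.2 (0, b0) (1, b1) (2, b2) &&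
      @wCoef Bool boolAdd q.1 q.2 (0, !b0) (1, !b1) (2, !b2))

/-- For each pair of states that `coef_mul_coef_eq_zero` allows for the two foot edges of a gap, the
crossing form equals the number of complementary patterns over the three axes. -/
def parityCheck : Bool :=
  allStates.all fun p => allStates.all fun q => !(compatible p q) ||
    (@axisForm Bool boolAdd boolMul p.1 p.2 q.1 q.2 ==
      xor (xor (@complForm Bool boolAdd boolMul not p.1 q.1 0)
      (@complForm Bool boolAdd boolMul not p.1 q.1 1))
        (@complForm Bool boolAdd boolMul not p.1 q.1 2))

set_option maxRecDepth 100000 in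
theorem parityCheck_eq : parityCheck = true := by decide +kernel

end Bits

/-- Each of the eight triangles is tested at one vertex of the opposite triangle; in a plane drawing
only the outer triangle encloses that vertex. The ten crossing pairs are the correction for other
drawings: once they are expanded by the drawing formula, all values of `m` cancel and the order
terms leave `1`. -/
theorem axis_identity (m : Vx → Vx → Vx → ZMod 2) (hm : ∀ x y v, m x y v = m y x v)
    (L : Vx → Vx → ZMod 2) (cr : Vx → Vx → Vx → Vx → ZMod 2) {a A y Y z Z : Vx}
    (hL : ∀ p ∈ [(A, y), (A, Y), (A, z), (A, Z), (y, Y), (y, z), (Y, z), (Y, Z), (z, Z)], L p.2 p.1 = L p.1 p.2 + 1)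
    (hcr : ∀ p ∈ [(a, y, A, Z), (a, z, A, y), (a, Y, A, z), (a, Z, A, Y), (y, z, Y, Z),
      (z, Y, Z, y), (a, y, A, Y), (a, z, A, Z), (a, Y, A, y), (a, Z, A, z)],
      cr p.1 p.2.1 p.2.2.1 p.2.2.2 = m p.1 p.2.1 p.2.2.1 + m p.1 p.2.1 p.2.2.2 +
        (m p.2.2.1 p.2.2.2 p.1 + m p.2.2.1 p.2.2.2 p.2.1) +
        (L p.1 p.2.2.1 + L p.1 p.2.2.2 + L p.2.1 p.2.2.1 + L p.2.1 p.2.2.2)) :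
    (((m a y Z + m y z Z + m z a Z) + (m A Y y + m Y Z y + m Z A y) + cr a y A Z) +
     ((m a z y + m z Y y + m Y a y) + (m A Z z + m Z y z + m y A z) + cr a z A y) +
     ((m a Y z + m Y Z z + m Z a z) + (m A y Y + m y z Y + m z A Y) + cr a Y A z) +
     ((m a Z Y + m Z y Y + m y a Y) + (m A z Z + m z Y Z + m Y A Z) + cr a Z A Y) +
     (cr y z Y Z + cr z Y Z y) + (cr a y A Y + cr a z A Z + cr a Y A y + cr a Z A z)) = 1 := by
  simp only [List.forall_mem_cons, List.not_mem_nil, false_implies, implies_true, and_true] at hL hcr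
  obtain ⟨e1, e2, e3, e4, e5, e6, e7, e8, e9⟩ := hL
  obtain ⟨c1, c2, c3, c4, c5, c6, c7, c8, c9, c10⟩ := hcr
  rw [c1, c2, c3, c4, c5, c6, c7, c8, c9, c10, hm z a, hm Z A, hm Y a, hm y A, hm Z a, hm z A,
    hm y a, hm Y A, hm Z y, hm z Y]
  simp only [e1, e2, e3, e4, e5, e6, e7, e8, e9]
  ring_nf
  reduce_mod_char

theorem toZ_xor (a b : Bool) : toZ (xor a b) = toZ a + toZ b := by
  revert a b; decide

theorem toZ_and (a b : Bool) : toZ (a && b) = toZ a * toZ b := by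
  revert a b; decide

theorem toZ_not (a : Bool) : toZ (!a) = 1 + toZ a := by
  revert a; decide

theorem toZ_eq_zero {a : Bool} : toZ a = 0 ↔ a = false := by
  revert a; decide

theorem exists_toZ (x : ZMod 2) : ∃ b, toZ b = x := by
  revert x; decide

theorem toZ_boolAdd (a b : Bool) :
    toZ (@HAdd.hAdd Bool Bool Bool (@instHAdd Bool boolAdd) a b) = toZ a + toZ b := toZ_xor a b

theorem toZ_boolMul (a b : Bool) :
    toZ (@HMul.hMul Bool Bool Bool (@instHMul Bool boolMul) a b) = toZ a * toZ b := toZ_and a b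

theorem wCoef_toZ (l E : Vx → Vx → Bool) (v w x : Vx) :
    wCoef (fun v w => toZ (l v w)) (fun v w => toZ (E v w)) v w x =
      toZ (@wCoef Bool boolAdd l E v w x) := by
  simp only [wCoef, eCoef, toZ_boolAdd]

theorem axisForm_toZ (l E l' E' : Vx → Vx → Bool) :
    axisForm (fun v w => toZ (l v w)) (fun v w => toZ (E v w)) (fun v w => toZ (l' v w))
      (fun v w => toZ (E' v w)) = toZ (@axisForm Bool boolAdd boolMul l E l' E') := by
  simp only [axisForm, axisTerm, wlTerm, eeTerm, wCoef, eCoef, toZ_boolAdd, toZ_boolMul]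

theorem complForm_toZ (l l' : Vx → Vx → Bool) (i : Fin 3) :
    complForm (fun x => 1 + x) (fun v w => toZ (l v w)) (fun v w => toZ (l' v w)) i =
      toZ (@complForm Bool boolAdd boolMul not l l' i) := by
  simp only [complForm, complTerm, toZ_boolAdd, toZ_boolMul, toZ_not]

theorem complForm_sum {p q : (Vx → Vx → Bool) × (Vx → Vx → Bool)} (hp : p ∈ allStates)
    (hq : q ∈ allStates) {l E l' E' : Vx → Vx → ZMod 2}
    (hl : ∀ v w, l v w = toZ (p.1 v w)) (hE : ∀ v w, E v w = toZ (p.2 v w))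
    (hl' : ∀ v w, l' v w = toZ (q.1 v w)) (hE' : ∀ v w, E' v w = toZ (q.2 v w))
    (hc : ∀ b0 b1 b2, wCoef l E (0, b0) (1, b1) (2, b2) *
      wCoef l' E' (0, !b0) (1, !b1) (2, !b2) = 0) :
    axisForm l E l' E' = ∑ i, complForm (fun x => 1 + x) l l' i := by
  obtain rfl : l = fun v w => toZ (p.1 v w) := funext₂ hl
  obtain rfl : E = fun v w => toZ (p.2 v w) := funext₂ hE
  obtain rfl : l' = fun v w => toZ (q.1 v w) := funext₂ hl'
  obtain rfl : E' = fun v w => toZ (q.2 v w) := funext₂ hE'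
  have key := parityCheck_eq
  unfold parityCheck at key
  have key := List.all_eq_true.1 (List.all_eq_true.1 key p hp) q hq
  have hcomp : compatible p q = true := by
    unfold compatible
    simp only [List.all_eq_true]
    intro b0 _ b1 _ b2 _
    have := hc b0 b1 b2
    rw [wCoef_toZ, wCoef_toZ, ← toZ_and, toZ_eq_zero] at this
    rw [this]; rfl
  rw [hcomp] at key
  simp only [Bool.not_true, Bool.false_or] at key
  rw [axisForm_toZ, eq_of_beq key, toZ_xor, toZ_xor, Fin.sum_univ_three]
  simp only [complForm_toZ]

/-- Bits of a foot edge that lies in one branch set, or in one branch path. -/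
theorem exists_state {l E : Vx → Vx → ZMod 2} (h0 : ∀ v w, v.1 = w.1 → l v w = 0)
    (href : ∀ v, l v (v.1 + 1, false) = 0)
    (hE : ∀ v w, E v w = E w v)
    (h : (∃ v, (∀ x w, x ≠ v → l x w = 0) ∧ ∀ x y, E x y = 0) ∨
      (∃ v w, v.1 ≠ w.1 ∧ (∀ x y, l x y = 0) ∧
        ∀ x y, ¬ ((x = v ∧ y = w) ∨ (x = w ∧ y = v)) → E x y = 0)) :
    ∃ p ∈ allStates, (∀ v w, l v w = toZ (p.1 v w)) ∧ ∀ v w, E v w = toZ (p.2 v w) := by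
  have mem : ∀ v : Vx, v ∈ allVx := by decide
  rcases h with ⟨v, h1, h2⟩ | ⟨v, w, hvw, h1, h2⟩
  · obtain ⟨b1, e1⟩ := exists_toZ (l v (v.1 + 1, true))
    obtain ⟨b2, e2⟩ := exists_toZ (l v (v.1 + 2, false))
    obtain ⟨b3, e3⟩ := exists_toZ (l v (v.1 + 2, true))
    refine ⟨(legState v b1 b2 b3, fun _ _ => false), ?_, ?_, fun x y => (h2 x y).trans rfl⟩
    · unfold allStates
      refine List.mem_append_left _ (List.mem_cons_of_mem _ (List.mem_flatMap.2 ⟨v, mem v,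
        List.mem_flatMap.2 ⟨b1, by cases b1 <;> simp, List.mem_flatMap.2 ⟨b2, by cases b2 <;> simp,
          List.mem_map.2 ⟨b3, by cases b3 <;> simp, rfl⟩⟩⟩⟩))
    · intro x w
      by_cases hx : x = v
      · subst hx
        obtain ⟨j, b⟩ := w
        have hj : j = x.1 ∨ j = x.1 + 1 ∨ j = x.1 + 2 := by
          generalize x.1 = i; revert i j; decide
        have n1 : ∀ i : Fin 3, i ≠ i + 1 ∧ i ≠ i + 2 ∧ i + 2 ≠ i + 1 := by decide
        obtain ⟨n1, n2, n3⟩ := n1 x.1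
        rcases hj with rfl | rfl | rfl
        · rw [h0 x (x.1, b) rfl]; simp [legState, n1, n2, toZ]
        · cases b
          · rw [href]; simp [legState, toZ]
          · rw [← e1]; simp [legState]
        · cases b
          · rw [← e2]; simp [legState, n3]
          · rw [← e3]; simp [legState, n3]
      · rw [h1 x w hx]; simp [legState, hx, toZ]
  · wlog hor : w.1 = v.1 + 1 generalizing v w
    · refine this w v (Ne.symm hvw) (fun x y hxy => h2 x y (by tauto)) ?_
      generalize v.1 = i at *; generalize w.1 = j at *
      revert i j; decide
    obtain ⟨b, e⟩ := exists_toZ (E v w)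
    cases b
    · refine ⟨(fun _ _ => false, fun _ _ => false), by simp [allStates],
        fun x y => (h1 x y).trans rfl, fun x y => ?_⟩
      by_cases hxy : (x = v ∧ y = w) ∨ (x = w ∧ y = v)
      · rcases hxy with ⟨rfl, rfl⟩ | ⟨rfl, rfl⟩
        · exact e.symm
        · rw [hE]; exact e.symm
      · exact h2 x y hxy
    · refine ⟨(fun _ _ => false, pathState v w), ?_, fun x y => (h1 x y).trans rfl, fun x y => ?_⟩
      · unfold allStates
        refine List.mem_append_right _ (List.mem_flatMap.2 ⟨v, mem v, List.mem_map.2 ⟨w,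
          List.mem_filter.2 ⟨mem w, by simp [hor]⟩, rfl⟩⟩)
      · by_cases hxy : (x = v ∧ y = w) ∨ (x = w ∧ y = v)
        · rcases hxy with ⟨rfl, rfl⟩ | ⟨rfl, rfl⟩
          · rw [← e]; simp [pathState]
          · rw [hE, ← e]; simp [pathState]
        · rw [h2 x y hxy]
          have : pathState v w x y = false := by
            unfold pathState
            simpa using hxy
          simp [this, toZ]

/-! ### Octahedra in the infinite NSS graph -/

/-- The neighbour of `v` from which the legs of `v` start. -/
abbrev Vx.ref (v : Vx) : Vx := (v.1 + 1, false)

/-- The antipode of the reference neighbour. -/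
abbrev Vx.opp (v : Vx) : Vx := (v.1 + 1, true)

theorem Vx.ref_ne (v : Vx) : v.1 ≠ v.ref.1 := by
  obtain ⟨i, b⟩ := v; revert i b; decide

theorem Vx.opp_ne (v : Vx) : v.1 ≠ v.opp.1 := by
  obtain ⟨i, b⟩ := v; revert i b; decide

/-- A model of the octahedron whose parts are far apart in the trees. -/
structure Config (d n : ℕ) where
  U : Vx → Set Label
  P : Vx → Vx → Label
  path : ∀ v w, (full d).Walk (P v w) (P w v)
  path_symm : ∀ v w, path w v = (path v w).reverse
  mem : ∀ v w, v.1 ≠ w.1 → P v w ∈ U v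
  -- Equal or antipodal indices have no branch path. A common default vertex keeps `P` total, and
  -- since it lies in a branch set, `leg v w` can be defined for all pairs.
  diag : ∀ v w, v.1 = w.1 → P v w = P (0, false) (1, false)
  isPath : ∀ v w, v.1 ≠ w.1 → (path v w).IsPath
  meet : ∀ v w, v.1 ≠ w.1 → ∀ a ∈ (path v w).support, a ∈ U v → a = P v w
  reach : ∀ v, ∀ a ∈ U v, ∀ b ∈ U v, Reach d (U v) a b
  U_subset : ∀ v, U v ⊆ trig d n 0
  path_subset : ∀ v w, v.1 ≠ w.1 → ∀ a ∈ (path v w).support, a ∈ trig d n 0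
  apart_U : ∀ v w, v ≠ w → Apart (U v) (U w)
  apart_path_U : ∀ v w x, v.1 ≠ w.1 → x ≠ v → x ≠ w → Apart {a | a ∈ (path v w).support} (U x)
  apart_path : ∀ v w x y, v.1 ≠ w.1 → x.1 ≠ y.1 → ¬ ((x = v ∧ y = w) ∨ (x = w ∧ y = v)) →
    Apart {a | a ∈ (path v w).support} {a | a ∈ (path x y).support}

namespace Config

variable {d n : ℕ} (C : Config d n)

/-- The vertex set of a branch path. -/
def E (v w : Vx) : Set Label := {a | a ∈ (C.path v w).support}

theorem E_symm (v w : Vx) : C.E v w = C.E w v := by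
  ext a
  simp [E, C.path_symm v w]

/-- The union of the branch sets and branch paths spanned by a set of vertices. -/
def reg (S : Set Vx) : Set Label :=
  {a | (∃ v ∈ S, a ∈ C.U v) ∨ ∃ v ∈ S, ∃ w ∈ S, v.1 ≠ w.1 ∧ a ∈ C.E v w}

variable {C}

theorem U_subset_reg {S : Set Vx} {v : Vx} (hv : v ∈ S) : C.U v ⊆ C.reg S :=
  fun _ ha => Or.inl ⟨v, hv, ha⟩

theorem E_subset_reg {S : Set Vx} {v w : Vx} (hv : v ∈ S) (hw : w ∈ S) (h : v.1 ≠ w.1) :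
    C.E v w ⊆ C.reg S := fun _ ha => Or.inr ⟨v, hv, w, hw, h, ha⟩

theorem reg_subset_trig (S : Set Vx) : C.reg S ⊆ trig d n 0 := by
  rintro a (⟨v, -, h⟩ | ⟨v, -, w, -, h1, h2⟩)
  · exact C.U_subset v h
  · exact C.path_subset v w h1 a h2

theorem reg_mono {S T : Set Vx} (h : S ⊆ T) : C.reg S ⊆ C.reg T := by
  rintro a (⟨v, hv, h'⟩ | ⟨v, hv, w, hw, h'⟩)
  · exact Or.inl ⟨v, h hv, h'⟩
  · exact Or.inr ⟨v, h hv, w, h hw, h'⟩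

/-- The pieces of which a region consists. -/
def IsPiece (C : Config d n) (S : Set Vx) (X : Set Label) : Prop :=
  (∃ v ∈ S, X = C.U v) ∨ ∃ v ∈ S, ∃ w ∈ S, v.1 ≠ w.1 ∧ X = C.E v w

theorem exists_isPiece {S : Set Vx} {a : Label} (h : a ∈ C.reg S) : ∃ X, C.IsPiece S X ∧ a ∈ X := by
  rcases h with ⟨v, hv, h⟩ | ⟨v, hv, w, hw, h1, h2⟩
  · exact ⟨_, Or.inl ⟨v, hv, rfl⟩, h⟩
  · exact ⟨_, Or.inr ⟨v, hv, w, hw, h1, rfl⟩, h2⟩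

theorem IsPiece.apart {S T : Set Vx} (hST : ∀ v ∈ S, v ∉ T) {X Y : Set Label} (hX : C.IsPiece S X)
    (hY : C.IsPiece T Y) : Apart X Y := by
  rcases hX with ⟨v, hv, rfl⟩ | ⟨v, hv, w, hw, h, rfl⟩ <;>
    rcases hY with ⟨x, hx, rfl⟩ | ⟨x, hx, y, hy, h', rfl⟩
  · exact C.apart_U v x (by rintro rfl; exact hST _ hv hx)
  · exact (C.apart_path_U x y v h' (by rintro rfl; exact hST _ hv hx)
      (by rintro rfl; exact hST _ hv hy)).symm
  · exact C.apart_path_U v w x h (by rintro rfl; exact hST _ hv hx)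
      (by rintro rfl; exact hST _ hw hx)
  · refine C.apart_path v w x y h h' ?_
    rintro (⟨rfl, rfl⟩ | ⟨rfl, rfl⟩)
    · exact hST _ hv hx
    · exact hST _ hv hy

theorem apart_reg {S T : Set Vx} (hST : ∀ v ∈ S, v ∉ T) : Apart (C.reg S) (C.reg T) where
  disj a ha ha' := by
    obtain ⟨X, hX, h⟩ := exists_isPiece ha
    obtain ⟨Y, hY, h'⟩ := exists_isPiece ha'
    exact (hX.apart hST hY).disj _ h h'
  parent l i ha ha' := by
    obtain ⟨X, hX, h⟩ := exists_isPiece ha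
    obtain ⟨Y, hY, h'⟩ := exists_isPiece ha'
    exact (hX.apart hST hY).parent _ _ h h'
  parent' l i ha ha' := by
    obtain ⟨Y, hY, h⟩ := exists_isPiece ha
    obtain ⟨X, hX, h'⟩ := exists_isPiece ha'
    exact (hX.apart hST hY).parent' _ _ h h'
  sibling l i e he ha ha' := by
    obtain ⟨X, hX, h⟩ := exists_isPiece ha
    obtain ⟨Y, hY, h'⟩ := exists_isPiece ha'
    exact (hX.apart hST hY).sibling _ _ _ he h h'

theorem sep_reg {S T : Set Vx} (hST : ∀ v ∈ S, v ∉ T) : Sep d n (C.reg S) (C.reg T) :=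
  ⟨apart_reg hST, reg_subset_trig S, reg_subset_trig T⟩

theorem U_disj {v w : Vx} (h : v ≠ w) {a : Label} (ha : a ∈ C.U v) : a ∉ C.U w :=
  (C.apart_U v w h).disj a ha

theorem E_meet {v w : Vx} (h : v.1 ≠ w.1) {x : Vx} {a : Label} (ha : a ∈ C.E v w)
    (hx : a ∈ C.U x) : (x = v ∧ a = C.P v w) ∨ (x = w ∧ a = C.P w v) := by
  by_cases h1 : x = v
  · subst h1; exact Or.inl ⟨rfl, C.meet _ _ h a ha hx⟩
  · by_cases h2 : x = w
    · subst h2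
      rw [E_symm] at ha
      exact Or.inr ⟨rfl, C.meet _ _ (Ne.symm h) a ha hx⟩
    · exact ((C.apart_path_U v w x h h1 h2).disj a ha hx).elim

/-- The foot edge lies in a set. -/
def FootIn (d i : ℕ) (r : Bool) (X : Set Label) : Prop :=
  footTop d (footIdx i r) r ∈ X ∧ footEnd d i r ∈ X

theorem footTop_ne_footEnd (hd : 1 ≤ d) (i : ℕ) (r : Bool) :
    footTop d (footIdx i r) r ≠ footEnd d i r := footTop_ne_bottom hd _ _ _

theorem FootIn.not_E (hd : 1 ≤ d) {i : ℕ} {r : Bool} {x v w : Vx} (h : FootIn d i r (C.U x))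
    (hvw : v.1 ≠ w.1) : ¬ FootIn d i r (C.E v w) := by
  rintro ⟨h1, h2⟩
  rcases E_meet hvw h1 h.1 with ⟨rfl, h3⟩ | ⟨rfl, h3⟩ <;>
    rcases E_meet hvw h2 h.2 with ⟨h, h4⟩ | ⟨h, h4⟩
  · exact footTop_ne_footEnd hd i r (h3.trans h4.symm)
  · exact hvw (congrArg Prod.fst h)
  · exact hvw (congrArg Prod.fst h.symm)
  · exact footTop_ne_footEnd hd i r (h3.trans h4.symm)

theorem FootIn.not_U {i : ℕ} {r : Bool} {x v : Vx} (h : FootIn d i r (C.U x)) (hv : v ≠ x) :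
    ¬ FootIn d i r (C.U v) := fun h' => U_disj hv h'.1 h.1

theorem FootIn.edge_eq {i : ℕ} {r : Bool} {x y v w : Vx} (h : FootIn d i r (C.E x y))
    (hvw : v.1 ≠ w.1) (hxy : x.1 ≠ y.1) (h' : FootIn d i r (C.E v w)) :
    (v = x ∧ w = y) ∨ (v = y ∧ w = x) := by
  by_contra hn
  exact (C.apart_path x y v w hxy hvw hn).disj _ h.1 h'.1

theorem FootIn.of_coef {i : ℕ} {r : Bool} {u v : Label} {X : Set Label} {p : (full d).Walk u v}
    (hp : ∀ a ∈ p.support, a ∈ X) (h : coef d (footIdx i r) r p ≠ 0) : FootIn d i r X := by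
  obtain ⟨h1, h2⟩ := footEnd_mem_of_coef p h
  exact ⟨hp _ h1, hp _ h2⟩

theorem coef_eq_zero_of_not {i : ℕ} {r : Bool} {u v : Label} {X : Set Label}
    {p : (full d).Walk u v} (hp : ∀ a ∈ p.support, a ∈ X) (h : ¬ FootIn d i r X) :
    coef d (footIdx i r) r p = 0 := by
  by_contra hn
  exact h (FootIn.of_coef hp hn)

variable (C)

/-- Walks inside the branch sets that join the ends of the branch paths. -/
structure Legs where
  leg : ∀ v w, (full d).Walk (C.P v v.ref) (C.P v w)
  mem : ∀ v w, v.1 ≠ w.1 → ∀ a ∈ (leg v w).support, a ∈ C.U v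
  ref : ∀ v, (leg v v.ref).length = 0
  isPath : ∀ v, (leg v v.opp).IsPath
  -- A leg to the third axis follows the main path, which is the leg to `v.opp`, up to a vertex `x`
  -- and then never meets it again. So a foot edge of the main path is on that leg exactly if it
  -- comes before `x`.
  split : ∀ v w, w.1 = v.1 + 2 → ∃ (x : Label) (α : (full d).Walk (C.P v v.ref) x)
    (β : (full d).Walk x (C.P v v.opp)) (σ : (full d).Walk x (C.P v w)),
    leg v v.opp = α.append β ∧ leg v w = α.append σ ∧
      ∀ a ∈ σ.support, a ∈ (leg v v.opp).support → a = x

namespace Legs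

variable {C} (L : C.Legs)

/-- The walk between two centres along a branch path. -/
def e (v w : Vx) : (full d).Walk (C.P v v.ref) (C.P w w.ref) :=
  (L.leg v w).append ((C.path v w).append (L.leg w v).reverse)

/-- The closed walk along a triangle. -/
def tri (v w x : Vx) : (full d).Walk (C.P v v.ref) (C.P v v.ref) :=
  (L.e v w).append ((L.e w x).append (L.e x v))

theorem mem_e {v w : Vx} (h : v.1 ≠ w.1) {a : Label} (ha : a ∈ (L.e v w).support) :
    a ∈ C.reg {v, w} := by
  simp only [e, Walk.mem_support_append_iff, Walk.support_reverse, List.mem_reverse] at ha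
  rcases ha with ha | ha | ha
  · exact U_subset_reg (by simp) (L.mem v w h a ha)
  · exact E_subset_reg (by simp) (by simp) h ha
  · exact U_subset_reg (by simp) (L.mem w v (Ne.symm h) a ha)

theorem mem_tri {v w x : Vx} (h : v.1 ≠ w.1) (h' : w.1 ≠ x.1) (h'' : x.1 ≠ v.1) {a : Label}
    (ha : a ∈ (L.tri v w x).support) : a ∈ C.reg {v, w, x} := by
  simp only [tri, Walk.mem_support_append_iff] at ha
  rcases ha with ha | ha | ha
  · refine reg_mono ?_ (L.mem_e h ha); rintro _ (rfl | rfl) <;> simp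
  · refine reg_mono ?_ (L.mem_e h' ha); rintro _ (rfl | rfl) <;> simp
  · refine reg_mono ?_ (L.mem_e h'' ha); rintro _ (rfl | rfl) <;> simp

theorem coef_ref (i : ℕ) (r : Bool) (v : Vx) : coef d i r (L.leg v v.ref) = 0 := by
  have h := L.ref v
  generalize L.leg v v.ref = p at h
  cases p with
  | nil => rfl
  | cons => simp at h

open Classical in
/-- The bits of the legs at a foot edge. -/
noncomputable def lb (i : ℕ) (r : Bool) (v w : Vx) : ZMod 2 :=
  if v.1 = w.1 then 0 else coef d (footIdx i r) r (L.leg v w)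

open Classical in
/-- The bits of the branch paths at a foot edge. -/
noncomputable def _root_.NSS.Config.eb (C : Config d n) (i : ℕ) (r : Bool) (v w : Vx) : ZMod 2 :=
  if v.1 = w.1 then 0 else coef d (footIdx i r) r (C.path v w)

theorem coef_e {v w : Vx} (h : v.1 ≠ w.1) (i : ℕ) (r : Bool) :
    coef d (footIdx i r) r (L.e v w) = eCoef (L.lb i r) (C.eb i r) v w := by
  simp only [e, coef_append, coef_reverse, eCoef, lb, eb, if_neg h, if_neg (Ne.symm h)]
  ring

theorem coef_tri {v w x : Vx} (h : v.1 ≠ w.1) (h' : w.1 ≠ x.1) (h'' : x.1 ≠ v.1) (i : ℕ)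
    (r : Bool) :
    coef d (footIdx i r) r (L.tri v w x) = wCoef (L.lb i r) (C.eb i r) v w x := by
  rw [tri, coef_append, coef_append, L.coef_e h, L.coef_e h', L.coef_e h'']
  simp only [wCoef]
  ring

theorem lb_eq_zero {i : ℕ} {r : Bool} {v w : Vx} (h : ¬ FootIn d i r (C.U v)) :
    L.lb i r v w = 0 := by
  unfold lb
  split_ifs with h1
  · rfl
  · exact coef_eq_zero_of_not (L.mem v w h1) h

theorem _root_.NSS.Config.eb_eq_zero {i : ℕ} {r : Bool} {v w : Vx}
    (h : v.1 ≠ w.1 → ¬ FootIn d i r (C.E v w)) : C.eb i r v w = 0 := by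
  unfold eb
  split_ifs with h1
  · rfl
  · exact coef_eq_zero_of_not (X := C.E v w) (fun a ha => ha) (h h1)

/-- A foot edge lies in at most one piece. -/
theorem bits_cases (hd : 1 ≤ d) (i : ℕ) (r : Bool) :
    (∃ v, FootIn d i r (C.U v) ∧ (∀ x w, x ≠ v → L.lb i r x w = 0) ∧ ∀ x y, C.eb i r x y = 0) ∨
    (∃ v w, v.1 ≠ w.1 ∧ FootIn d i r (C.E v w) ∧ (∀ x y, L.lb i r x y = 0) ∧
        ∀ x y, ¬ ((x = v ∧ y = w) ∨ (x = w ∧ y = v)) → C.eb i r x y = 0) ∨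
    ((∀ x y, L.lb i r x y = 0) ∧ ∀ x y, C.eb i r x y = 0) := by
  by_cases h1 : ∃ v, FootIn d i r (C.U v)
  · obtain ⟨v, hv⟩ := h1
    exact Or.inl ⟨v, hv, fun x w hx => L.lb_eq_zero (hv.not_U hx),
      fun x y => eb_eq_zero fun h => hv.not_E hd h⟩
  · push Not at h1
    by_cases h2 : ∃ v w, v.1 ≠ w.1 ∧ FootIn d i r (C.E v w)
    · obtain ⟨v, w, h, hv⟩ := h2
      exact Or.inr (Or.inl ⟨v, w, h, hv, fun x y => L.lb_eq_zero (h1 x), fun x y hxy =>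
        eb_eq_zero fun h' h'' => hxy (hv.edge_eq h' h h'')⟩)
    · push Not at h2
      exact Or.inr (Or.inr ⟨fun x y => L.lb_eq_zero (h1 x), fun x y => eb_eq_zero (h2 x y)⟩)

theorem exists_state_bits (hd : 1 ≤ d) (i : ℕ) (r : Bool) :
    ∃ p ∈ allStates, (∀ v w, L.lb i r v w = toZ (p.1 v w)) ∧
      ∀ v w, C.eb i r v w = toZ (p.2 v w) := by
  refine exists_state (fun v w h => if_pos h) (fun v => ?_) (fun v w => ?_) ?_
  · rw [lb]
    split_ifs
    · rfl
    · exact L.coef_ref _ _ _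
  · rw [eb, eb, C.path_symm v w, coef_reverse]
    by_cases h : v.1 = w.1
    · rw [if_pos h, if_pos h.symm]
    · rw [if_neg h, if_neg (Ne.symm h)]
  · rcases L.bits_cases hd i r with ⟨v, -, h⟩ | ⟨v, w, h, -, h'⟩ | ⟨h1, h2⟩
    · exact Or.inl ⟨v, h⟩
    · exact Or.inr ⟨v, w, h, h'⟩
    · exact Or.inl ⟨(0, false), fun x w _ => h1 x w, h2⟩

/-- Opposite triangles are not odd on the two foot edges of a gap. -/
theorem tri_mul_tri (hd : 1 ≤ d) {v w x v' w' x' : Vx} (h : v.1 ≠ w.1) (h' : w.1 ≠ x.1)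
    (h'' : x.1 ≠ v.1) (hv : v' = v.bar) (hw : w' = w.bar) (hx : x' = x.bar) (i : ℕ) (r : Bool) :
    wCoef (L.lb i r) (C.eb i r) v w x * wCoef (L.lb i (!r)) (C.eb i (!r)) v' w' x' = 0 := by
  subst hv hw hx
  rw [← L.coef_tri h h' h'', ← L.coef_tri (v := v.bar) (w := w.bar) (x := x.bar) h h' h'']
  refine coef_mul_coef_eq_zero hd (apart_reg (C := C) (S := {v, w, x}) (T := {v.bar, w.bar, x.bar}) ?_)
    (reg_subset_trig _) (reg_subset_trig _) _ _ (fun a ha => L.mem_tri h h' h'' ha)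
    (fun a ha => L.mem_tri (v := v.bar) (w := w.bar) (x := x.bar) h h' h'' ha) i r
  have key : ∀ v w x : Vx, v.1 ≠ w.1 → w.1 ≠ x.1 → x.1 ≠ v.1 → ∀ y, y = v ∨ y = w ∨ y = x →
    ¬ (y = v.bar ∨ y = w.bar ∨ y = x.bar) := by
    rintro ⟨a, b⟩ ⟨a', b'⟩ ⟨a'', b''⟩ h1 h2 h3 y (rfl | rfl | rfl) <;>
      simp [Vx.bar] <;> simp_all [eq_comm]
  exact key v w x h h' h''

theorem axisForm_eq (hd : 1 ≤ d) (i : ℕ) :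
    axisForm (L.lb i false) (C.eb i false) (L.lb i true) (C.eb i true) =
      ∑ j, complForm (fun x => 1 + x) (L.lb i false) (L.lb i true) j := by
  obtain ⟨p, hp, h1, h2⟩ := L.exists_state_bits hd i false
  obtain ⟨q, hq, h3, h4⟩ := L.exists_state_bits hd i true
  exact complForm_sum hp hq h1 h2 h3 h4 fun b0 b1 b2 => L.tri_mul_tri hd (by decide : (0 : Fin 3) ≠ 1) (by decide : (1 : Fin 3) ≠ 2) (by decide : (2 : Fin 3) ≠ 0) rfl rfl rfl i false

end Legs

end Config

/-! ### The parity identity for a model -/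

theorem edgeInd_eq_zero {V : Type*} {G : SimpleGraph V} {u w y z : V} {q : G.Walk u w}
    (h : y ∉ q.support ∨ z ∉ q.support) : walkSum (edgeInd y z) q = 0 := by
  by_contra hn
  obtain ⟨-, h1, h2⟩ := mem_of_edgeInd hn
  exact h.elim (fun h => h h1) (fun h => h h2)

/-- A path uses its first edge once. -/
theorem exists_edgeInd_eq_one {V : Type*} {G : SimpleGraph V} {u v : V} {p : G.Walk u v}
    (hp : p.IsPath) (h : u ≠ v) : ∃ b ∈ p.support, b ≠ u ∧ walkSum (edgeInd u b) p = 1 := by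
  cases p with
  | nil => exact absurd rfl h
  | @cons _ b _ hb q =>
    rw [Walk.cons_isPath_iff] at hp
    refine ⟨b, by simp, hb.ne', ?_⟩
    rw [walkSum_cons, edgeInd_eq_zero (Or.inl hp.2)]
    simp [edgeInd]

namespace Config

variable {d n : ℕ} {C : Config d n}

namespace Legs

variable (L : C.Legs)

/-- The branch path leaves the branch set of `y` by its first edge and uses it once. Each of the
other eight segments of the closed walk misses an end of this edge. -/
theorem odd_end {y z u : Vx} (h : y.1 ≠ z.1) (h' : z.1 ≠ u.1) (h'' : u.1 ≠ y.1) :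
    ∃ b, walkSum (edgeInd (C.P y z) b) (L.tri y z u) ≠ 0 := by
  have hyz : y ≠ z := fun e => h (congrArg Prod.fst e)
  have hzu : z ≠ u := fun e => h' (congrArg Prod.fst e)
  have huy : u ≠ y := fun e => h'' (congrArg Prod.fst e)
  have hP := C.mem y z h
  have hP' : C.P y z ∈ C.E y z := Walk.start_mem_support _
  obtain ⟨b, hb, hne, hodd⟩ := exists_edgeInd_eq_one (C.isPath y z h)
    (fun e => U_disj hyz hP (e ▸ C.mem z y (Ne.symm h)))
  have hbU : b ∉ C.U y := fun hbU => hne (C.meet y z h b hb hbU)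
  refine ⟨b, ?_⟩
  have rev : ∀ {s t : Label} (p : (full d).Walk s t),
      walkSum (edgeInd (C.P y z) b) p.reverse = walkSum (edgeInd (C.P y z) b) p :=
    fun p => walkSum_reverse (edgeInd_comm _ _) p
  simp only [tri, e, walkSum_append, rev]
  rw [hodd, edgeInd_eq_zero (Or.inr fun hb' => hbU (L.mem y z h b hb')),
    edgeInd_eq_zero (q := L.leg z y) (Or.inl fun hb' => U_disj hyz hP (L.mem z y (Ne.symm h) _ hb')),
    edgeInd_eq_zero (q := L.leg z u) (Or.inl fun hb' => U_disj hyz hP (L.mem z u h' _ hb')),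
    edgeInd_eq_zero (q := C.path z u) (Or.inl fun hb' => ?_),
    edgeInd_eq_zero (q := L.leg u z) (Or.inl fun hb' =>
      U_disj huy.symm hP (L.mem u z (Ne.symm h') _ hb')),
    edgeInd_eq_zero (q := L.leg u y) (Or.inl fun hb' => U_disj huy.symm hP (L.mem u y h'' _ hb')),
    edgeInd_eq_zero (q := C.path u y) (Or.inr fun hb' => ?_),
    edgeInd_eq_zero (q := L.leg y u) (Or.inr fun hb' => hbU (L.mem y u (Ne.symm h'') b hb'))]
  · simp
  · refine (C.apart_path u y y z h'' h ?_).disj b hb' hb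
    rintro (⟨e, -⟩ | ⟨-, e⟩)
    · exact huy e.symm
    · exact hzu e
  · rcases E_meet h' hb' hP with ⟨e, -⟩ | ⟨e, -⟩
    · exact hyz e
    · exact huy e.symm

theorem mu_tri_eq_zero (hd : 1 ≤ d) {v w x y z u : Vx} (h1 : v.1 ≠ w.1) (h2 : w.1 ≠ x.1)
    (h3 : x.1 ≠ v.1) (h4 : y.1 ≠ z.1) (h5 : z.1 ≠ u.1) (h6 : u.1 ≠ y.1)
    (hdis : ∀ a ∈ ({v, w, x} : Set Vx), a ∉ ({y, z, u} : Set Vx)) :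
    mu d (L.tri v w x) (C.P y z) = 0 := by
  obtain ⟨b, hb⟩ := L.odd_end h4 h5 h6
  exact mu_eq_zero_of_odd hd (sep_reg hdis) _ _ (fun a ha => L.mem_tri h1 h2 h3 ha)
    (fun a ha => L.mem_tri h4 h5 h6 ha) hb

/-- The triangle does not enclose `P y z`, which lies on an odd edge of the opposite triangle. So
the crossings with the leg from the centre of `y` to `P y z` decide whether the triangle encloses
the centre. -/
theorem cross_tri (hd : 1 ≤ d) {v w x y z u : Vx} (h1 : v.1 ≠ w.1) (h2 : w.1 ≠ x.1)
    (h3 : x.1 ≠ v.1) (h4 : y.1 ≠ z.1) (h5 : z.1 ≠ u.1) (h6 : u.1 ≠ y.1)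
    (hdis : ∀ a ∈ ({v, w, x} : Set Vx), a ∉ ({y, z, u} : Set Vx)) :
    cross d (2 ^ n) (L.tri v w x) (L.leg y z) =
      mu d (L.e v w) (C.P y y.ref) + mu d (L.e w x) (C.P y y.ref) + mu d (L.e x v) (C.P y y.ref) := by
  rw [cross_closed hd (sep_reg hdis) _ _ (fun a ha => L.mem_tri h1 h2 h3 ha)
    (fun a ha => U_subset_reg (by simp) (L.mem y z h4 a ha)),
    L.mu_tri_eq_zero hd h1 h2 h3 h4 h5 h6 hdis, tri, mu_append, mu_append]
  ring

theorem cross_e (hd : 1 ≤ d) {v w x y : Vx} (h1 : v.1 ≠ w.1) (h2 : x.1 ≠ y.1)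
    (hdis : ∀ a ∈ ({v, w} : Set Vx), a ∉ ({x, y} : Set Vx)) :
    cross d (2 ^ n) (L.e v w) (L.e x y) =
      mu d (L.e v w) (C.P x x.ref) + mu d (L.e v w) (C.P y y.ref) +
      (mu d (L.e x y) (C.P v v.ref) + mu d (L.e x y) (C.P w w.ref)) +
      (leftOf d (C.P v v.ref) (C.P x x.ref) + leftOf d (C.P v v.ref) (C.P y y.ref) +
       leftOf d (C.P w w.ref) (C.P x x.ref) + leftOf d (C.P w w.ref) (C.P y y.ref)) :=
  cross_eq hd _ _ (fun a ha ha' => (apart_reg (C := C) hdis).disj a (L.mem_e h1 ha) (L.mem_e h2 ha'))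
    (fun i r hi ha => footBound_of_subset hd (reg_subset_trig (C := C) {v, w}) i r hi (L.mem_e h1 ha))

theorem mu_e_symm (x y : Vx) (a : Label) : mu d (L.e x y) a = mu d (L.e y x) a := by
  simp only [e, mu_append, mu_reverse, C.path_symm x y]
  ring

theorem cross_tri_eq {v w x y z : Vx} (h1 : v.1 ≠ w.1) (h2 : w.1 ≠ x.1)
    (h3 : x.1 ≠ v.1) (h4 : y.1 ≠ z.1) :
    cross d (2 ^ n) (L.tri v w x) (L.leg y z) = ∑ i ∈ Finset.range (2 ^ n),
      wlTerm (L.lb i false) (C.eb i false) (L.lb i true) (C.eb i true) v w x y z := by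
  refine Finset.sum_congr rfl fun i _ => ?_
  have e1 : coef d i true (L.tri v w x) = _ := L.coef_tri h1 h2 h3 i true
  have e2 : coef d (i + 1) false (L.tri v w x) = _ := L.coef_tri h1 h2 h3 i false
  rw [e1, e2, wlTerm, lb, lb, if_neg h4, if_neg h4]
  simp only [footIdx]
  simp
  ring

theorem cross_e_eq {v w x y : Vx} (h1 : v.1 ≠ w.1) (h2 : x.1 ≠ y.1) :
    cross d (2 ^ n) (L.e v w) (L.e x y) = ∑ i ∈ Finset.range (2 ^ n),
      eeTerm (L.lb i false) (C.eb i false) (L.lb i true) (C.eb i true) v w x y := by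
  refine Finset.sum_congr rfl fun i _ => ?_
  have e1 : coef d i true (L.e v w) = _ := L.coef_e h1 i true
  have e2 : coef d (i + 1) false (L.e v w) = _ := L.coef_e h1 i false
  have e3 : coef d i true (L.e x y) = _ := L.coef_e h2 i true
  have e4 : coef d (i + 1) false (L.e x y) = _ := L.coef_e h2 i false
  rw [e1, e2, e3, e4, eeTerm]

theorem valid_center (hd : 1 ≤ d) (v : Vx) : Valid d (C.P v v.ref) := by
  have h : C.P v v.ref ≠ C.P v.ref v := fun e =>
    U_disj (fun e => v.ref_ne (congrArg Prod.fst e)) (C.mem v v.ref v.ref_ne)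
      (e ▸ C.mem v.ref v v.ref_ne.symm)
  have key : ∀ {a b : Label} (p : (full d).Walk a b), a ≠ b → Valid d a := by
    intro a b p hab
    cases p with
    | nil => exact absurd rfl hab
    | cons h _ => exact (valid_of_adj hd h).1
  exact key (C.path v v.ref) h

theorem leftOf_center (hd : 1 ≤ d) {v w : Vx} (h : v ≠ w) :
    leftOf d (C.P w w.ref) (C.P v v.ref) = leftOf d (C.P v v.ref) (C.P w w.ref) + 1 := by
  have h1 := leftOf_add_leftOf hd (valid_center (C := C) hd v) (valid_center (C := C) hd w)
    (fun e => U_disj h (C.mem v v.ref v.ref_ne) (e ▸ C.mem w w.ref w.ref_ne))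
  linear_combination h1 - zmod_self_add (leftOf d (C.P v v.ref) (C.P w w.ref))

/-- Apply `axis_identity` to the centres, turn the values of the triangles into crossings by
`cross_tri`, and split all crossings according to the gaps. -/
theorem sum_axisForm (hd : 1 ≤ d) : ∑ i ∈ Finset.range (2 ^ n),
    axisForm (L.lb i false) (C.eb i false) (L.lb i true) (C.eb i true) = 1 := by
  have key := axis_identity (fun x y w => mu d (L.e x y) (C.P w w.ref))
    (fun x y v => L.mu_e_symm x y _) (fun v w => leftOf d (C.P v v.ref) (C.P w w.ref))
    (fun v w x y => cross d (2 ^ n) (L.e v w) (L.e x y))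
    (a := (0, false)) (A := (0, true)) (y := (1, false)) (Y := (1, true)) (z := (2, false))
    (Z := (2, true)) ?_ ?_
  · rw [← key]
    -- The vertex `u` only completes `y` and `z` to the triangle opposite to `v`, `w`, `x`.
    have T : ∀ {v w x y z : Vx} (u : Vx), v.1 ≠ w.1 → w.1 ≠ x.1 → x.1 ≠ v.1 → y.1 ≠ z.1 →
        z.1 ≠ u.1 → u.1 ≠ y.1 → (∀ a ∈ ({v, w, x} : Set Vx), a ∉ ({y, z, u} : Set Vx)) →
        mu d (L.e v w) (C.P y y.ref) + mu d (L.e w x) (C.P y y.ref) +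
          mu d (L.e x v) (C.P y y.ref) = ∑ i ∈ Finset.range (2 ^ n),
      wlTerm (L.lb i false) (C.eb i false) (L.lb i true) (C.eb i true) v w x y z := by
      intro v w x y z u h1 h2 h3 h4 h5 h6 hdis
      rw [← L.cross_tri hd h1 h2 h3 h4 h5 h6 hdis, L.cross_tri_eq h1 h2 h3 h4]
    simp only [axisForm, axisTerm, Finset.sum_add_distrib]
    rw [T (v := (0, false)) (w := (1, false)) (x := (2, false)) (y := (2, true)) (z := (0, true)) (1, true)
        (by decide) (by decide) (by decide) (by decide) (by decide) (by decide) (by simp),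
      T (v := (0, true)) (w := (1, true)) (x := (2, true)) (y := (1, false)) (z := (2, false)) (0, false)
        (by decide) (by decide) (by decide) (by decide) (by decide) (by decide) (by simp),
      T (v := (0, false)) (w := (2, false)) (x := (1, true)) (y := (1, false)) (z := (2, true)) (0, true)
        (by decide) (by decide) (by decide) (by decide) (by decide) (by decide) (by simp),
      T (v := (0, true)) (w := (2, true)) (x := (1, false)) (y := (2, false)) (z := (0, false)) (1, true)
        (by decide) (by decide) (by decide) (by decide) (by decide) (by decide) (by simp),
      T (v := (0, false)) (w := (1, true)) (x := (2, true)) (y := (2, false)) (z := (0, true)) (1, false)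
        (by decide) (by decide) (by decide) (by decide) (by decide) (by decide) (by simp),
      T (v := (0, true)) (w := (1, false)) (x := (2, false)) (y := (1, true)) (z := (2, true)) (0, false)
        (by decide) (by decide) (by decide) (by decide) (by decide) (by decide) (by simp),
      T (v := (0, false)) (w := (2, true)) (x := (1, false)) (y := (1, true)) (z := (2, false)) (0, true)
        (by decide) (by decide) (by decide) (by decide) (by decide) (by decide) (by simp),
      T (v := (0, true)) (w := (2, false)) (x := (1, true)) (y := (2, true)) (z := (0, false)) (1, false)
        (by decide) (by decide) (by decide) (by decide) (by decide) (by decide) (by simp),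
      L.cross_e_eq (v := (0, false)) (w := (1, false)) (x := (0, true)) (y := (2, true)) (by decide) (by decide),
      L.cross_e_eq (v := (0, false)) (w := (2, false)) (x := (0, true)) (y := (1, false)) (by decide) (by decide),
      L.cross_e_eq (v := (0, false)) (w := (1, true)) (x := (0, true)) (y := (2, false)) (by decide) (by decide),
      L.cross_e_eq (v := (0, false)) (w := (2, true)) (x := (0, true)) (y := (1, true)) (by decide) (by decide),
      L.cross_e_eq (v := (1, false)) (w := (2, false)) (x := (1, true)) (y := (2, true)) (by decide) (by decide),
      L.cross_e_eq (v := (2, false)) (w := (1, true)) (x := (2, true)) (y := (1, false)) (by decide) (by decide),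
      L.cross_e_eq (v := (0, false)) (w := (1, false)) (x := (0, true)) (y := (1, true)) (by decide) (by decide),
      L.cross_e_eq (v := (0, false)) (w := (2, false)) (x := (0, true)) (y := (2, true)) (by decide) (by decide),
      L.cross_e_eq (v := (0, false)) (w := (1, true)) (x := (0, true)) (y := (1, false)) (by decide) (by decide),
      L.cross_e_eq (v := (0, false)) (w := (2, true)) (x := (0, true)) (y := (2, false)) (by decide) (by decide)]
  · intro p hp
    apply leftOf_center hd
    fin_cases hp <;> decide
  · intro p hp
    fin_cases hp <;> exact L.cross_e hd (by decide) (by decide) (by simp)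

end Legs

end Config

/-! ### Walks -/

section Walks

variable {V : Type*} {G : SimpleGraph V}

/-- Two splittings of a walk are comparable. -/
theorem append_eq_append {u v x y z : V} (α : G.Walk u x) (β : G.Walk x v) (π : G.Walk u y)
    (h : G.Adj y z) (ρ : G.Walk z v) (he : α.append β = π.append (Walk.cons h ρ)) :
    (∃ γ : G.Walk x y, π = α.append γ ∧ β = γ.append (Walk.cons h ρ)) ∨
      ∃ γ : G.Walk z x, α = π.append (Walk.cons h γ) ∧ ρ = γ.append β := by
  induction α with
  | nil => exact Or.inl ⟨π, rfl, he⟩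
  | @cons a b c hab α ih =>
    cases π with
    | nil =>
      rw [Walk.cons_append, Walk.nil_append] at he
      obtain ⟨rfl, he⟩ := Walk.cons.inj he
      exact Or.inr ⟨α, rfl, (eq_of_heq he).symm⟩
    | @cons _ b' _ hab' π =>
      rw [Walk.cons_append, Walk.cons_append] at he
      obtain ⟨rfl, he⟩ := Walk.cons.inj he
      rcases ih β π (eq_of_heq he) with ⟨γ, rfl, h2⟩ | ⟨γ, rfl, h2⟩
      · exact Or.inl ⟨γ, rfl, h2⟩
      · exact Or.inr ⟨γ, rfl, h2⟩

/-- The first step of a walk with a property. -/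
theorem exists_first_step (Q : V → V → Prop) {u v : V} (p : G.Walk u v) :
    (∀ a ∈ p.darts, ¬ Q a.fst a.snd) ∨
      ∃ (s t : V) (h : G.Adj s t) (π : G.Walk u s) (ρ : G.Walk t v),
        p = π.append (Walk.cons h ρ) ∧ Q s t ∧ ∀ a ∈ π.darts, ¬ Q a.fst a.snd := by
  induction p with
  | nil => exact Or.inl (by simp)
  | @cons a b c hab p ih =>
    by_cases hQ : Q a b
    · exact Or.inr ⟨a, b, hab, Walk.nil, p, rfl, hQ, by simp⟩
    · rcases ih with ih | ⟨s, t, h, π, ρ, rfl, h1, h2⟩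
      · left
        intro x hx
        rw [Walk.darts_cons, List.mem_cons] at hx
        rcases hx with rfl | hx
        · exact hQ
        · exact ih x hx
      · refine Or.inr ⟨s, t, h, Walk.cons hab π, ρ, rfl, h1, ?_⟩
        intro x hx
        rw [Walk.darts_cons, List.mem_cons] at hx
        rcases hx with rfl | hx
        · exact hQ
        · exact h2 x hx

/-- The part of a walk before it meets a set. -/
theorem exists_walk_first (X : Set V) {u v : V} (p : G.Walk u v) (hv : v ∈ X) :
    ∃ w ∈ X, ∃ q : G.Walk u w, (∀ a ∈ q.support, a ∈ p.support) ∧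
      ∀ a ∈ q.support, a ∈ X → a = w := by
  induction p with
  | nil => exact ⟨_, hv, Walk.nil, by simp, by simp⟩
  | @cons a b c hab p ih =>
    by_cases ha : a ∈ X
    · exact ⟨a, ha, Walk.nil, by simp, by simp⟩
    · obtain ⟨w, hw, q, h1, h2⟩ := ih hv
      refine ⟨w, hw, Walk.cons hab q, ?_, ?_⟩
      · intro x hx
        rw [Walk.support_cons, List.mem_cons] at hx ⊢
        exact hx.imp id (h1 x)
      · intro x hx hx'
        rw [Walk.support_cons, List.mem_cons] at hx
        rcases hx with rfl | hx
        · exact absurd hx' ha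
        · exact h2 x hx hx'

theorem eq_of_mem_append {u v w x : V} {p : G.Walk u v} {q : G.Walk v w}
    (h : (p.append q).IsPath) (hp : x ∈ p.support) (hq : x ∈ q.support) : x = v := by
  by_contra hne
  have hn := h.support_nodup
  rw [Walk.support_append] at hn
  have h2 : x ∈ q.support.tail := by
    rw [← Walk.cons_tail_support] at hq
    exact (List.mem_cons.1 hq).resolve_left hne
  exact (List.nodup_append.1 hn).2.2 x hp x h2 rfl

end Walks

theorem Reach.exists_walk {d : ℕ} {X : Set Label} {u v : Label} (h : Reach d X u v) :
    ∃ p : (full d).Walk u v, ∀ a ∈ p.support, a ∈ X := by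
  obtain ⟨h1, h2⟩ := h
  induction h2 with
  | refl => exact ⟨Walk.nil, by simpa using h1⟩
  | @tail b c _ h ih =>
    obtain ⟨p, hp⟩ := ih
    refine ⟨p.concat h.1, fun a ha => ?_⟩
    rw [Walk.support_concat, List.mem_append] at ha
    rcases ha with ha | ha
    · exact hp a ha
    · rw [List.mem_singleton.1 ha]; exact h.2

/-! ### Gaps and walks -/

theorem gap_boundary {d m : ℕ} (hd : 1 ≤ d) {x y : Label} (h : (full d).Adj x y)
    (hx : x ∈ gap d m) (hy : y ∉ gap d m) : x = gapEnd d m 0 ∨ x = gapEnd d m 1 := by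
  cases x with
  | tree => exact hx.elim
  | leg => exact hx.elim
  | bottom p =>
    obtain ⟨h1, h2⟩ := hx
    have e1 : (2 * m + 1) * d = 2 * m * d + d := by ring
    suffices hs : p = 2 * m * d ∨ p = (2 * m + 1) * d by
      unfold gapEnd
      rcases hs with hs | hs <;> simp [hs]
    by_contra hn
    push Not at hn
    have foot : ∀ i r, p ≠ footPos i r * d := by
      rintro i r rfl
      have h3 := Nat.le_of_mul_le_mul_right h1 hd
      have h4 := Nat.le_of_mul_le_mul_right h2 hd
      obtain h5 | h5 : footPos i r = 2 * m ∨ footPos i r = 2 * m + 1 := by omega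
      · exact hn.1 (by rw [h5])
      · exact hn.2 (by rw [h5])
    generalize hx : bottom p = x at h
    rcases full_adj_cases h with h | h <;> cases h <;> try cases hx
    · exact hy ⟨by omega, by omega⟩
    · exact legPoint_ne_bottom (by omega) _ hx.symm
    · exact footTop_ne_bottom hd _ _ _ hx.symm
    · exact hy ⟨by omega, by omega⟩
    · exact foot _ _ rfl

theorem reach_gap {d m : ℕ} (hd : 1 ≤ d) :
    Reach d (gap d m) (gapEnd d m 0) (gapEnd d m 1) := by
  have e1 : (2 * m + 1) * d = 2 * m * d + d := by ring
  have key : ∀ t ≤ d, Reach d (gap d m) (gapEnd d m 0) (bottom (2 * m * d + t)) := by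
    intro t
    induction t with
    | zero => exact fun _ => Reach.refl (gapEnd_mem_gap (by omega))
    | succ t ih =>
      intro ht
      exact (ih (by omega)).tail ((full_adj hd).2 (Or.inl (NLink.bottom _)))
        ⟨by omega, by omega⟩
  have := key d le_rfl
  rwa [← e1] at this

theorem exists_gap_walk {d : ℕ} (hd : 1 ≤ d) (j : ℕ) (r : Bool) :
    ∃ p : (full d).Walk (footEnd d j r) (footEnd d j (!r)), ∀ a ∈ p.support, a ∈ gap d (j + 1) := by
  cases r
  · exact (reach_gap hd).exists_walk
  · exact (reach_gap hd).symm.exists_walk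

theorem gap_subset_of_foot {d n j : ℕ} {r : Bool} (h : footEnd d j r ∈ trig d n 0)
    (h' : footEnd d j (!r) ∈ trig d n 0) : gap d (j + 1) ⊆ trig d n 0 := by
  intro x hx
  cases x with
  | tree => exact hx.elim
  | leg => exact hx.elim
  | bottom p =>
    obtain ⟨h1, h2⟩ := hx
    have h3 : footEnd d j true ∈ trig d n 0 := by cases r <;> assumption
    refine ⟨by simp, h2.trans h3.2⟩

/-- A closed walk that avoids both ends of a gap and uses some foot edge avoids the gap. -/
theorem notMem_gap_of_coef {d m i : ℕ} {r : Bool} (hd : 1 ≤ d) {u : Label} {p : (full d).Walk u u}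
    (h : coef d (footIdx i r) r p ≠ 0) (h0 : gapEnd d m 0 ∉ p.support)
    (h1 : gapEnd d m 1 ∉ p.support) {x : Label} (hx : x ∈ p.support) : x ∉ gap d m := by
  intro hg
  have ht := (footEnd_mem_of_coef p h).1
  have hr : ∀ {a b}, a ∈ p.support → b ∈ p.support → Reach d {a | a ∈ p.support} a b := by
    classical
    have key : ∀ a ∈ p.support, Reach d {a | a ∈ p.support} u a := fun a ha =>
      Reach.of_walk (p.takeUntil a ha) fun b hb => p.support_takeUntil_subset_support ha hb
    intro a b ha hb
    exact (key _ ha).symm.trans (key _ hb)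
  rcases (hr hx ht).exit hg with h2 | ⟨a, b, h2, h3, h4, h5⟩
  · exact footTop_notMem_gap hd h2.right_mem.2
  · rcases gap_boundary hd h3 h2.right_mem.2 h5 with rfl | rfl
    · exact h0 h2.right_mem.1
    · exact h1 h2.right_mem.1

/-! ### Complementary foot edges -/

namespace Config

variable {d n : ℕ} {C : Config d n} (L : C.Legs)

/-- The foot edge `(j, r)` lies in the branch set of `(i, false)`, the other foot edge of the gap
in the branch set of the antipode, and they separate the branch paths in complementary ways. -/
noncomputable def Legs.chi (i : Fin 3) (b : Bool) (j : ℕ) (r : Bool) : ZMod 2 :=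
  (L.lb j r (i, false) (i + 1, true) * L.lb j (!r) (i, true) (i + 1, true)) *
    ((L.lb j r (i, false) (i + 2, b) * (1 + L.lb j r (i, false) (i + 2, !b))) *
      ((1 + L.lb j (!r) (i, true) (i + 2, b)) * L.lb j (!r) (i, true) (i + 2, !b)))

/-- For each gap and axis, `complForm` is the sum of `chi` over `b` and `r`. If all sums of `chi`
over the gaps were zero, then `sum_axisForm` would read `0 = 1`. -/
theorem Legs.exists_chi_sum (hd : 1 ≤ d) :
    ∃ i b, ∑ j ∈ Finset.range (2 ^ n), ∑ r, L.chi i b j r ≠ 0 := by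
  by_contra hn
  push Not at hn
  have h := L.sum_axisForm hd
  simp only [L.axisForm_eq hd] at h
  rw [Finset.sum_comm] at h
  rw [Finset.sum_eq_zero] at h
  · exact zero_ne_one h
  · intro i _
    have h1 := congrArg₂ (· + ·) (hn i false) (hn i true)
    simp only [add_zero, ← Finset.sum_add_distrib] at h1
    rw [← h1]
    refine Finset.sum_congr rfl fun j _ => ?_
    simp only [complForm, complTerm, chi, Fintype.sum_bool, Bool.not_true, Bool.not_false]
    ring

end Config

theorem zmod_two_cases (x : ZMod 2) : x = 0 ∨ x = 1 := by
  revert x; decide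

theorem fin_three_ne (i : Fin 3) : i ≠ i + 1 ∧ i ≠ i + 2 ∧ i + 1 ≠ i + 2 := by
  revert i; decide

theorem footEnd_injective {d : ℕ} (hd : 1 ≤ d) {j j' : ℕ} {r r' : Bool}
    (h : footEnd d j r = footEnd d j' r') : j = j' ∧ r = r' := by
  simp only [footEnd, gapEnd, bottom.injEq] at h
  have := Nat.eq_of_mul_eq_mul_right hd h
  cases r <;> cases r' <;> simp at this ⊢ <;> omega

namespace Config

variable {d n : ℕ} {C : Config d n}

theorem reach_reg {v w : Vx} (h : v.1 ≠ w.1) {a b : Label} (ha : a ∈ C.reg {v, w})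
    (hb : b ∈ C.U v) : Reach d (C.reg {v, w}) a b := by
  have hv : C.U v ⊆ C.reg {v, w} := U_subset_reg (by simp)
  have hw : C.U w ⊆ C.reg {v, w} := U_subset_reg (by simp)
  have hE : C.E v w ⊆ C.reg {v, w} := E_subset_reg (by simp) (by simp) h
  have hV : ∀ x ∈ C.U v, Reach d (C.reg {v, w}) x b := fun x hx => (C.reach v x hx b hb).mono hv
  have hP : Reach d (C.reg {v, w}) (C.P v w) b := hV _ (C.mem v w h)
  have hEr : ∀ x ∈ C.E v w, Reach d (C.reg {v, w}) x b := by
    classical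
    intro x hx
    exact (Reach.of_walk ((C.path v w).takeUntil x hx) fun y hy =>
      hE ((C.path v w).support_takeUntil_subset_support hx hy)).symm.trans hP
  rcases ha with ⟨x, e | e, hx⟩ | ⟨x, hx, y, hy, hxy, hxE⟩
  · exact hV a (e ▸ hx)
  · exact ((C.reach w a (e ▸ hx) _ (C.mem w v (Ne.symm h))).mono hw).trans
      (hEr _ (Walk.end_mem_support _))
  · rcases hx with rfl | rfl <;> rcases hy with rfl | rfl
    · exact absurd rfl hxy
    · exact hEr a hxE
    · rw [E_symm] at hxE
      exact hEr a hxE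
    · exact absurd rfl hxy

namespace Legs

variable (L : C.Legs)

theorem lb_eq_zero_of_U {j : ℕ} {r : Bool} {v x : Vx} (h : FootIn d j r (C.U v)) (hx : x ≠ v)
    (y : Vx) : L.lb j r x y = 0 := L.lb_eq_zero (h.not_U hx)

theorem wCoef_of_U (hd : 1 ≤ d) {j : ℕ} {r : Bool} {v x y : Vx} (h : FootIn d j r (C.U v))
    (hx : x ≠ v) (hy : y ≠ v) :
    wCoef (L.lb j r) (C.eb j r) v x y = L.lb j r v x + L.lb j r v y := by
  have hE : ∀ x y, C.eb j r x y = 0 := fun x y => eb_eq_zero fun h' => h.not_E hd h'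
  simp only [wCoef, eCoef, hE, L.lb_eq_zero_of_U h hx, L.lb_eq_zero_of_U h hy, add_zero, zero_add]

/-- The foot edge `(j, r)` and the other foot edge of the gap are complementary; `c` and `b` say
which neighbours of the two antipodes are separated. -/
def Compl (i : Fin 3) (c b : Bool) (j : ℕ) (r : Bool) : Prop :=
  L.lb j r (i, false) (i + 1, c) + L.lb j r (i, false) (i + 1, !c) = 1 ∧
  L.lb j r (i, false) (i + 1, !c) + L.lb j r (i, false) (i + 2, b) = 0 ∧
  L.lb j r (i, false) (i + 1, !c) + L.lb j r (i, false) (i + 2, !b) = 1 ∧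
  L.lb j (!r) (i, true) (i + 1, c) + L.lb j (!r) (i, true) (i + 1, !c) = 1 ∧
  L.lb j (!r) (i, true) (i + 1, !c) + L.lb j (!r) (i, true) (i + 2, !b) = 0 ∧
  L.lb j (!r) (i, true) (i + 1, !c) + L.lb j (!r) (i, true) (i + 2, b) = 1

/-- A path through a branch set that runs upwards through a complementary foot edge. -/
structure Upward (i : Fin 3) (c b : Bool) (j : ℕ) (r : Bool) where
  before : (full d).Walk (C.P (i, false) (i + 1, c)) (footEnd d j r)
  after : (full d).Walk (footTop d (footIdx j r) r) (C.P (i, false) (i + 1, !c))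
  adj : (full d).Adj (footEnd d j r) (footTop d (footIdx j r) r)
  isPath : (before.append (Walk.cons adj after)).IsPath
  mem : ∀ a ∈ (before.append (Walk.cons adj after)).support, a ∈ C.U (i, false)
  coef_eq : ∀ j' r', coef d (footIdx j' r') r' (before.append (Walk.cons adj after)) =
    L.lb j' r' (i, false) (i + 1, c) + L.lb j' r' (i, false) (i + 1, !c)
  compl : L.Compl i c b j r
  -- In both constructions in `sum_chi` this holds because the leg to `(i + 2, !b)` branches off in
  -- the part `before`.
  sep : ∀ j' r', coef d (footIdx j' r') r' (Walk.cons adj after) ≠ 0 →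
    L.lb j' r' (i, false) (i + 1, !c) + L.lb j' r' (i, false) (i + 2, !b) = 1

namespace Upward

variable {L} {i : Fin 3} {c b : Bool} {j : ℕ} {r : Bool} (F : L.Upward i c b j r)

theorem mem_U {a : Label} (h : a ∈ F.before.support ∨ a ∈ (Walk.cons F.adj F.after).support) :
    a ∈ C.U (i, false) := F.mem a (by rwa [Walk.mem_support_append_iff])

theorem coef_before (hd : 1 ≤ d) {j' : ℕ} {r' : Bool}
    (h : coef d (footIdx j' r') r' (Walk.cons F.adj F.after) ≠ 0) :
    coef d (footIdx j' r') r' F.before = 0 := by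
  by_contra h'
  obtain ⟨h1, h2⟩ := footEnd_mem_of_coef _ h
  obtain ⟨h3, h4⟩ := footEnd_mem_of_coef _ h'
  exact footTop_ne_footEnd hd j' r' ((eq_of_mem_append F.isPath h3 h1).trans
    (eq_of_mem_append F.isPath h4 h2).symm)

theorem notMem_after : footEnd d j r ∉ F.after.support := by
  have := F.isPath.of_append_right
  rw [Walk.cons_isPath_iff] at this
  exact this.2

theorem coef_self : coef d (footIdx j r) r (Walk.cons F.adj F.after) = 1 := by
  have h : coef d (footIdx j r) r F.after = 0 := by
    by_contra h
    exact F.notMem_after (footEnd_mem_of_coef _ h).2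
  rw [coef, walkSum_cons]
  rw [coef] at h
  rw [h, add_zero, footEdge, if_pos (Or.inr ⟨rfl, footEnd_eq _ _ _⟩)]

theorem footIn_compl (F : L.Upward i c b j r) : FootIn d j (!r) (C.U (i, true)) := by
  by_contra h
  have := F.compl.2.2.2.1
  rw [L.lb_eq_zero h, L.lb_eq_zero h] at this
  simp at this

/-- Otherwise the path can be closed up: along `before` and `after` to the foot of `(j', r')`,
across its gap, and back to the start through the parts at `(i + 1, c)` and `(i + 2, !b)`. This
closed walk is odd on `(j, r)`, and the triangle through the antipode and the other two neighbours
is odd on `(j, !r)`, contrary to `coef_mul_coef_eq_zero`. -/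
theorem not_joined (hd : 1 ≤ d) {j' : ℕ} {r' : Bool}
    (h : coef d (footIdx j' r') r' (Walk.cons F.adj F.after) ≠ 0)
    (hm : footEnd d j' (!r') ∈ C.reg {(i + 1, c), (i + 2, !b)}) : False := by
  classical
  obtain ⟨n1, n2, n3⟩ := fin_three_ne i
  have hne : ¬ (j' = j ∧ r' = r) := by
    rintro ⟨rfl, rfl⟩
    refine (apart_reg (C := C) (S := {(i, true)}) (T := {(i + 1, c), (i + 2, !b)}) ?_).disj _
      (U_subset_reg (Set.mem_singleton _) F.footIn_compl.2) hm
    simp [n1, n2]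
  have hg := footEnd_mem_of_coef _ h
  have hfoot : footEdge d (footIdx j' r') r' (footEnd d j r) (footTop d (footIdx j r) r) = 0 := by
    apply footEdge_eq_zero_of_not
    rw [← footEnd_eq]
    rintro (⟨h1, -⟩ | ⟨-, h1⟩)
    · exact footTop_ne_bottom hd _ _ _ h1.symm
    · have := footEnd_injective hd h1
      exact hne ⟨this.1.symm, this.2.symm⟩
  have hafter : footEnd d j' r' ∈ F.after.support := by
    rw [coef, walkSum_cons, hfoot, zero_add] at h
    exact (footEnd_mem_of_coef _ h).2
  have htU : footTop d (footIdx j r) r ∈ C.U (i, false) := F.mem_U (by simp)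
  obtain ⟨γ, hγ⟩ := exists_gap_walk hd j' r'
  obtain ⟨ρ, hρ⟩ := (reach_reg (C := C) n3 hm (C.mem (i + 1, c) (i, false) n1.symm)).exists_walk
  have hρt : coef d (footIdx j r) r ρ = 0 := by
    by_contra hn
    refine (apart_reg (C := C) (S := {(i, false)}) (T := {(i + 1, c), (i + 2, !b)}) ?_).disj _
      (U_subset_reg (Set.mem_singleton _) htU) (hρ _ (footEnd_mem_of_coef _ hn).1)
    simp [n1, n2]
  have hγt : coef d (footIdx j r) r γ = 0 := by
    by_contra hn
    exact footTop_notMem_gap hd (hγ _ (footEnd_mem_of_coef _ hn).1)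
  have hEt : coef d (footIdx j r) r (C.path (i + 1, c) (i, false)) = 0 := by
    by_contra hn
    have h1 : footTop d (footIdx j r) r ∈ C.E (i + 1, c) (i, false) := (footEnd_mem_of_coef _ hn).1
    rcases E_meet n1.symm h1 htU with ⟨e, -⟩ | ⟨-, e⟩
    · exact n1 (congrArg Prod.fst e)
    · refine footTop_ne_footEnd hd j r (eq_of_mem_append F.isPath ?_ ?_)
      · rw [e]; exact Walk.start_mem_support _
      · simp
  have htake : coef d (footIdx j r) r (F.after.takeUntil _ hafter) = 0 := by
    by_contra hn
    exact F.notMem_after (F.after.support_takeUntil_subset_support hafter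
      (footEnd_mem_of_coef _ hn).2)
  let B := (F.before.append (Walk.cons F.adj (F.after.takeUntil _ hafter))).append
    (γ.append (ρ.append (C.path (i + 1, c) (i, false))))
  have hB : coef d (footIdx j r) r B = 1 := by
    have hb := F.coef_before hd (j' := j) (r' := r) (by rw [F.coef_self]; exact one_ne_zero)
    simp only [B, coef_append, hρt, hγt, hEt, hb]
    have := F.coef_self
    rw [coef, walkSum_cons] at this ⊢
    have h0 : coef d (footIdx j r) r F.after = 0 := by
      by_contra hn
      exact F.notMem_after (footEnd_mem_of_coef _ hn).2
    rw [coef] at h0 htake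
    rw [h0] at this
    rw [htake, this]
    simp
  let K := L.tri (i, true) (i + 1, !c) (i + 2, b)
  have hKmem : ∀ a ∈ K.support, a ∈ C.reg {(i, true), (i + 1, !c), (i + 2, b)} :=
    fun a ha => L.mem_tri n1 n3 n2.symm ha
  have hK : coef d (footIdx j (!r)) (!r) K = 1 := by
    rw [L.coef_tri n1 n3 n2.symm, L.wCoef_of_U hd F.footIn_compl (by simp) (by simp)]
    exact F.compl.2.2.2.2.2
  have hap : Apart (C.reg {(i, false), (i + 1, c), (i + 2, !b)})
      (C.reg {(i, true), (i + 1, !c), (i + 2, b)}) :=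
    apart_reg (by simp [n1, n2, n3, n1.symm, n2.symm, n3.symm])
  have hKe : ∀ a ∈ C.reg {(i, false), (i + 1, c), (i + 2, !b)}, a ∉ K.support :=
    fun a ha ha' => hap.disj a ha (hKmem a ha')
  have hend : footEnd d j' r' ∈ C.reg {(i, false), (i + 1, c), (i + 2, !b)} :=
    U_subset_reg (v := (i, false)) (by simp) (F.mem_U (Or.inr hg.2))
  have hend' : footEnd d j' (!r') ∈ C.reg {(i, false), (i + 1, c), (i + 2, !b)} :=
    reg_mono (by simp) hm
  -- The triangle misses both ends of this gap, so if it met the gap it would stay inside; but it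
  -- uses a foot edge.
  have hgap : ∀ x ∈ gap d (j' + 1), x ∉ K.support := by
    intro x hx hx'
    refine notMem_gap_of_coef hd (by rw [hK]; exact one_ne_zero) ?_ ?_ hx' hx
    · cases r'
      · exact hKe _ hend
      · exact hKe _ hend'
    · cases r'
      · exact hKe _ hend'
      · exact hKe _ hend
  have hsub : gap d (j' + 1) ⊆ trig d n 0 :=
    gap_subset_of_foot (reg_subset_trig _ hend) (reg_subset_trig _ hend')
  have hAB : Apart (gap d (j' + 1) ∪ C.reg {(i, false), (i + 1, c), (i + 2, !b)})
      {a | a ∈ K.support} := by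
    have hap' := hap.mono subset_rfl (show {a | a ∈ K.support} ⊆ _ from hKmem)
    refine ⟨?_, ?_, ?_, ?_⟩
    · rintro x (hx | hx)
      · exact hgap x hx
      · exact hap'.disj x hx
    · rintro h i (hx | hx)
      · exact hx.elim
      · exact hap'.parent h i hx
    · rintro h i hx (hx' | hx')
      · exact hx'.elim
      · exact hap'.parent' h i hx hx'
    · rintro h i e he (hx | hx)
      · exact hx.elim
      · exact hap'.sibling h i e he hx
  have hBmem : ∀ a ∈ B.support, a ∈ gap d (j' + 1) ∪ C.reg {(i, false), (i + 1, c), (i + 2, !b)} := by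
    intro a ha
    simp only [B, Walk.mem_support_append_iff] at ha
    rcases ha with (ha | ha) | ha | ha | ha
    · exact Or.inr (U_subset_reg (v := (i, false)) (by simp) (F.mem_U (Or.inl ha)))
    · refine Or.inr (U_subset_reg (v := (i, false)) (by simp) (F.mem_U (Or.inr ?_)))
      rw [Walk.support_cons, List.mem_cons] at ha ⊢
      exact ha.imp id fun h => F.after.support_takeUntil_subset_support hafter h
    · exact Or.inl (hγ a ha)
    · exact Or.inr (reg_mono (by simp) (hρ a ha))
    · exact Or.inr (E_subset_reg (v := (i + 1, c)) (w := (i, false)) (by simp) (by simp) n1.symm ha)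
  have := coef_mul_coef_eq_zero hd hAB (Set.union_subset hsub (reg_subset_trig _))
    (fun a ha => reg_subset_trig _ (hKmem a ha)) B K hBmem (fun a ha => ha) j r
  rw [hB, hK] at this
  simp at this

end Upward

end Legs

end Config

theorem zmod_compl_symm (x₁ x₂ x₃ x₄ : ZMod 2) : x₁ + x₂ = 1 → x₂ + x₃ = 0 → x₂ + x₄ = 1 →
    x₁ + x₄ = 0 ∧ x₁ + x₃ = 1 := by
  revert x₁ x₂ x₃ x₄; decide

theorem zmod_compl_true (x₂ x₃ x₄ y₂ y₃ y₄ : ZMod 2) :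
    (x₂ = 1 ∧ x₂ + x₃ = 0 ∧ x₂ + x₄ = 1 ∧ y₂ = 1 ∧ y₂ + y₄ = 0 ∧ y₂ + y₃ = 1) →
    x₂ * y₂ * (x₃ * (1 + x₄) * ((1 + y₃) * y₄)) = 1 := by
  revert x₂ x₃ x₄ y₂ y₃ y₄; decide

theorem zmod_compl_false (x₂ x₃ x₄ y₂ y₃ y₄ : ZMod 2) :
    ¬ (x₂ = 1 ∧ x₂ + x₃ = 0 ∧ x₂ + x₄ = 1 ∧ y₂ = 1 ∧ y₂ + y₄ = 0 ∧ y₂ + y₃ = 1) →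
    x₂ * y₂ * (x₃ * (1 + x₄) * ((1 + y₃) * y₄)) = 0 := by
  revert x₂ x₃ x₄ y₂ y₃ y₄; decide

namespace Config

variable {d n : ℕ} {C : Config d n}

namespace Legs

variable {L : C.Legs} {i : Fin 3} {c b : Bool} {j : ℕ} {r : Bool}

namespace Upward

variable (F : L.Upward i c b j r)

-- Opposite triangles are not odd on both foot edges of a gap; three choices of neighbours give
-- relations between the bits. If the partner foot edge lies in the antipodal branch set, they
-- settle the claim. Branch paths at the antipode that belong to the triangle are excluded because
-- they also belong to another triangle known to be even, and the remaining parts of the triangle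
-- are excluded by `not_joined`.
open Classical in
theorem coef_partner (hd : 1 ≤ d) {j' : ℕ} {r' : Bool}
    (h : coef d (footIdx j' r') r' (Walk.cons F.adj F.after) ≠ 0) :
    coef d (footIdx j' (!r')) (!r') (L.tri (i, true) (i + 1, c) (i + 2, !b)) =
      if L.Compl i c b j' r' then 1 else 0 := by
  obtain ⟨n1, n2, n3⟩ := fin_three_ne i
  rw [L.coef_tri n1 n3 n2.symm]
  have hU : FootIn d j' r' (C.U (i, false)) := FootIn.of_coef (fun a ha => F.mem_U (Or.inr ha)) h
  have hβ := F.coef_eq j' r'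
  rw [coef_append, F.coef_before hd h, (zmod_two_cases _).resolve_left h, zero_add] at hβ
  have hs := F.sep j' r' h
  have ne : ∀ (s : Bool), (i + 1, s) ≠ (i, false) ∧ (i + 2, s) ≠ (i, false) ∧
      (i + 1, s) ≠ (i, true) ∧ (i + 2, s) ≠ (i, true) := by
    intro s; simp [n1.symm, n2.symm]
  have N : ∀ s t, (L.lb j' r' (i, false) (i + 1, s) + L.lb j' r' (i, false) (i + 2, t)) *
      wCoef (L.lb j' (!r')) (C.eb j' (!r')) (i, true) (i + 1, !s) (i + 2, !t) = 0 := by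
    intro s t
    rw [← L.wCoef_of_U hd hU (ne s).1 (ne t).2.1]
    exact L.tri_mul_tri hd n1 n3 n2.symm rfl rfl rfl j' r'
  have N1 := N (!c) b
  have N2 := N (!c) (!b)
  have N3 := N c b
  simp only [Bool.not_not] at N1 N2 N3
  unfold Compl
  rw [hs, one_mul] at N2
  generalize L.lb j' r' (i, false) (i + 1, c) = x1 at *
  generalize L.lb j' r' (i, false) (i + 1, !c) = x2 at *
  generalize L.lb j' r' (i, false) (i + 2, b) = x3 at *
  generalize L.lb j' r' (i, false) (i + 2, !b) = x4 at *
  -- If the sum is `1`, then `(j', r')` is not complementary and `N1` says that the triangle is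
  -- even.
  rcases zmod_two_cases (x2 + x3) with h0 | h0
  swap
  · rw [h0, one_mul] at N1
    rw [N1, if_neg]
    rintro ⟨-, h1, -⟩
    rw [h1] at h0
    exact zero_ne_one h0
  have h13 : x1 + x3 = 1 := by
    linear_combination -hβ + h0 - zmod_self_add x2
  rw [h13, one_mul] at N3
  rcases L.bits_cases hd j' (!r') with ⟨v, hv, hl, hE⟩ | ⟨v, w, hvw, hF, hl, hE⟩ | ⟨hl, hE⟩
  · by_cases hvA : v = (i, true)
    · subst hvA
      rw [L.wCoef_of_U hd hv (ne _).2.2.1 (ne _).2.2.2] at N2 N3 ⊢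
      generalize L.lb j' (!r') (i, true) (i + 1, c) = y1 at *
      generalize L.lb j' (!r') (i, true) (i + 1, !c) = y2 at *
      generalize L.lb j' (!r') (i, true) (i + 2, b) = y3 at *
      generalize L.lb j' (!r') (i, true) (i + 2, !b) = y4 at *
      simp only [← hβ, h0, hs, true_and]
      clear * - N2 N3
      rcases zmod_two_cases y1 with rfl | rfl <;> rcases zmod_two_cases y2 with rfl | rfl <;>
      rcases zmod_two_cases y3 with rfl | rfl <;> rcases zmod_two_cases y4 with rfl | rfl <;>
      revert N2 N3 <;> decide
    · rw [if_neg]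
      swap
      · rintro ⟨-, -, -, h1, -⟩
        rw [hl _ _ (Ne.symm hvA), hl _ _ (Ne.symm hvA)] at h1
        simp at h1
      by_cases hv1 : v = (i + 1, c)
      · subst hv1
        exact (F.not_joined hd h (U_subset_reg (by simp) hv.2)).elim
      · by_cases hv2 : v = (i + 2, !b)
        · subst hv2
          exact (F.not_joined hd h (U_subset_reg (by simp) hv.2)).elim
        · simp [wCoef, eCoef, hE, hl _ _ (Ne.symm hvA), hl _ _ (Ne.symm hv1), hl _ _ (Ne.symm hv2)]
  · rw [if_neg]
    swap
    · rintro ⟨-, -, -, h1, -⟩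
      rw [hl, hl] at h1
      simp at h1
    have rule : ∀ x y x' y', C.eb j' (!r') x y ≠ 0 →
        ¬ ((x' = x ∧ y' = y) ∨ (x' = y ∧ y' = x)) → C.eb j' (!r') x' y' = 0 := by
      intro x y x' y' h1 h2
      apply hE
      intro h3
      have h4 : (x = v ∧ y = w) ∨ (x = w ∧ y = v) := by
        by_contra h4; exact h1 (hE _ _ h4)
      rcases h3 with ⟨rfl, rfl⟩ | ⟨rfl, rfl⟩ <;> rcases h4 with ⟨rfl, rfl⟩ | ⟨rfl, rfl⟩ <;>
        simp at h2
    simp only [wCoef, eCoef, hl, zero_add] at N2 N3 ⊢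
    have h1 : C.eb j' (!r') (i, true) (i + 1, c) = 0 := by
      by_contra h1
      rw [rule _ _ (i + 1, c) (i + 2, b) h1 (by simp [n1.symm, n2.symm, n3.symm]),
        rule _ _ (i + 2, b) (i, true) h1 (by simp [n1, n2.symm, n3.symm])] at N2
      exact h1 (by simpa using N2)
    have h2 : C.eb j' (!r') (i + 2, !b) (i, true) = 0 := by
      by_contra h1
      rw [rule _ _ (i, true) (i + 1, !c) h1 (by simp [n2, n3, n1.symm]),
        rule _ _ (i + 1, !c) (i + 2, !b) h1 (by simp [n3, n1.symm, n2.symm])] at N3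
      exact h1 (by simpa using N3)
    rw [h1, h2]
    by_contra h3
    have h4 : C.eb j' (!r') (i + 1, c) (i + 2, !b) ≠ 0 := by simpa using h3
    have h5 : FootIn d j' (!r') (C.E (i + 1, c) (i + 2, !b)) := by
      by_contra hn
      exact h4 (eb_eq_zero fun _ => hn)
    exact F.not_joined hd h (E_subset_reg (by simp) (by simp) n3 h5.2)
  · rw [if_neg]
    · simp [wCoef, eCoef, hl, hE]
    · rintro ⟨-, -, -, h1, -⟩
      rw [hl, hl] at h1
      simp at h1

/-- The path runs upwards through an even number of complementary foot edges from the given one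
on. -/
theorem sum_coef (hd : 1 ≤ d) [∀ j r, Decidable (L.Compl i c b j r)] :
    ∑ j' ∈ Finset.range (2 ^ n), ∑ r',
      (if L.Compl i c b j' r' then coef d (footIdx j' r') r' (Walk.cons F.adj F.after) else 0) =
        0 := by
  obtain ⟨n1, n2, n3⟩ := fin_three_ne i
  have hdis : ∀ a ∈ ({(i, true), (i + 1, c), (i + 2, !b)} : Set Vx),
      a ∉ ({(i, false), (i + 1, !c), (i + 2, b)} : Set Vx) := by
    simp [n1, n2, n3, n1.symm, n2.symm, n3.symm]
  -- The triangle encloses neither end of this walk: one is on the bottom path, the other on an odd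
  -- edge of the opposite triangle. So they cross evenly, and by `coef_partner` exactly the
  -- complementary foot edges count.
  have key := cross_closed hd (sep_reg (C := C) hdis)
    (L.tri (i, true) (i + 1, c) (i + 2, !b)) (Walk.cons F.adj F.after)
    (fun a ha => L.mem_tri n1 n3 n2.symm ha)
    (fun a ha => U_subset_reg (v := (i, false)) (by simp) (F.mem_U (Or.inr ha)))
  rw [L.mu_tri_eq_zero hd n1 n3 n2.symm n1 n3 n2.symm hdis,
    show mu d _ (footEnd d j r) = 0 from mu_bottom _ _ _, add_zero] at key
  refine Eq.trans ?_ key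
  refine Finset.sum_congr rfl fun j' _ => ?_
  have term : ∀ r', (if L.Compl i c b j' r' then
      coef d (footIdx j' r') r' (Walk.cons F.adj F.after) else 0) =
      coef d (footIdx j' r') r' (Walk.cons F.adj F.after) *
      coef d (footIdx j' (!r')) (!r') (L.tri (i, true) (i + 1, c) (i + 2, !b)) := by
    intro r'
    by_cases h : coef d (footIdx j' r') r' (Walk.cons F.adj F.after) = 0
    · rw [h]; simp
    · rw [F.coef_partner hd h]
      split_ifs <;> simp
  rw [Fintype.sum_bool, term, term]
  simp only [footIdx, Bool.not_true, Bool.not_false, if_true, Bool.false_eq_true, if_false]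
  ring

end Upward

/-- The legs to `(i + 1, false)` are trivial, so both sides depend on the same six bits. -/
theorem chi_eq [Decidable (L.Compl i false b j r)] :
    L.chi i b j r = if L.Compl i false b j r then 1 else 0 := by
  have h1 : L.lb j r (i, false) (i + 1, false) = 0 := by
    rw [lb, if_neg (fin_three_ne i).1]; exact L.coef_ref _ _ _
  have h2 : L.lb j (!r) (i, true) (i + 1, false) = 0 := by
    rw [lb, if_neg (fin_three_ne i).1]; exact L.coef_ref _ _ _
  simp only [chi, Compl, h1, h2, zero_add, Bool.not_false]
  generalize L.lb j r (i, false) (i + 1, true) = x2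
  generalize L.lb j r (i, false) (i + 2, b) = x3
  generalize L.lb j r (i, false) (i + 2, !b) = x4
  generalize L.lb j (!r) (i, true) (i + 1, true) = y2
  generalize L.lb j (!r) (i, true) (i + 2, b) = y3
  generalize L.lb j (!r) (i, true) (i + 2, !b) = y4
  split_ifs with h
  · exact zmod_compl_true _ _ _ _ _ _ h
  · exact zmod_compl_false _ _ _ _ _ _ h

/-- The equations record only which neighbours are separated, so exchanging the neighbours on both
axes is harmless. This is what traversing the main path backwards needs. -/
theorem Compl.symm (h : L.Compl i c b j r) : L.Compl i (!c) (!b) j r := by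
  unfold Compl at h ⊢
  simp only [Bool.not_not]
  obtain ⟨h1, h2, h3, h4, h5, h6⟩ := h
  obtain ⟨h7, h8⟩ := zmod_compl_symm _ _ _ _ h1 h2 h3
  obtain ⟨h9, h10⟩ := zmod_compl_symm _ _ _ _ h4 h5 h6
  exact ⟨by rw [add_comm]; exact h1, h7, h8, by rw [add_comm]; exact h4, h9, h10⟩

end Legs

end Config

theorem exists_dart_of_walkSum {V : Type*} {G : SimpleGraph V} {φ : V → V → ZMod 2} {u v : V}
    {p : G.Walk u v} (h : walkSum φ p ≠ 0) : ∃ a ∈ p.darts, φ a.fst a.snd ≠ 0 := by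
  by_contra hn
  push Not at hn
  refine h ?_
  unfold walkSum
  rw [List.map_congr_left hn]
  simp

theorem footEdge_cases {d j : ℕ} {r : Bool} {u v : Label} (h : footEdge d (footIdx j r) r u v ≠ 0) :
    (u = footEnd d j r ∧ v = footTop d (footIdx j r) r) ∨
      (u = footTop d (footIdx j r) r ∧ v = footEnd d j r) := by
  by_contra hn
  refine h (footEdge_eq_zero_of_not ?_)
  rw [← footEnd_eq]
  tauto

theorem coef_cons (d j : ℕ) (r : Bool) {u v w : Label} (h : (full d).Adj u v)
    (p : (full d).Walk v w) :
    coef d j r (Walk.cons h p) = footEdge d j r u v + coef d j r p := walkSum_cons _ _ _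

/-- Two consecutive parts of a path share a single vertex, and a foot edge has two ends. -/
theorem coef_eq_zero_of_path {d : ℕ} (hd : 1 ≤ d) {u v w x y : Label} {p : (full d).Walk u v}
    {q : (full d).Walk v w} {p' : (full d).Walk x y} (hpq : (p.append q).IsPath)
    (hp' : ∀ a ∈ p'.support, a ∈ p.support) {j : ℕ} {r : Bool}
    (h : coef d (footIdx j r) r q ≠ 0) : coef d (footIdx j r) r p' = 0 := by
  by_contra h'
  obtain ⟨h1, h2⟩ := footEnd_mem_of_coef _ h
  obtain ⟨h3, h4⟩ := footEnd_mem_of_coef _ h'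
  exact Config.footTop_ne_footEnd hd j r ((eq_of_mem_append hpq (hp' _ h3) h1).trans
    (eq_of_mem_append hpq (hp' _ h4) h2).symm)

theorem mem_support_append_left {V : Type*} {G : SimpleGraph V} {u v w : V} (p : G.Walk u v)
    (q : G.Walk v w) : ∀ a ∈ p.support, a ∈ (p.append q).support := fun a ha => by
  rw [Walk.mem_support_append_iff]; exact Or.inl ha

/-! ### Complementary foot edges along a main path are even in number -/

namespace Config

variable {d n : ℕ} {C : Config d n}

namespace Legs

variable {L : C.Legs} {i : Fin 3} {b : Bool} {j : ℕ} {r : Bool}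

theorem lb_ref (j : ℕ) (r : Bool) (i : Fin 3) (s : Bool) :
    L.lb j r (i, s) (i + 1, false) = 0 := by
  rw [lb, if_neg (fin_three_ne i).1]; exact L.coef_ref _ _ _

theorem lb_opp (j : ℕ) (r : Bool) (i : Fin 3) (s : Bool) :
    L.lb j r (i, s) (i + 1, true) = coef d (footIdx j r) r (L.leg (i, s) (i + 1, true)) := by
  rw [lb, if_neg (fin_three_ne i).1]

/-- A leg follows the main path of its branch set up to some vertex. -/
theorem exists_split (hd : 1 ≤ d) (i : Fin 3) (s b : Bool) :
    ∃ (x : Label) (α : (full d).Walk (C.P (i, s) (i + 1, false)) x)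
      (β : (full d).Walk x (C.P (i, s) (i + 1, true))),
      L.leg (i, s) (i + 1, true) = α.append β ∧ ∀ j r,
        coef d (footIdx j r) r (L.leg (i, s) (i + 1, true)) ≠ 0 →
          L.lb j r (i, s) (i + 2, b) = coef d (footIdx j r) r α := by
  obtain ⟨x, α, β, σ, h1, h2, h3⟩ := L.split (i, s) (i + 2, b) rfl
  refine ⟨x, α, β, h1, fun j r h => ?_⟩
  rw [lb, if_neg (fin_three_ne i).2.1, h2]
  have : coef d (footIdx j r) r σ = 0 := by
    by_contra h'
    obtain ⟨a1, a2⟩ := footEnd_mem_of_coef _ h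
    obtain ⟨a3, a4⟩ := footEnd_mem_of_coef _ h'
    exact footTop_ne_footEnd hd j r ((h3 _ a3 a1).trans (h3 _ a4 a2).symm)
  rw [coef_append, this, add_zero]

theorem Compl.bits (h : L.Compl i false b j r) :
    coef d (footIdx j r) r (L.leg (i, false) (i + 1, true)) = 1 ∧
      L.lb j r (i, false) (i + 2, b) = 1 ∧ L.lb j r (i, false) (i + 2, !b) = 0 := by
  obtain ⟨h1, h2, h3, -⟩ := h
  simp only [Bool.not_false] at h1 h2 h3
  rw [lb_ref, zero_add, lb_opp] at h1
  rw [lb_opp, h1] at h2 h3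
  refine ⟨h1, ?_, ?_⟩
  · linear_combination h2 - zmod_self_add 1
  · linear_combination h3

/-- The foot edge at the beginning of the second part of a path occurs once. -/
theorem coef_cons_path {s t v : Label} {h : (full d).Adj s t} {ρ : (full d).Walk t v}
    (hρ : (Walk.cons h ρ).IsPath) (hst : footEdge d (footIdx j r) r s t = 1) :
    coef d (footIdx j r) r (Walk.cons h ρ) = 1 := by
  rw [coef_cons, hst]
  have : coef d (footIdx j r) r ρ = 0 := by
    by_contra hn
    obtain ⟨h1, h2⟩ := footEnd_mem_of_coef _ hn
    rw [Walk.cons_isPath_iff] at hρ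
    rcases footEdge_cases (by rw [hst]; exact one_ne_zero) with ⟨rfl, -⟩ | ⟨rfl, -⟩
    · exact hρ.2 h2
    · exact hρ.2 h1
  rw [this, add_zero]

/-- Look at the first complementary foot edge of the main path. If the path climbs it,
`Upward.sum_coef` counts this edge and all later complementary ones, which are thus even in number.
If the path descends it, the reversed initial part would contain exactly one complementary foot
edge, against the same lemma. -/
theorem sum_chi (hd : 1 ≤ d) (L : C.Legs) (i : Fin 3) (b : Bool) :
    ∑ j ∈ Finset.range (2 ^ n), ∑ r, L.chi i b j r = 0 := by
  classical
  have hπ : (L.leg (i, false) (i + 1, true)).IsPath := L.isPath (i, false)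
  rcases exists_first_step (u := C.P (i, false) (i + 1, false)) (fun u v => ∃ j r, j < 2 ^ n ∧ L.Compl i false b j r ∧
    footEdge d (footIdx j r) r u v ≠ 0) (L.leg (i, false) (i + 1, true)) with
      h | ⟨s, t, hst, π, ρ, he, ⟨j, r, hj, hc, hf⟩, hfirst⟩
  · refine Finset.sum_eq_zero fun j hj => Finset.sum_eq_zero fun r _ => ?_
    rw [chi_eq]
    refine if_neg fun hc => ?_
    obtain ⟨a, ha, h'⟩ := exists_dart_of_walkSum (φ := footEdge d (footIdx j r) r)
      (by rw [← coef, hc.bits.1]; exact one_ne_zero)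
    exact h a ha ⟨j, r, Finset.mem_range.1 hj, hc, h'⟩
  · have hπ' : ∀ j' r', j' < 2 ^ n → L.Compl i false b j' r' → coef d (footIdx j' r') r' π = 0 := by
      intro j' r' hj' hc'
      by_contra hn
      obtain ⟨a, ha, h'⟩ := exists_dart_of_walkSum hn
      exact hfirst a ha ⟨j', r', hj', hc', h'⟩
    have hst1 := (zmod_two_cases _).resolve_left hf
    have hmem : ∀ a ∈ (π.append (Walk.cons hst ρ)).support, a ∈ C.U (i, false) := by
      rw [← he]; exact L.mem (i, false) (i + 1, true) (fin_three_ne i).1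
    have hcoef : ∀ j' r', coef d (footIdx j' r') r' (π.append (Walk.cons hst ρ)) =
        L.lb j' r' (i, false) (i + 1, true) := by
      intro j' r'; rw [← he, lb_opp]
    have hpath : (π.append (Walk.cons hst ρ)).IsPath := he ▸ hπ
    have hself := coef_cons_path hpath.of_append_right hst1
    rcases footEdge_cases hf with ⟨rfl, rfl⟩ | ⟨rfl, rfl⟩
    · let F : L.Upward i false b j r :=
        { before := π
          after := ρ
          adj := hst
          isPath := hpath
          mem := hmem
          coef_eq := fun j' r' => by rw [hcoef, lb_ref, zero_add]; rfl
          compl := hc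
          sep := by
            intro j' r' h
            have h1 : coef d (footIdx j' r') r' (L.leg (i, false) (i + 1, true)) = 1 := by
              rw [he, coef_append, coef_eq_zero_of_path hd hpath (fun a ha => ha) h, zero_add]
              exact (zmod_two_cases _).resolve_left h
            obtain ⟨x, α, β, e, hα⟩ := L.exists_split hd i false (!b)
            have h2 : coef d (footIdx j' r') r' α = 0 := by
              rcases append_eq_append α β π hst ρ (e.symm.trans he) with ⟨γ, rfl, -⟩ | ⟨γ, rfl, rfl⟩
              · exact coef_eq_zero_of_path hd hpath (mem_support_append_left α γ) h
              -- A leg branching off later would contain the foot edge `(j, r)`, while by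
              -- `Compl.bits` its bit there is `0`.
              · exfalso
                have h3 := hα j r (by rw [hc.bits.1]; exact one_ne_zero)
                rw [hc.bits.2.2, coef_append, hπ' j r hj hc, zero_add, coef_cons_path ?_ hst1] at h3
                · exact zero_ne_one h3
                · have := hpath.of_append_right
                  rw [← Walk.cons_append] at this
                  exact this.of_append_left
            rw [hα j' r' (by rw [h1]; exact one_ne_zero), h2, add_zero]
            exact (lb_opp _ _ _ _).trans h1 }
      rw [← F.sum_coef hd]
      refine Finset.sum_congr rfl fun j' hj' => Finset.sum_congr rfl fun r' _ => ?_
      rw [chi_eq]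
      split_ifs with h
      · have := hcoef j' r'
        rw [coef_append, hπ' j' r' (Finset.mem_range.1 hj') h, zero_add, lb_opp, h.bits.1] at this
        exact this.symm
      · rfl
    · exfalso
      have hrev : ρ.reverse.append (Walk.cons hst.symm π.reverse) =
          (π.append (Walk.cons hst ρ)).reverse := by
        rw [Walk.reverse_append, Walk.reverse_cons, ← Walk.append_assoc]
        rfl
      have hpath' : (ρ.reverse.append (Walk.cons hst.symm π.reverse)).IsPath := by
        rw [hrev]; exact hpath.reverse
      have hmem' : ∀ a ∈ (ρ.reverse.append (Walk.cons hst.symm π.reverse)).support,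
          a ∈ C.U (i, false) := by
        rw [hrev]
        intro a ha
        exact hmem a (by rwa [Walk.support_reverse, List.mem_reverse] at ha)
      have hcoef' : ∀ j' r', coef d (footIdx j' r') r'
          (ρ.reverse.append (Walk.cons hst.symm π.reverse)) =
            L.lb j' r' (i, false) (i + 1, true) + L.lb j' r' (i, false) (i + 1, false) := by
        intro j' r'
        rw [hrev, coef_reverse, hcoef, lb_ref, add_zero]
      have hsep : ∀ j' r', coef d (footIdx j' r') r' (Walk.cons hst.symm π.reverse) ≠ 0 →
          L.lb j' r' (i, false) (i + 1, false) + L.lb j' r' (i, false) (i + 2, b) = 1 := by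
        intro j' r' h
        have h0 : coef d (footIdx j' r') r' (Walk.cons hst.symm π.reverse) = 1 :=
          (zmod_two_cases _).resolve_left h
        have h1 : coef d (footIdx j' r') r' (L.leg (i, false) (i + 1, true)) = 1 := by
          rw [he, ← coef_reverse, ← hrev, coef_append,
            coef_eq_zero_of_path hd hpath' (fun a ha => ha) h, zero_add, h0]
        obtain ⟨x, α, β, e, hα⟩ := L.exists_split hd i false b
        have h2 : coef d (footIdx j' r') r' α = 1 := by
          rcases append_eq_append α β π hst ρ (e.symm.trans he) with ⟨γ, rfl, -⟩ | ⟨γ, rfl, rfl⟩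
          -- A leg branching off earlier would miss the foot edge `(j, r)`, while by `Compl.bits`
          -- its bit there is `1`.
          · exfalso
            have h3 := hα j r (by rw [hc.bits.1]; exact one_ne_zero)
            have h5 := coef_eq_zero_of_path hd (p' := α) hpath (mem_support_append_left α γ)
              (j := j) (r := r) (by rw [hself]; exact one_ne_zero)
            rw [hc.bits.2.1, h5] at h3
            exact one_ne_zero h3
          · have h3 : coef d (footIdx j' r') r' γ = 0 := by
              refine coef_eq_zero_of_path hd hpath' (fun a ha => ?_) h
              rw [Walk.support_reverse, List.mem_reverse]
              exact mem_support_append_left γ β a ha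
            rw [coef_cons, coef_reverse, footEdge_comm] at h0
            rw [coef_append, coef_cons, h3, add_zero, add_comm]
            exact h0
        have h3 := hα j' r' (by rw [h1]; exact one_ne_zero)
        rw [h2] at h3
        rw [lb_ref, h3, zero_add]
      let F : L.Upward i true (!b) j r :=
        { before := ρ.reverse
          after := π.reverse
          adj := hst.symm
          isPath := hpath'
          mem := hmem'
          coef_eq := hcoef'
          compl := hc.symm
          sep := fun j' r' h => by rw [Bool.not_not]; exact hsep j' r' h }
      -- `after` is the reversed part before the first complementary foot edge, so `(j, r)` is the
      -- only one counted and the even sum would be `1`.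
      have hzero : ∀ j' r', j' < 2 ^ n → ¬ (j' = j ∧ r' = r) → L.Compl i true (!b) j' r' →
          coef d (footIdx j' r') r' (Walk.cons F.adj F.after) = 0 := by
        intro j' r' hj' hne hc'
        have hc' := hc'.symm
        simp only [Bool.not_true, Bool.not_not] at hc'
        refine (coef_cons _ _ _ _ _).trans ?_
        rw [show coef d (footIdx j' r') r' F.after = 0 from
          (coef_reverse _ _ _ _).trans (hπ' j' r' hj' hc'), add_zero]
        by_contra hn
        rcases footEdge_cases hn with ⟨h, -⟩ | ⟨h, -⟩
        · have := footEnd_injective hd h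
          exact hne ⟨this.1.symm, this.2.symm⟩
        · exact footTop_ne_bottom hd _ _ _ h.symm
      have h0 := F.sum_coef hd
      rw [Finset.sum_eq_single j, Finset.sum_eq_single r, if_pos F.compl, F.coef_self] at h0
      · exact one_ne_zero h0
      · intro r' _ hr'
        exact ite_eq_right_iff.2 fun h => hzero j r' hj (fun h => hr' h.2) h
      · simp
      · intro j' hj' hne
        exact Finset.sum_eq_zero fun r' _ => ite_eq_right_iff.2 fun h =>
          hzero j' r' (Finset.mem_range.1 hj') (fun h => hne h.1) h
      · intro hn
        exact absurd (Finset.mem_range.2 hj) hn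

theorem false_of_legs (hd : 1 ≤ d) (L : C.Legs) : False := by
  obtain ⟨i, b, h⟩ := L.exists_chi_sum hd
  exact h (L.sum_chi hd i b)

end Legs

end Config

/-! ### Construction of the legs -/

namespace Config

variable {d n : ℕ} (C : Config d n)

theorem exists_walk {v w : Vx} {a b : Label} (ha : a ∈ C.U v) (hb : b ∈ C.U w) :
    Nonempty ((full d).Walk a b) := by
  have key : ∀ {v w : Vx} {a b : Label}, v.1 ≠ w.1 → a ∈ C.U v → b ∈ C.U w →
      Nonempty ((full d).Walk a b) := by
    intro v w a b h ha hb
    obtain ⟨p, -⟩ := (reach_reg (C := C) h (U_subset_reg (by simp) hb) ha).exists_walk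
    exact ⟨p.reverse⟩
  by_cases h : v.1 = w.1
  · obtain ⟨p⟩ := key v.ref_ne ha (C.mem v.ref v v.ref_ne.symm)
    obtain ⟨q⟩ := key (by rw [← h]; exact v.ref_ne.symm) (C.mem v.ref v v.ref_ne.symm) hb
    exact ⟨p.append q⟩
  · exact key h ha hb

theorem exists_legs : Nonempty C.Legs := by
  classical
  have hπ : ∀ v, ∃ π : (full d).Walk (C.P v v.ref) (C.P v v.opp), π.IsPath ∧
      ∀ a ∈ π.support, a ∈ C.U v := by
    intro v
    obtain ⟨p, hp⟩ := (C.reach v _ (C.mem v v.ref v.ref_ne) _ (C.mem v v.opp v.opp_ne)).exists_walk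
    exact ⟨p.bypass, p.bypass_isPath, fun a ha => hp a (p.support_bypass_subset_support ha)⟩
  choose π hπ1 hπ2 using hπ
  have hleg : ∀ v w, ∃ l : (full d).Walk (C.P v v.ref) (C.P v w),
      (v.1 ≠ w.1 → ∀ a ∈ l.support, a ∈ C.U v) ∧ (w = v.ref → l.length = 0) ∧
      (∀ h : w = v.opp, l = (π v).copy rfl (by rw [h])) ∧
      (w.1 = v.1 + 2 → ∃ (x : Label) (α : (full d).Walk (C.P v v.ref) x)
        (β : (full d).Walk x (C.P v v.opp)) (σ : (full d).Walk x (C.P v w)),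
        π v = α.append β ∧ l = α.append σ ∧ ∀ a ∈ σ.support, a ∈ (π v).support → a = x) := by
    intro v w
    obtain ⟨n1, n2, n3⟩ := fin_three_ne v.1
    by_cases h1 : w = v.ref
    · subst h1
      refine ⟨Walk.nil, ?_, fun _ => rfl, ?_, fun h => absurd h n3⟩
      · intro h a ha
        rw [Walk.support_nil, List.mem_singleton] at ha
        rw [ha]; exact C.mem _ _ h
      · intro h
        simp at h
    · by_cases h2 : w = v.opp
      · subst h2
        exact ⟨π v, fun _ => hπ2 v, fun h => absurd h h1, fun _ => rfl, fun h => absurd h n3⟩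
      · by_cases h3 : w.1 = v.1 + 2
        · have hvw : v.1 ≠ w.1 := h3 ▸ n2
          obtain ⟨p, hp⟩ :=
            (C.reach v _ (C.mem v w hvw) _ (C.mem v v.ref v.ref_ne)).exists_walk
          -- The walk starts at `P v w`, so its first vertex on the main path can serve as the
          -- branching vertex of the leg.
          obtain ⟨x, hx, q, hq1, hq2⟩ := exists_walk_first {a | a ∈ (π v).support} p
            (Walk.start_mem_support _)
          refine ⟨((π v).takeUntil x hx).append q.reverse, ?_, fun h => absurd h h1,
            fun h => absurd h h2, fun _ => ⟨x, (π v).takeUntil x hx, (π v).dropUntil x hx, q.reverse,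
              ((π v).take_spec hx).symm, rfl, ?_⟩⟩
          · intro _ a ha
            rw [Walk.mem_support_append_iff, Walk.support_reverse, List.mem_reverse] at ha
            rcases ha with ha | ha
            · exact hπ2 v a ((π v).support_takeUntil_subset_support hx ha)
            · exact hp a (hq1 a ha)
          · intro a ha ha'
            rw [Walk.support_reverse, List.mem_reverse] at ha
            exact hq2 a ha ha'
        · have h4 : v.1 = w.1 := by
            obtain ⟨i, s⟩ := v
            obtain ⟨j, t⟩ := w
            revert h1 h2 h3
            revert i s j t
            decide
          obtain ⟨p⟩ := C.exists_walk (C.mem v v.ref v.ref_ne)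
            (C.mem (0, false) (1, false) (by decide))
          exact ⟨p.copy rfl (C.diag v w h4).symm, fun h => absurd h4 h, fun h => absurd h h1,
            fun h => absurd h h2, fun h => absurd h h3⟩
  choose leg hl1 hl2 hl3 hl4 using hleg
  have hopp : ∀ v : Vx, leg v v.opp = π v := fun v => hl3 v v.opp rfl
  refine ⟨⟨leg, hl1, fun v => hl2 v _ rfl, fun v => by rw [hopp]; exact hπ1 v, fun v w h => ?_⟩⟩
  rw [hopp]
  exact hl4 v w h

theorem isEmpty (hd : 1 ≤ d) : IsEmpty (Config d n) :=
  ⟨fun C => C.exists_legs.elim fun L => L.false_of_legs hd⟩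

end Config

/-! ### Models in NSS graphs -/

theorem vertexSet_subset_trig (n d : ℕ) : vertexSet (n + 1) d ⊆ trig d n 0 := by
  intro v hv
  cases v with
  | tree h i =>
    obtain ⟨h1, h2, h3⟩ : 1 ≤ h ∧ h ≤ n + 1 ∧ i < 2 ^ (n + 1 - h) := hv
    obtain ⟨l, rfl⟩ : ∃ l, h = l + 1 := ⟨h - 1, by omega⟩
    rw [Nat.add_sub_add_right] at h3
    exact ⟨l, rfl, by omega, Nat.div_eq_of_lt h3⟩
  | bottom p =>
    have h : p ≤ (2 ^ (n + 1) + 1) * d := hv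
    exact ⟨by simp, h.trans_eq (by ring)⟩
  | leg i r t =>
    have h : i < 2 ^ n ∧ 0 < t ∧ t < d := hv
    exact Nat.div_eq_of_lt h.1

theorem Link.nLink {k d : ℕ} {u v : Label} (h : Link d u v) (hu : u ∈ vertexSet k d) :
    NLink d u v := by
  cases h with
  | tree h i =>
    obtain ⟨l, rfl⟩ : ∃ l, h = l + 1 := ⟨h - 1, by have := hu.1; omega⟩
    exact NLink.tree l i
  | bottom p => exact NLink.bottom p
  | leg i r t ht =>
    by_cases h : t + 1 < d
    · have : legPoint d i r (t + 1) = Label.leg i r (t + 1) := by simp [legPoint, h]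
      rw [this]
      exact NLink.leg i r t h
    · obtain rfl : d = t + 1 := by omega
      have : legPoint (t + 1) i r (t + 1) = Label.bottom (footPos i r * (t + 1)) := by
        simp [legPoint, footPos]
      rw [this]
      exact NLink.foot i r

/-- The embedding of an NSS graph into the infinite NSS graph. -/
def inclusion {k d : ℕ} (hd : 1 ≤ d) : graph k d →g full d where
  toFun := Subtype.val
  map_rel' {a b} h := by
    have h2 : Link d a b ∨ Link d b a := h.2
    exact (full_adj hd).2 (h2.imp (fun h => h.nLink a.2) fun h => h.nLink b.2)

/-- A common vertex, a parent and child, or two siblings would give walks of length `0`, `1` or `2`,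
so distance at least three is all that is needed. -/
theorem apart_of_farApart {k d : ℕ} {A B : Set (vertexSet k d)}
    (h : FatMinor.FarApart (graph k d) 9 A B) :
    Apart (Subtype.val '' A) (Subtype.val '' B) := by
  have near : ∀ a ∈ A, ∀ b ∈ B, ∀ p : (graph k d).Walk a b, p.length ≤ 2 → False := by
    intro a ha b hb p hp
    have h1 := (h a ha b hb).trans p.edist_le
    have h2 : 9 ≤ p.length := by exact_mod_cast h1
    omega
  have adj : ∀ a b : vertexSet k d, Link d a b → (graph k d).Adj a b := fun a b h =>
    ⟨fun e => h.ne (congrArg Subtype.val e), Or.inl h⟩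
  refine ⟨?_, ?_, ?_, ?_⟩
  · rintro _ ⟨a, ha, rfl⟩ ⟨b, hb, e⟩
    obtain rfl := Subtype.ext e
    exact near b ha b hb Walk.nil (by simp)
  · rintro l i ⟨a, ha, ea⟩ ⟨b, hb, eb⟩
    exact near a ha b hb (adj a b (ea ▸ eb ▸ Link.tree (l + 1) i)).toWalk (by simp)
  · rintro l i ⟨b, hb, eb⟩ ⟨a, ha, ea⟩
    exact near a ha b hb (adj b a (ea ▸ eb ▸ Link.tree (l + 1) i)).symm.toWalk (by simp)
  · rintro l i e he ⟨a, ha, ea⟩ ⟨b, hb, eb⟩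
    have ha' : 1 ≤ l ∧ l ≤ k ∧ 2 * i + e < 2 ^ (k - l) := by have := a.2; rwa [ea] at this
    have hb' : 1 ≤ l ∧ l ≤ k ∧ 2 * i + (1 - e) < 2 ^ (k - l) := by have := b.2; rwa [eb] at this
    -- At the top level there is only one tree vertex, so the parent of two siblings belongs to the
    -- graph.
    have hlt : l < k := by
      by_contra hn
      have : k - l = 0 := by omega
      rw [this] at ha' hb'
      omega
    have hc : tree (l + 1) i ∈ vertexSet k d := by
      have : k - l = k - (l + 1) + 1 := by omega
      rw [this, pow_succ] at ha'
      exact ⟨by omega, hlt, by omega⟩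
    have e1 : (2 * i + e) / 2 = i := by omega
    have e2 : (2 * i + (1 - e)) / 2 = i := by omega
    have l1 := Link.tree (d := d) l (2 * i + e)
    have l2 := Link.tree (d := d) l (2 * i + (1 - e))
    rw [e1, ← ea] at l1
    rw [e2, ← eb] at l2
    exact near a ha b hb (Walk.cons (adj a ⟨_, hc⟩ l1) (adj b ⟨_, hc⟩ l2).symm.toWalk) (by simp)

/-- Walks chosen for ordered pairs of adjacent vertices, symmetrically. -/
theorem exists_symm_walks {V : Type*} {G : SimpleGraph V}
    (Q : Vx → Vx → ∀ {x y : V}, G.Walk x y → Prop)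
    (hs : ∀ v w {x y : V} (p : G.Walk x y), Q v w p → Q w v p.reverse)
    (H : ∀ v w : Vx, v.1 ≠ w.1 → ∃ (x y : V) (p : G.Walk x y), Q v w p) :
    ∃ (P : Vx → Vx → V) (path : ∀ v w, G.Walk (P v w) (P w v)),
      (∀ v w, path w v = (path v w).reverse) ∧ (∀ v w, v.1 ≠ w.1 → Q v w (path v w)) ∧
      ∀ v w, v.1 = w.1 → P v w = P (0, false) (1, false) := by
  have H' : ∀ v w : Vx, ∃ g : Σ x y : V, G.Walk x y, v.1 ≠ w.1 → Q v w g.2.2 := by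
    intro v w
    by_cases h : v.1 = w.1
    · obtain ⟨x, y, p, -⟩ := H (0, false) (1, false) (by decide)
      exact ⟨⟨x, y, p⟩, fun h' => absurd h h'⟩
    · obtain ⟨x, y, p, hp⟩ := H v w h
      exact ⟨⟨x, y, p⟩, fun _ => hp⟩
  choose F hF using H'
  let rev : (Σ x y : V, G.Walk x y) → Σ x y : V, G.Walk x y := fun g => ⟨g.2.1, g.1, g.2.2.reverse⟩
  have hrev : ∀ g, rev (rev g) = g := by
    rintro ⟨x, y, p⟩
    simp [rev]
  let x₀ := (F (0, false) (1, false)).1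
  -- For each pair the walk is chosen in the cyclic direction of `Fin 3` and reversed for the other,
  -- which makes the symmetry an equality. Pairs on the same axis get a constant trivial walk.
  let g : Vx → Vx → Σ x y : V, G.Walk x y := fun v w =>
    if w.1 = v.1 + 1 then F v w else if v.1 = w.1 + 1 then rev (F w v) else ⟨x₀, x₀, Walk.nil⟩
  have cyc : ∀ a b : Fin 3, a = b + 1 → ¬ b = a + 1 := by decide
  have cyc' : ∀ a b : Fin 3, a ≠ b → ¬ b = a + 1 → a = b + 1 := by decide
  have hg : ∀ v w, g w v = rev (g v w) := by
    intro v w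
    by_cases h1 : w.1 = v.1 + 1
    · simp only [g, if_pos h1, if_neg (cyc _ _ h1)]
    · by_cases h2 : v.1 = w.1 + 1
      · simp only [g, if_pos h2, if_neg h1, hrev]
      · simp only [g, if_neg h1, if_neg h2]
        rfl
  have hgQ : ∀ v w, v.1 ≠ w.1 → Q v w (g v w).2.2 := by
    intro v w h
    by_cases h1 : w.1 = v.1 + 1
    · rw [show g v w = F v w from if_pos h1]
      exact hF v w h
    · rw [show g v w = rev (F w v) from (if_neg h1).trans (if_pos (cyc' _ _ h h1))]
      exact hs _ _ _ (hF w v h.symm)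
  have hend : ∀ v w, (g v w).2.1 = (g w v).1 := fun v w => by rw [hg v w]
  have hcopy : ∀ v w {x y y' : V} (p : G.Walk x y) (h : y = y'), Q v w p → Q v w (p.copy rfl h) := by
    intro v w x y y' p h hp
    subst h
    exact hp
  have hsym : ∀ (A B : Σ x y : V, G.Walk x y) (_ : B = rev A) (h1 : A.2.1 = B.1) (h2 : B.2.1 = A.1),
      B.2.2.copy rfl h2 = (A.2.2.copy rfl h1).reverse := by
    rintro A _ rfl h1 h2
    rfl
  refine ⟨fun v w => (g v w).1, fun v w => (g v w).2.2.copy rfl (hend v w),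
    fun v w => hsym _ _ (hg v w) _ _, fun v w h => hcopy _ _ _ _ (hgQ v w h), fun v w h => ?_⟩
  have h1 : ∀ a : Fin 3, ¬ a = a + 1 := by decide
  simp only [g, h, if_neg (h1 _)]
  rfl

/-- The octahedron. -/
abbrev octahedron : SimpleGraph (Σ _ : Fin 3, Fin 2) := completeMultipartiteGraph fun _ => Fin 2

/-- The vertices of the octahedron as pairs. -/
def Vx.toSigma (v : Vx) : Σ _ : Fin 3, Fin 2 := ⟨v.1, if v.2 then 1 else 0⟩

theorem Vx.toSigma_injective : Function.Injective Vx.toSigma := by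
  rintro ⟨i, b⟩ ⟨j, c⟩ h
  revert i b j c
  unfold Vx.toSigma
  decide

def Vx.edge (v w : Vx) (h : v.1 ≠ w.1) : octahedron.edgeSet := ⟨s(v.toSigma, w.toSigma), h⟩

theorem nonempty_config {n d : ℕ} (hd : 1 ≤ d) (M : FatMinor.Model octahedron (graph (n + 1) d))
    (hM : M.IsFat 9) : Nonempty (Config d n) := by
  obtain ⟨f1, f2, f3⟩ := hM
  let U : Vx → Set Label := fun v => Subtype.val '' M.branchSet v.toSigma
  let Q : Vx → Vx → ∀ {x y : Label}, (full d).Walk x y → Prop := fun v w x y p =>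
    p.IsPath ∧ (∀ a ∈ p.support, a ∈ U v ↔ a = x) ∧ (∀ a ∈ p.support, a ∈ U w ↔ a = y) ∧
      ∀ h : v.1 ≠ w.1, {a | a ∈ p.support} = Subtype.val '' M.pathSet (v.edge w h)
  have hsub : ∀ v (a : vertexSet (n + 1) d), (a : Label) ∈ U v ↔ a ∈ M.branchSet v.toSigma := by
    intro v a
    exact Subtype.val_injective.mem_set_image
  have hsymm : ∀ v w {x y : Label} (p : (full d).Walk x y), Q v w p → Q w v p.reverse := by
    intro v w x y p ⟨h1, h2, h3, h4⟩
    refine ⟨h1.reverse, by simpa using h3, by simpa using h2, fun h => ?_⟩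
    have e : w.edge v h = v.edge w h.symm := Subtype.ext Sym2.eq_swap
    rw [e, ← h4]
    simp
  obtain ⟨P, path, p1, p2, p3⟩ := exists_symm_walks Q hsymm (by
    intro v w h
    have hmap : ∀ {a b : vertexSet (n + 1) d} (p : (graph (n + 1) d).Walk a b) (v w : Vx),
        FatMinor.IsSetPath (M.branchSet v.toSigma) (M.branchSet w.toSigma) p →
        (∀ h : v.1 ≠ w.1, {a | a ∈ p.support} = M.pathSet (v.edge w h)) →
        Q v w (p.map (inclusion hd)) := by
      intro a b p v w ⟨h1, h2, h3⟩ h4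
      refine ⟨h1.map Subtype.val_injective, ?_, ?_, fun h => ?_⟩
      · intro x hx
        rw [Walk.support_map, List.mem_map] at hx
        obtain ⟨y, hy, rfl⟩ := hx
        exact (hsub v y).trans ((h2 y hy).trans Subtype.val_injective.eq_iff.symm)
      · intro x hx
        rw [Walk.support_map, List.mem_map] at hx
        obtain ⟨y, hy, rfl⟩ := hx
        exact (hsub w y).trans ((h3 y hy).trans Subtype.val_injective.eq_iff.symm)
      · rw [← h4 h, Walk.support_map]
        ext x
        simp only [Set.mem_ofPred_eq, List.mem_map, Set.mem_image]
        rfl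
    obtain ⟨x, y, he, hp⟩ := M.joins (v.edge w h)
    -- The model leaves the orientation of each branch path open, so the walk may have to be
    -- reversed.
    rcases Sym2.eq_iff.1 he with ⟨rfl, rfl⟩ | ⟨rfl, rfl⟩
    · exact ⟨_, _, _, hmap _ v w hp fun _ => rfl⟩
    · have := hmap _ w v hp fun h' => by
        have e : w.edge v h' = v.edge w h := Subtype.ext Sym2.eq_swap
        rw [e]; rfl
      exact ⟨_, _, _, hsymm _ _ _ this⟩)
  have hE : ∀ v w (h : v.1 ≠ w.1), {a | a ∈ (path v w).support} =
      Subtype.val '' M.pathSet (v.edge w h) := fun v w h => (p2 v w h).2.2.2 h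
  have hne : ∀ {v w : Vx}, v ≠ w → v.toSigma ≠ w.toSigma := fun h e => h (Vx.toSigma_injective e)
  refine ⟨⟨U, P, path, p1, ?_, p3, ?_, ?_, ?_, ?_, ?_, ?_, ?_, ?_⟩⟩
  · intro v w h
    exact ((p2 v w h).2.1 _ (Walk.start_mem_support _)).2 rfl
  · exact fun v w h => (p2 v w h).1
  · exact fun v w h a ha ha' => ((p2 v w h).2.1 a ha).1 ha'
  · rintro v _ ⟨a, ha, rfl⟩ _ ⟨b, hb, rfl⟩
    obtain ⟨p⟩ := (M.connected v.toSigma).preconnected ⟨a, ha⟩ ⟨b, hb⟩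
    let q := (p.map (Embedding.induce _).toHom).map (inclusion hd)
    have hq : ∀ x ∈ q.support, x ∈ U v := by
      intro x hx
      rw [Walk.support_map, List.mem_map] at hx
      obtain ⟨y, hy, rfl⟩ := hx
      rw [Walk.support_map, List.mem_map] at hy
      obtain ⟨z, -, rfl⟩ := hy
      exact ⟨z, z.2, rfl⟩
    exact Reach.of_walk q hq
  · rintro v _ ⟨a, -, rfl⟩
    exact vertexSet_subset_trig n d a.2
  · intro v w h a ha
    have : a ∈ Subtype.val '' M.pathSet (v.edge w h) := by rw [← hE v w h]; exact ha
    obtain ⟨b, -, rfl⟩ := this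
    exact vertexSet_subset_trig n d b.2
  · exact fun v w h => apart_of_farApart (f1 _ _ (hne h))
  · intro v w x h h1 h2
    rw [hE v w h]
    refine apart_of_farApart (f3 _ _ fun h3 => ?_)
    rcases Sym2.mem_iff.1 h3 with h3 | h3
    · exact hne h1 h3
    · exact hne h2 h3
  · intro v w x y h h' hn
    rw [hE v w h, hE x y h']
    refine apart_of_farApart (f2 _ _ fun e => hn ?_)
    rcases Sym2.eq_iff.1 (congrArg Subtype.val e) with ⟨e1, e2⟩ | ⟨e1, e2⟩
    · exact Or.inl ⟨(Vx.toSigma_injective e1).symm, (Vx.toSigma_injective e2).symm⟩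
    · exact Or.inr ⟨(Vx.toSigma_injective e2).symm, (Vx.toSigma_injective e1).symm⟩

end NSS

theorem mainTheorem4 (k d : ℕ) (hk : 1 ≤ k) (hd : 1 ≤ d) :
    ¬ FatMinor.IsFatMinor 9 (SimpleGraph.completeMultipartiteGraph fun _ : Fin 3 => Fin 2)
      (NSS.graph k d) := by
  obtain ⟨n, rfl⟩ : ∃ n, k = n + 1 := ⟨k - 1, by omega⟩
  rintro ⟨M, hM⟩
  obtain ⟨C⟩ := NSS.nonempty_config hd M hM
  exact (NSS.Config.isEmpty hd).false C
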